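/- Let $\mathbb{K}\in\{\mathbb{R},\mathbb{C}\}$, $\rho=[\mathbb{K}:\mathbb{R}]$, $|x|_{\mathbb{K}}=|x|^{\rho}$, $G=\mathrm{SL}_2(\mathbb{K})$, and let $K$ be $\mathrm{SO}_2(\mathbb{R})$ or $\mathrm{SU}_2(\mathbb{C})$, respectively. Put $a(t)=\mathrm{diag}(e^{t/2},e^{-t/2})$, $n(z)=\begin{pmatrix}1&z\\0&1\end{pmatrix}$, let $dk$ be the Haar probability measure on $K$ and $dz$ the Lebesgue measure on $\mathbb{K}$, and use on $G$ the Haar measure $$\int_G f(g)\,dg=\int_K\int_{\mathbb{K}}\int_{\mathbb{R}}f(a(t)n(z)k)\,dt\,dz\,dk.$$ For $g\in G$ let $H(g)\ge 0$ be given by $\cosh H(g)=\frac12\mathrm{tr}(gg^*)$, and put $B(R)=\{g\in G: H(g)\le R\}$. For $s\in\mathbb{C}$ let $\phi_s(g)=\int_K v_s(kg)\,dk$ with $v_s(n(z)a(\log y)k)=|y|_{\mathbb{K}}^{s+1/2}$ ($z\in\mathbb{K}$, $y>0$, $k\in K$) be the elementary spherical function, and let $\widehat f(s)=\int_G f(g)\phi_s(g)\,dg$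 be the spherical transform of a compactly supported bi-$K$-invariant function $f$. For $\gamma\in G$ let $\Delta(\gamma)=\mathrm{tr}(\gamma)^2-4$; $\gamma$ is regular semisimple if $\Delta(\gamma)\ne0$. Its centralizer $G_\gamma$ is then conjugate in $G$ to exactly one of the diagonal subgroup $D$ and $K$. It carries the Haar measure transported by conjugation from $D$ (with $dt$ times the Haar probability measure on $D\cap K$, where $D=\{a(t)\}\cdot(D\cap K)$) or from $K$ (with $dk$), and $G_\gamma\backslash G$ carries the corresponding right $G$-invariant quotient measure, characterized by $\int_G f(g)\,dg=\int_{G_\gamma\backslash G}\int_{G_\gamma}f(hg)\,dh\,d\dot g$ for $f\in C_c(G)$. Let $\mathbf{O}(\gamma,f)=\int_{G_\gamma\backslash G}f(g^{-1}\gamma g)\,d\dot g$. Proposition. There exist absolute constants $c,C>0$ such that for each $\mathbb{K}\in\{\mathbb{R},\mathbb{C}\}$ and every $R\ge0$ there is a smooth, compactly supported, bi-$K$-invariant function $u:G\to\mathbb{C}$ such that, with $\check u(g)=\overline{u(g^{-1})}$ and $(u*\check u)(g)=\int_G u(x)\check u(x^{-1}g)\,dx$, the function $F=u*\check u$ is positive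 definite and bi-$K$-invariant, and it has the following properties: - $\widehat F(\sigma)$ is real and $\widehat F(\sigma)\ge c\,e^{2\rho R|\sigma|}$ for every $\sigma\in[-1,1]$; - $F$ is supported in $B(2R+2)$, and $|F(g)|\le C$ for every $g\in G$; - $|\Delta(\gamma)|_{\mathbb{K}}^{1/2}\,|\mathbf{O}(\gamma,F)|\le C$ for every regular semisimple $\gamma\in G$. -/

import Mathlib

open MeasureTheory TopologicalSpace
open scoped ENNReal ContDiff MatrixGroups ComplexOrder

namespace SphericalSL2

noncomputable section

/-! Throughout, `𝕂` stands for `ℝ` or `ℂ` with its standard Lebesgue measure (`dx`, resp. `dx dy`),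
and `G = SL(2, 𝕂)`. -/

/-- The Borel `σ`-algebra on `SL₂(𝕂)`. -/
instance instMeasurableSpaceSL (𝕂 : Type*) [RCLike 𝕂] : MeasurableSpace SL(2, 𝕂) := borel _

instance instBorelSpaceSL (𝕂 : Type*) [RCLike 𝕂] : BorelSpace SL(2, 𝕂) := ⟨rfl⟩

section Subgroups

variable (𝕂 : Type*) [RCLike 𝕂]

/-- The maximal compact subgroup `K` of `SL₂(𝕂)`: `SO₂(ℝ)` for `𝕂 = ℝ` and `SU₂(ℂ)` for
`𝕂 = ℂ`. -/
def maxCompact : Subgroup SL(2, 𝕂) where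
  carrier := {g | (g : Matrix (Fin 2) (Fin 2) 𝕂) ∈ Matrix.unitaryGroup (Fin 2) 𝕂}
  one_mem' := by
    simp only [Set.mem_ofPred_eq, Matrix.SpecialLinearGroup.coe_one]
    exact one_mem _
  mul_mem' := by
    intro a b ha hb
    simp only [Set.mem_ofPred_eq, Matrix.SpecialLinearGroup.coe_mul] at *
    exact mul_mem ha hb
  inv_mem' := by
    intro a ha
    simp only [Set.mem_ofPred_eq] at *
    have h1 : (a : Matrix (Fin 2) (Fin 2) 𝕂) * ((a⁻¹ : SL(2, 𝕂)) : Matrix (Fin 2) (Fin 2) 𝕂) = 1 := by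
      rw [← Matrix.SpecialLinearGroup.coe_mul, mul_inv_cancel, Matrix.SpecialLinearGroup.coe_one]
    have h2 : ((a⁻¹ : SL(2, 𝕂)) : Matrix (Fin 2) (Fin 2) 𝕂)
        = star (a : Matrix (Fin 2) (Fin 2) 𝕂) := by
      have h3 := (Matrix.mem_unitaryGroup_iff'.1 ha)
      calc ((a⁻¹ : SL(2, 𝕂)) : Matrix (Fin 2) (Fin 2) 𝕂)
          = (star (a : Matrix (Fin 2) (Fin 2) 𝕂) * (a : Matrix (Fin 2) (Fin 2) 𝕂))
              * ((a⁻¹ : SL(2, 𝕂)) : Matrix (Fin 2) (Fin 2) 𝕂) := by rw [h3, one_mul]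
        _ = star (a : Matrix (Fin 2) (Fin 2) 𝕂) := by rw [mul_assoc, h1, mul_one]
    rw [h2]
    exact Unitary.star_mem ha

/-- The subgroup `D` of diagonal matrices in `SL₂(𝕂)`. -/
def diagSubgroup : Subgroup SL(2, 𝕂) where
  carrier := {g | g 0 1 = 0 ∧ g 1 0 = 0}
  one_mem' := by simp
  mul_mem' := by
    rintro a b ⟨ha, ha'⟩ ⟨hb, hb'⟩
    simp only [Set.mem_ofPred_eq, Matrix.SpecialLinearGroup.coe_mul, Matrix.mul_apply,
      Fin.sum_univ_two]
    rw [ha, ha', hb, hb']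
    simp
  inv_mem' := by
    rintro a ⟨ha, ha'⟩
    simp only [Set.mem_ofPred_eq, Matrix.SpecialLinearGroup.coe_inv, Matrix.adjugate_fin_two]
    simp [ha, ha']

/-- The maximal compact subgroup `T = D ∩ K` of `D`. -/
def compactTorus : Subgroup SL(2, 𝕂) := diagSubgroup 𝕂 ⊓ maxCompact 𝕂

theorem isClosed_diagSubgroup : IsClosed (diagSubgroup 𝕂 : Set SL(2, 𝕂)) := by
  have hc : ∀ i j : Fin 2, Continuous fun g : SL(2, 𝕂) => g i j := fun i j =>
    (continuous_apply j).comp ((continuous_apply i).comp continuous_subtype_val)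
  exact (isClosed_eq (hc 0 1) continuous_const).inter (isClosed_eq (hc 1 0) continuous_const)

theorem isCompact_maxCompact : IsCompact (maxCompact 𝕂 : Set SL(2, 𝕂)) := by
  have hemb : Topology.IsClosedEmbedding
      (Subtype.val : SL(2, 𝕂) → Matrix (Fin 2) (Fin 2) 𝕂) := by
    refine IsClosed.isClosedEmbedding_subtypeVal ?_
    exact isClosed_eq (Continuous.matrix_det continuous_id) continuous_const
  have hU : IsCompact {M : Matrix (Fin 2) (Fin 2) 𝕂 | M ∈ Matrix.unitaryGroup (Fin 2) 𝕂} := by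
    have hbox : IsCompact (Set.univ.pi fun _ : Fin 2 => Set.univ.pi fun _ : Fin 2 =>
        Metric.closedBall (0 : 𝕂) 1) :=
      isCompact_univ_pi fun _ => isCompact_univ_pi fun _ => isCompact_closedBall _ _
    refine hbox.of_isClosed_subset ?_ ?_
    · have : {M : Matrix (Fin 2) (Fin 2) 𝕂 | M ∈ Matrix.unitaryGroup (Fin 2) 𝕂}
          = {M | M * star M = 1} := by
        ext M; exact Matrix.mem_unitaryGroup_iff
      rw [this]
      exact isClosed_eq (continuous_id.matrix_mul continuous_id.matrix_conjTranspose)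
        continuous_const
    · intro M hM i _ j _
      simpa using entry_norm_bound_of_unitary hM i j
  exact hemb.isCompact_preimage hU

instance instCompactSpaceMaxCompact : CompactSpace (maxCompact 𝕂) :=
  isCompact_iff_compactSpace.1 (isCompact_maxCompact 𝕂)

instance instCompactSpaceCompactTorus : CompactSpace (compactTorus 𝕂) :=
  isCompact_iff_compactSpace.1 <|
    (isCompact_maxCompact 𝕂).of_isClosed_subset
      ((isClosed_diagSubgroup 𝕂).inter (isCompact_maxCompact 𝕂).isClosed) Set.inter_subset_right

end Subgroups

variable {𝕂 : Type} [RCLike 𝕂]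

/-- The Haar probability measure of a compact subgroup `H` of `SL₂(𝕂)`, regarded as a measure on
`SL₂(𝕂)`. -/
def haarProb (H : Subgroup SL(2, 𝕂)) [CompactSpace H] : Measure SL(2, 𝕂) :=
  (Measure.haarMeasure (⊤ : PositiveCompacts H)).map Subtype.val

/-- `ρ = [𝕂 : ℝ]`. -/
def degree (𝕂 : Type) [RCLike 𝕂] : ℕ := Module.finrank ℝ 𝕂

/-- The module function `|x|_𝕂 = |x| ^ ρ`. -/
def modulus (x : 𝕂) : ℝ := ‖x‖ ^ degree 𝕂

/-- `a(t) = diag(e^{t/2}, e^{-t/2})`. -/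
def aMat (t : ℝ) : SL(2, 𝕂) :=
  ⟨!![((Real.exp (t / 2) : ℝ) : 𝕂), 0; 0, ((Real.exp (-t / 2) : ℝ) : 𝕂)], by
    rw [Matrix.det_fin_two_of, ← RCLike.ofReal_mul, ← Real.exp_add]
    ring_nf
    simp⟩

/-- `n(z)`, the upper triangular unipotent matrix with upper right entry `z`. -/
def nMat (z : 𝕂) : SL(2, 𝕂) := ⟨!![1, z; 0, 1], by simp [Matrix.det_fin_two_of]⟩

/-- The Haar measure on `G`, through the Iwasawa decomposition `G = ANK`:
`∫_G f = ∫_K ∫_N ∫_A f(ank) da dn dk`, where `da = dt`, `dn = dz` (Lebesgue) and `dk` is the Haar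
probability measure on `K`. -/
def haarG (𝕂 : Type) [RCLike 𝕂] [MeasureSpace 𝕂] : Measure SL(2, 𝕂) :=
  ((volume : Measure ℝ).prod ((volume : Measure 𝕂).prod (haarProb (maxCompact 𝕂)))).map
    fun p => aMat p.1 * nMat p.2.1 * p.2.2

/-- The Haar measure on `D = AT`: the product of `da = dt` on `A` and of the Haar probability
measure on `T`, regarded as a measure on `G`. -/
def haarD (𝕂 : Type) [RCLike 𝕂] : Measure SL(2, 𝕂) :=
  ((volume : Measure ℝ).prod (haarProb (compactTorus 𝕂))).map fun p => aMat p.1 * p.2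

/-- `cosh H(g) = tr(g g*) / 2`. -/
def coshHeight (g : SL(2, 𝕂)) : ℝ := (∑ i, ∑ j, ‖g i j‖ ^ 2) / 2

/-- The height `H(g) ≥ 0`, for which `g ∈ K a(H(g)) K`; that is, `cosh H(g) = tr(g g*) / 2`. -/
def height (g : SL(2, 𝕂)) : ℝ := Real.arcosh (coshHeight g)

/-- `B(R) = {g ∈ G : H(g) ≤ R}`. -/
def heightBall (𝕂 : Type) [RCLike 𝕂] (R : ℝ) : Set SL(2, 𝕂) := {g | height g ≤ R}

/-- `f` is bi-`K`-invariant, i.e. a (spherical) function on `K \ G / K`. -/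
def IsSpherical (f : SL(2, 𝕂) → ℂ) : Prop :=
  ∀ k₁ ∈ maxCompact 𝕂, ∀ k₂ ∈ maxCompact 𝕂, ∀ g, f (k₁ * g * k₂) = f g

/-- Smoothness of a function on `G`. As `G` is a closed submanifold of the real vector space of
`2 × 2` matrices over `𝕂`, the smooth functions on `G` are the restrictions of the smooth functions
on this vector space. -/
def IsSmooth (f : SL(2, 𝕂) → ℂ) : Prop :=
  ∃ f' : (Fin 2 → Fin 2 → 𝕂) → ℂ, ContDiff ℝ ∞ f' ∧ ∀ g : SL(2, 𝕂), f g = f' fun i j => g i j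

/-- `f ∈ C_c^∞(K \ G / K)`. -/
structure IsTestFunction (f : SL(2, 𝕂) → ℂ) : Prop where
  smooth : IsSmooth f
  hasCompactSupport : HasCompactSupport f
  spherical : IsSpherical f

/-- `ǔ(g) = conj (u(g⁻¹))`. -/
def check (u : SL(2, 𝕂) → ℂ) (g : SL(2, 𝕂)) : ℂ := (starRingEnd ℂ) (u g⁻¹)

/-- The convolution `(u ∗ v)(g) = ∫_G u(x) v(x⁻¹ g) dx`. -/
def conv [MeasureSpace 𝕂] (u v : SL(2, 𝕂) → ℂ) (g : SL(2, 𝕂)) : ℂ :=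
  ∫ x, u x * v (x⁻¹ * g) ∂haarG 𝕂

/-- Positive definiteness: every matrix `(f(g_i⁻¹ g_j))_{i,j}` is positive semidefinite. -/
def IsPositiveDefinite (f : SL(2, 𝕂) → ℂ) : Prop :=
  ∀ (n : ℕ) (g : Fin n → SL(2, 𝕂)),
    (Matrix.of fun i j => f ((g i)⁻¹ * g j) : Matrix (Fin n) (Fin n) ℂ).PosSemidef

/-- The `A`-component in the Iwasawa decomposition: `iwasawaY (n(z) a(log y) k) = y` for `z ∈ 𝕂`,
`y > 0`, `k ∈ K`. Indeed, the bottom row of `n(z) a(log y) k` is `y^{-1/2}` times that of `k`. -/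
def iwasawaY (g : SL(2, 𝕂)) : ℝ := (‖g 1 0‖ ^ 2 + ‖g 1 1‖ ^ 2)⁻¹

/-- The `K`-invariant unit vector `v_s` in the spherical principal series representation `π_s`
(right translation) that is unitarily induced from the character `diag(y^{1/2}, y^{-1/2}) ↦ |y|_𝕂^s`
of the upper triangular group: `v_s(n a(log y) k) = |y|_𝕂^{s + 1/2}`. -/
def sphericalVector (s : ℂ) (g : SL(2, 𝕂)) : ℂ :=
  ((iwasawaY g ^ degree 𝕂 : ℝ) : ℂ) ^ (s + 1 / 2)

/-- The elementary spherical function `φ_s(g) = ⟨π_s(g) v_s, v_s⟩ = ∫_K v_s(k g) dk` (note that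
`v_s = 1` on `K`), of normalized Casimir eigenvalue `1/4 - s²`. -/
def sphericalFunction (s : ℂ) (g : SL(2, 𝕂)) : ℂ :=
  ∫ k, sphericalVector s (k * g) ∂haarProb (maxCompact 𝕂)

/-- The spherical transform `f̂(s) = ∫_G f(g) φ_s(g) dg`. -/
def sphericalTransform [MeasureSpace 𝕂] (f : SL(2, 𝕂) → ℂ) (s : ℂ) : ℂ :=
  ∫ g, f g * sphericalFunction s g ∂haarG 𝕂

/-- The Weyl discriminant `Δ(γ) = (w - w⁻¹)² = tr(γ)² - 4`, where `w, w⁻¹` are the eigenvalues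
of `γ`. -/
def weylDisc (γ : SL(2, 𝕂)) : 𝕂 := (γ : Matrix (Fin 2) (Fin 2) 𝕂).trace ^ 2 - 4

/-- `γ` is regular semisimple: its eigenvalues `w, w⁻¹` are distinct. -/
def IsRegularSemisimple (γ : SL(2, 𝕂)) : Prop := weylDisc γ ≠ 0

open Classical in
/-- The Haar measure on the centralizer `G_γ` of a regular semisimple `γ`, regarded as a measure on
`G`: `G_γ` is conjugate to exactly one of `D` and `K`, and the Haar measure of that group is
transported to `G_γ` by a conjugation (the result is independent of the choice of conjugation). The
last case does not occur for regular semisimple `γ`. -/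
def haarCentralizer (γ : SL(2, 𝕂)) : Measure SL(2, 𝕂) :=
  if h : ∃ p : SL(2, 𝕂), p⁻¹ * γ * p ∈ diagSubgroup 𝕂 then
    (haarD 𝕂).map fun d => h.choose * d * h.choose⁻¹
  else if h : ∃ p : SL(2, 𝕂), p⁻¹ * γ * p ∈ maxCompact 𝕂 then
    (haarProb (maxCompact 𝕂)).map fun k => h.choose * k * h.choose⁻¹
  else 0

/-- The coset space `G_γ \ G`. -/
abbrev CentralizerQuotient (γ : SL(2, 𝕂)) : Type :=
  Quotient (QuotientGroup.rightRel (Subgroup.centralizer {γ}))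

/-- A positive weight on `G` that is integrable over every coset `G_γ g`, `γ` regular
semisimple. -/
def cosetWeight (g : SL(2, 𝕂)) : ℝ≥0∞ := ENNReal.ofReal (Real.exp (-coshHeight g))

/-- The unique right `G`-invariant measure on `G_γ \ G` satisfying
`∫_G f(g) dg = ∫_{G_γ \ G} (∫_{G_γ} f(h g) dh) dġ`. It is constructed as the image of
`β(g) dg` on `G_γ \ G`, where `β ≥ 0` is a function on `G` with `∫_{G_γ} β(h g) dh = 1` for all `g`:
then `∫_G β(g) ∫_{G_γ} f(h g) dh dg = ∫_G f(g) ∫_{G_γ} β(h⁻¹ g) dh dg = ∫_G f(g) dg`. -/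
def quotientMeasure [MeasureSpace 𝕂] (γ : SL(2, 𝕂)) : Measure (CentralizerQuotient γ) :=
  ((haarG 𝕂).withDensity fun g =>
    cosetWeight g / ∫⁻ h, cosetWeight (h * g) ∂haarCentralizer γ).map (Quotient.mk _)

/-- The function `G_γ g ↦ f(g⁻¹ γ g)` on `G_γ \ G`. -/
def orbitFunction (γ : SL(2, 𝕂)) (f : SL(2, 𝕂) → ℂ) : CentralizerQuotient γ → ℂ :=
  Quotient.lift (fun g => f (g⁻¹ * γ * g)) <| by
    intro a b hab
    have h : b * a⁻¹ ∈ Subgroup.centralizer {γ} := QuotientGroup.rightRel_apply.1 hab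
    rw [Subgroup.mem_centralizer_singleton_iff] at h
    have : a⁻¹ * γ * a = b⁻¹ * γ * b := by
      calc a⁻¹ * γ * a = b⁻¹ * (b * a⁻¹ * γ) * a := by group
        _ = b⁻¹ * (γ * (b * a⁻¹)) * a := by rw [h]
        _ = b⁻¹ * γ * b := by group
    simp only [this]

/-- The orbital integral `O(γ, f) = ∫_{G_γ \ G} f(g⁻¹ γ g) dġ`. -/
def orbitalIntegral [MeasureSpace 𝕂] (γ : SL(2, 𝕂)) (f : SL(2, 𝕂) → ℂ) : ℂ :=
  ∫ x, orbitFunction γ f x ∂quotientMeasure γ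

end

end SphericalSL2

/-! The construction goes through the Abel (Harish-Chandra) transform `abelTransform`, that is, the
integral of a spherical function along `a(t)N` weighted by `e^{ρt/2}`. It controls every quantity in
the theorem. On continuous compactly supported spherical functions it turns convolution on `G` into
convolution on `ℝ` (`abelTransform_conv`), and the spherical transform at `σ` is its Laplace
transform (`sphericalTransform_eq_integral_abelTransform`). For split `γ` the normalized orbital
integral has the absolute value of one of its values (`exists_orbitalIntegral_eq_abelTransform`).
For elliptic `γ`, which occur only over `ℝ`, the normalized orbital integral is at most `2π` times
its supremum (`norm_orbitalIntegral_elliptic_le`).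

So it suffices to find `u` whose Abel transform is a good even function on `ℝ`. The choice is
`coshBump R`, a bump with values in `[0, 1]`, supported where `R ≤ |t| ≤ R + 1`, and equal to one on
a subinterval of length at least `log (12/11)`. Its self-convolution is bounded by 2, which bounds
all orbital integrals. Its Laplace transform at `ρσ` is at least `log (12/11) e^{ρR|σ|}`, and
squaring this gives the lower bound for the transform of `F`.

The Abel transform of a function of `cosh H(g)` is an integral of the profile over `y + ‖w‖²`, `w ∈
𝕂`. It is inverted explicitly, by a derivative over `ℂ` and by a derivative followed by one more
integration over `ℝ` (`exists_profile_complex`, `exists_profile_real`). The bump is a function of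
`e^{-R} cosh t`, so a single profile `φ`, independent of `R`, serves for all `R` after rescaling
(`abelTransform_radialFun`). Hence `|u|` is `O(e^{-ρR/2})` on a set of volume `O(e^{ρR})`, and `F`
is bounded uniformly in `R`. Positive definiteness holds because `F` is a matrix coefficient of
translates of `u` in `L²(G)`.

The rest is harmonic analysis on `SL₂` from the explicit definitions: the Cartan, Iwasawa and Bruhat
decompositions, invariance of the measures, and independence of the orbital integral from the weight
that defines the quotient measure. -/

namespace SphericalSL2

noncomputable section

set_option linter.unusedSectionVars false

section Field

variable {𝕂 : Type} [RCLike 𝕂]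

local notation "conj" => starRingEnd 𝕂

/-! ### Matrix entries, relations between `A` and `N`, and the explicit form of `K`. -/

section Entries

@[simp] theorem aMat_zero_zero (t : ℝ) : (aMat t : SL(2, 𝕂)) 0 0 = ((Real.exp (t / 2) : ℝ) : 𝕂) := rfl
@[simp] theorem aMat_zero_one (t : ℝ) : (aMat t : SL(2, 𝕂)) 0 1 = 0 := rfl
@[simp] theorem aMat_one_zero (t : ℝ) : (aMat t : SL(2, 𝕂)) 1 0 = 0 := rfl
@[simp] theorem aMat_one_one (t : ℝ) : (aMat t : SL(2, 𝕂)) 1 1 = ((Real.exp (-t / 2) : ℝ) : 𝕂) := rfl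
@[simp] theorem nMat_zero_zero (z : 𝕂) : nMat z 0 0 = 1 := rfl
@[simp] theorem nMat_zero_one (z : 𝕂) : nMat z 0 1 = z := rfl
@[simp] theorem nMat_one_zero (z : 𝕂) : nMat z 1 0 = 0 := rfl
@[simp] theorem nMat_one_one (z : 𝕂) : nMat z 1 1 = 1 := rfl

theorem mul_entry (g h : SL(2, 𝕂)) (i j : Fin 2) :
    (g * h) i j = g i 0 * h 0 j + g i 1 * h 1 j := by
  simp [Matrix.mul_apply, Fin.sum_univ_two]

theorem inv_zero_zero (g : SL(2, 𝕂)) : g⁻¹ 0 0 = g 1 1 := by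
  simp [Matrix.SpecialLinearGroup.coe_inv, Matrix.adjugate_fin_two]
theorem inv_zero_one (g : SL(2, 𝕂)) : g⁻¹ 0 1 = -g 0 1 := by
  simp [Matrix.SpecialLinearGroup.coe_inv, Matrix.adjugate_fin_two]
theorem inv_one_zero (g : SL(2, 𝕂)) : g⁻¹ 1 0 = -g 1 0 := by
  simp [Matrix.SpecialLinearGroup.coe_inv, Matrix.adjugate_fin_two]
theorem inv_one_one (g : SL(2, 𝕂)) : g⁻¹ 1 1 = g 0 0 := by
  simp [Matrix.SpecialLinearGroup.coe_inv, Matrix.adjugate_fin_two]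

theorem det_entries (g : SL(2, 𝕂)) : g 0 0 * g 1 1 - g 0 1 * g 1 0 = 1 := by
  have := g.2
  rwa [Matrix.det_fin_two] at this

theorem ext_entries {g h : SL(2, 𝕂)} (h00 : g 0 0 = h 0 0) (h01 : g 0 1 = h 0 1)
    (h10 : g 1 0 = h 1 0) (h11 : g 1 1 = h 1 1) : g = h := by
  ext i j
  fin_cases i <;> fin_cases j <;> assumption

theorem aMat_add (s t : ℝ) : (aMat (s + t) : SL(2, 𝕂)) = aMat s * aMat t := by
  apply ext_entries <;> simp [mul_entry, ← RCLike.ofReal_mul, ← Real.exp_add] <;> ring_nf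

@[simp] theorem aMat_zero : (aMat 0 : SL(2, 𝕂)) = 1 := by
  apply ext_entries <;> simp

theorem aMat_neg (t : ℝ) : (aMat (-t) : SL(2, 𝕂)) = (aMat t)⁻¹ := by
  rw [eq_inv_iff_mul_eq_one, ← aMat_add]; simp

theorem nMat_add (y z : 𝕂) : nMat (y + z) = nMat y * nMat z := by
  apply ext_entries <;> simp [mul_entry, add_comm]

@[simp] theorem nMat_zero : nMat (0 : 𝕂) = 1 := by
  apply ext_entries <;> simp

theorem nMat_neg (z : 𝕂) : nMat (-z) = (nMat z)⁻¹ := by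
  rw [eq_inv_iff_mul_eq_one, ← nMat_add]; simp

theorem exp_half_mul_self (t : ℝ) : Real.exp (t / 2) * Real.exp (t / 2) = Real.exp t := by
  rw [← Real.exp_add]; ring_nf

theorem nMat_mul_aMat (z : 𝕂) (t : ℝ) :
    nMat z * aMat t = aMat t * nMat (((Real.exp (-t) : ℝ) : 𝕂) * z) := by
  apply ext_entries
  · simp [mul_entry]
  · simp only [mul_entry, nMat_zero_zero, aMat_zero_one, nMat_zero_one, aMat_one_one, aMat_zero_zero,
      nMat_one_one, mul_zero, zero_add, zero_mul, add_zero]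
    rw [← mul_assoc, ← RCLike.ofReal_mul, ← Real.exp_add, mul_comm]
    ring_nf
  · simp [mul_entry]
  · simp [mul_entry]

theorem mem_maxCompact_iff_mul_star {g : SL(2, 𝕂)} : g ∈ maxCompact 𝕂 ↔
    (g : Matrix (Fin 2) (Fin 2) 𝕂) * (g : Matrix (Fin 2) (Fin 2) 𝕂).conjTranspose = 1 :=
  Matrix.mem_unitaryGroup_iff

/-- The inverse of a matrix of determinant one is its adjugate, so unitarity is an entrywise
identity between adjugate and conjugate transpose. -/
theorem mem_maxCompact_iff {g : SL(2, 𝕂)} :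
    g ∈ maxCompact 𝕂 ↔ g 1 1 = conj (g 0 0) ∧ g 1 0 = -conj (g 0 1) := by
  have hinv : g ∈ maxCompact 𝕂 ↔ ((g⁻¹ : SL(2, 𝕂)) : Matrix (Fin 2) (Fin 2) 𝕂) =
      (g : Matrix (Fin 2) (Fin 2) 𝕂).conjTranspose := by
    rw [mem_maxCompact_iff_mul_star]
    have h1 : ((g⁻¹ : SL(2, 𝕂)) : Matrix (Fin 2) (Fin 2) 𝕂) * g = 1 := by
      rw [← Matrix.SpecialLinearGroup.coe_mul, inv_mul_cancel, Matrix.SpecialLinearGroup.coe_one]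
    have h2 : (g : Matrix (Fin 2) (Fin 2) 𝕂) * (g⁻¹ : SL(2, 𝕂)) = 1 := by
      rw [← Matrix.SpecialLinearGroup.coe_mul, mul_inv_cancel, Matrix.SpecialLinearGroup.coe_one]
    constructor
    · intro h
      calc _ = ((g⁻¹ : SL(2, 𝕂)) : Matrix (Fin 2) (Fin 2) 𝕂) * (g *
            (g : Matrix (Fin 2) (Fin 2) 𝕂).conjTranspose) := by rw [h, mul_one]
        _ = _ := by rw [← mul_assoc, h1, one_mul]
    · intro h
      rw [← h, h2]
  rw [hinv]
  constructor
  · intro h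
    refine ⟨?_, ?_⟩
    · have := congrFun (congrFun h 0) 0
      rwa [inv_zero_zero] at this
    · have := congrFun (congrFun h 1) 0
      rw [inv_one_zero] at this
      rw [← neg_eq_iff_eq_neg]
      simpa using this
  · rintro ⟨h1, h2⟩
    ext i j
    fin_cases i <;> fin_cases j
    · simpa [inv_zero_zero] using h1
    · simp [inv_zero_one, h2]
    · simp [inv_one_zero, h2]
    · simp [inv_one_one, h1]

theorem norm_sq_add_of_mem_maxCompact {k : SL(2, 𝕂)} (hk : k ∈ maxCompact 𝕂) :
    ‖k 0 0‖ ^ 2 + ‖k 0 1‖ ^ 2 = 1 := by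
  obtain ⟨h1, h2⟩ := mem_maxCompact_iff.1 hk
  have := det_entries k
  rw [h1, h2, mul_neg, sub_neg_eq_add, RCLike.mul_conj, RCLike.mul_conj] at this
  exact_mod_cast this

end Entries

/-! ### The height function and the Cartan decomposition. -/

section Height

theorem coshHeight_eq (g : SL(2, 𝕂)) :
    coshHeight g = (‖g 0 0‖ ^ 2 + ‖g 0 1‖ ^ 2 + ‖g 1 0‖ ^ 2 + ‖g 1 1‖ ^ 2) / 2 := by
  simp [coshHeight, Fin.sum_univ_two]; ring

theorem ofReal_coshHeight (g : SL(2, 𝕂)) : ((2 * coshHeight g : ℝ) : 𝕂) =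
    ((g : Matrix (Fin 2) (Fin 2) 𝕂) * (g : Matrix (Fin 2) (Fin 2) 𝕂).conjTranspose).trace := by
  rw [coshHeight_eq, mul_div_cancel₀ _ (two_ne_zero' ℝ)]
  simp [Matrix.trace_fin_two, Matrix.mul_apply, Fin.sum_univ_two, RCLike.mul_conj]
  ring

theorem coshHeight_inv (g : SL(2, 𝕂)) : coshHeight g⁻¹ = coshHeight g := by
  rw [coshHeight_eq, coshHeight_eq, inv_zero_zero, inv_zero_one, inv_one_zero, inv_one_one,
    norm_neg, norm_neg]
  ring

theorem coshHeight_mul_right {k : SL(2, 𝕂)} (hk : k ∈ maxCompact 𝕂) (g : SL(2, 𝕂)) :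
    coshHeight (g * k) = coshHeight g := by
  have : ((2 * coshHeight (g * k) : ℝ) : 𝕂) = ((2 * coshHeight g : ℝ) : 𝕂) := by
    rw [ofReal_coshHeight, ofReal_coshHeight, Matrix.SpecialLinearGroup.coe_mul,
      Matrix.conjTranspose_mul, mul_assoc, ← mul_assoc (k : Matrix (Fin 2) (Fin 2) 𝕂),
      mem_maxCompact_iff_mul_star.1 hk, one_mul]
  have := RCLike.ofReal_injective this
  linarith

theorem coshHeight_mul_left {k : SL(2, 𝕂)} (hk : k ∈ maxCompact 𝕂) (g : SL(2, 𝕂)) :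
    coshHeight (k * g) = coshHeight g := by
  rw [← coshHeight_inv, mul_inv_rev, coshHeight_mul_right (inv_mem hk), coshHeight_inv]

theorem coshHeight_aMat_mul_nMat (t : ℝ) (z : 𝕂) :
    coshHeight (aMat t * nMat z) = Real.cosh t + Real.exp t * ‖z‖ ^ 2 / 2 := by
  rw [coshHeight_eq]
  simp only [mul_entry, aMat_zero_zero, nMat_zero_zero, mul_one, aMat_zero_one, nMat_one_zero,
    mul_zero, add_zero, nMat_zero_one, nMat_one_one, zero_add, norm_mul, aMat_one_zero, norm_zero,
    zero_mul, aMat_one_one, RCLike.norm_ofReal, Real.abs_exp, Real.cosh_eq]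
  have h1 : Real.exp (t / 2) ^ 2 = Real.exp t := by rw [sq, exp_half_mul_self]
  have h2 : Real.exp (-t / 2) ^ 2 = Real.exp (-t) := by rw [sq, exp_half_mul_self]
  rw [mul_pow, h1, h2]
  ring

@[simp] theorem coshHeight_aMat (t : ℝ) : coshHeight (aMat t : SL(2, 𝕂)) = Real.cosh t := by
  simpa using coshHeight_aMat_mul_nMat t (0 : 𝕂)

/-- A representative in `maxCompact` of the non-trivial Weyl group element. -/
def weylMat (𝕂 : Type) [RCLike 𝕂] : SL(2, 𝕂) := ⟨!![0, 1; -1, 0], by simp [Matrix.det_fin_two_of]⟩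

@[simp] theorem weylMat_zero_zero : weylMat 𝕂 0 0 = 0 := rfl
@[simp] theorem weylMat_zero_one : weylMat 𝕂 0 1 = 1 := rfl
@[simp] theorem weylMat_one_zero : weylMat 𝕂 1 0 = -1 := rfl
@[simp] theorem weylMat_one_one : weylMat 𝕂 1 1 = 0 := rfl

theorem weylMat_mem_maxCompact : weylMat 𝕂 ∈ maxCompact 𝕂 := by
  rw [mem_maxCompact_iff]; simp

theorem weylMat_mul_aMat (t : ℝ) : weylMat 𝕂 * aMat t = aMat (-t) * weylMat 𝕂 := by
  apply ext_entries <;> simp [mul_entry]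

/-- Diagonalize `g g*` by some `k₁ ∈ K`. Its eigenvalues are `e^t` and `e^{-t}` since the
determinant is one, and then `(k₁ a(t))⁻¹ g` is unitary. -/
theorem exists_eq_mul_aMat_mul (g : SL(2, 𝕂)) :
    ∃ k₁ ∈ maxCompact 𝕂, ∃ k₂ ∈ maxCompact 𝕂, ∃ t : ℝ, g = k₁ * aMat t * k₂ := by
  set P : Matrix (Fin 2) (Fin 2) 𝕂 :=
    (g : Matrix (Fin 2) (Fin 2) 𝕂) * (g : Matrix (Fin 2) (Fin 2) 𝕂).conjTranspose with hP
  have hps : P.PosSemidef := Matrix.posSemidef_self_mul_conjTranspose _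
  have hH : P.IsHermitian := hps.1
  set U : Matrix (Fin 2) (Fin 2) 𝕂 := hH.eigenvectorUnitary.1 with hU
  set l := hH.eigenvalues with hl
  have hUU : U * U.conjTranspose = 1 := Matrix.mem_unitaryGroup_iff.1 hH.eigenvectorUnitary.2
  have hUU' : U.conjTranspose * U = 1 := Matrix.mem_unitaryGroup_iff'.1 hH.eigenvectorUnitary.2
  have hspec : P = U * Matrix.diagonal (RCLike.ofReal ∘ l) * U.conjTranspose := hH.spectral_theorem
  have hl0 : ∀ i, 0 ≤ l i := fun i => hps.eigenvalues_nonneg i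
  have hdetP : P.det = 1 := by
    rw [hP, Matrix.det_mul, Matrix.det_conjTranspose, g.2]; simp
  have hll : l 0 * l 1 = 1 := by
    have h := hH.det_eq_prod_eigenvalues
    rw [hdetP, Fin.prod_univ_two] at h
    exact_mod_cast h.symm
  have hl0' : 0 < l 0 := lt_of_le_of_ne (hl0 0) (by rintro h; rw [← h] at hll; simp at hll)
  have hl1 : l 1 = (l 0)⁻¹ := eq_inv_of_mul_eq_one_right hll
  set δ : 𝕂 := U.det with hδ
  have hδ1 : δ * conj δ = 1 := by
    have := congrArg Matrix.det hUU
    rwa [Matrix.det_mul, Matrix.det_conjTranspose, Matrix.det_one] at this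
  -- Rescaling the second eigenvector by a unit makes the determinant one without affecting the
  -- diagonalization.
  set V : Matrix (Fin 2) (Fin 2) 𝕂 := U * Matrix.diagonal ![1, conj δ] with hV
  have hVdet : V.det = 1 := by
    rw [hV, Matrix.det_mul, Matrix.det_diagonal, Fin.prod_univ_two]; simpa using hδ1
  have hDD : (Matrix.diagonal ![1, conj δ] : Matrix (Fin 2) (Fin 2) 𝕂) *
      (Matrix.diagonal ![1, conj δ]).conjTranspose = 1 := by
    ext i j; fin_cases i <;> fin_cases j <;>
      simp [Matrix.diagonal_conjTranspose, mul_comm, hδ1]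
  have hVV : V * V.conjTranspose = 1 := by
    rw [hV, Matrix.conjTranspose_mul, mul_assoc, ← mul_assoc (Matrix.diagonal _), hDD, one_mul, hUU]
  have hVV' : V.conjTranspose * V = 1 := mul_eq_one_comm.1 hVV
  have hspec' : P = V * Matrix.diagonal (RCLike.ofReal ∘ l) * V.conjTranspose := by
    rw [hspec, hV, Matrix.conjTranspose_mul]
    simp only [mul_assoc]
    congr 1
    simp only [← mul_assoc]
    congr 1
    ext i j; fin_cases i <;> fin_cases j <;>
      simp [Matrix.diagonal_conjTranspose, Matrix.diagonal_mul_diagonal]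
    rw [mul_assoc, mul_comm, mul_assoc, hδ1, mul_one]
  clear_value V
  set k₁ : SL(2, 𝕂) := ⟨V, hVdet⟩ with hk₁
  have hk₁K : k₁ ∈ maxCompact 𝕂 := mem_maxCompact_iff_mul_star.2 hVV
  set t := Real.log (l 0) with ht
  have hexp : Real.exp t = l 0 := Real.exp_log hl0'
  refine ⟨k₁, hk₁K, (k₁ * aMat t)⁻¹ * g, ?_, t, by group⟩
  rw [mem_maxCompact_iff_mul_star, mul_inv_rev, ← aMat_neg]
  have hk₁i : ((k₁⁻¹ : SL(2, 𝕂)) : Matrix (Fin 2) (Fin 2) 𝕂) = V.conjTranspose := by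
    have : ((k₁⁻¹ : SL(2, 𝕂)) : Matrix (Fin 2) (Fin 2) 𝕂) * V = 1 := by
      have : ((k₁⁻¹ * k₁ : SL(2, 𝕂)) : Matrix (Fin 2) (Fin 2) 𝕂) = 1 := by
        rw [inv_mul_cancel, Matrix.SpecialLinearGroup.coe_one]
      rwa [Matrix.SpecialLinearGroup.coe_mul] at this
    calc _ = ((k₁⁻¹ : SL(2, 𝕂)) : Matrix (Fin 2) (Fin 2) 𝕂) * (V * V.conjTranspose) := by
          rw [hVV, mul_one]
      _ = _ := by rw [← mul_assoc, this, one_mul]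
  rw [Matrix.SpecialLinearGroup.coe_mul, Matrix.SpecialLinearGroup.coe_mul, hk₁i,
    Matrix.conjTranspose_mul, Matrix.conjTranspose_mul, Matrix.conjTranspose_conjTranspose V]
  set E : Matrix (Fin 2) (Fin 2) 𝕂 := (aMat (-t) : SL(2, 𝕂)).1 with hE
  calc E * V.conjTranspose * ↑g * ((g : Matrix (Fin 2) (Fin 2) 𝕂).conjTranspose *
          (V * E.conjTranspose)) = E * V.conjTranspose * P * V * E.conjTranspose := by
        rw [hP]; simp only [mul_assoc]
    _ = E * (V.conjTranspose * V) * Matrix.diagonal (RCLike.ofReal ∘ l) *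
          (V.conjTranspose * V) * E.conjTranspose := by
        rw [hspec']; simp only [mul_assoc]
    _ = E * Matrix.diagonal (RCLike.ofReal ∘ l) * E.conjTranspose := by rw [hVV']; simp
    _ = 1 := by
        have h1 : Real.exp (-t / 2) * l 0 * Real.exp (-t / 2) = 1 := by
          rw [← hexp, ← Real.exp_add, ← Real.exp_add]; ring_nf; simp
        have h2 : Real.exp (t / 2) * l 1 * Real.exp (t / 2) = 1 := by
          rw [hl1, ← hexp, ← Real.exp_neg, ← Real.exp_add, ← Real.exp_add]; ring_nf; simp
        have h1' : ((Real.exp (-t / 2) : ℝ) : 𝕂) * (l 0 : 𝕂) * ((Real.exp (-t / 2) : ℝ) : 𝕂) = 1 := by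
          exact_mod_cast h1
        have h2' : ((Real.exp (t / 2) : ℝ) : 𝕂) * (l 1 : 𝕂) * ((Real.exp (t / 2) : ℝ) : 𝕂) = 1 := by
          exact_mod_cast h2
        have e00 : E 0 0 = ((Real.exp (-t / 2) : ℝ) : 𝕂) := rfl
        have e01 : E 0 1 = 0 := rfl
        have e10 : E 1 0 = 0 := rfl
        have e11 : E 1 1 = ((Real.exp (t / 2) : ℝ) : 𝕂) := by rw [hE, aMat_one_one, neg_neg]
        ext i j
        fin_cases i <;> fin_cases j <;>
          simp only [Fin.zero_eta, Fin.mk_one, Matrix.mul_apply, Fin.sum_univ_two,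
            Matrix.diagonal_apply, Matrix.conjTranspose_apply, e00, e01, e10, e11] <;>
          simp [h1', h2']

theorem one_le_coshHeight (g : SL(2, 𝕂)) : 1 ≤ coshHeight g := by
  obtain ⟨k₁, h₁, k₂, h₂, t, rfl⟩ := exists_eq_mul_aMat_mul g
  rw [coshHeight_mul_right h₂, coshHeight_mul_left h₁, coshHeight_aMat]
  exact Real.one_le_cosh t

theorem cosh_height (g : SL(2, 𝕂)) : Real.cosh (height g) = coshHeight g :=
  Real.cosh_arcosh (one_le_coshHeight g)

theorem height_nonneg (g : SL(2, 𝕂)) : 0 ≤ height g := Real.arcosh_nonneg (one_le_coshHeight g)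

/-- The Cartan decomposition. -/
theorem exists_eq_mul_aMat_height_mul (g : SL(2, 𝕂)) :
    ∃ k₁ ∈ maxCompact 𝕂, ∃ k₂ ∈ maxCompact 𝕂, g = k₁ * aMat (height g) * k₂ := by
  obtain ⟨k₁, h₁, k₂, h₂, t, ht⟩ := exists_eq_mul_aMat_mul g
  have hh : height g = |t| := by
    rw [height, ht, coshHeight_mul_right h₂, coshHeight_mul_left h₁, coshHeight_aMat,
      ← Real.cosh_abs, Real.arcosh_cosh (abs_nonneg t)]
  rcases abs_cases t with ⟨h, -⟩ | ⟨h, -⟩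
  · exact ⟨k₁, h₁, k₂, h₂, by rw [hh, h, ← ht]⟩
  · refine ⟨k₁ * (weylMat 𝕂)⁻¹, mul_mem h₁ (inv_mem weylMat_mem_maxCompact),
      weylMat 𝕂 * k₂, mul_mem weylMat_mem_maxCompact h₂, ?_⟩
    have : (weylMat 𝕂)⁻¹ * aMat (-t) * weylMat 𝕂 = aMat t := by
      rw [mul_assoc, ← weylMat_mul_aMat]; group
    rw [hh, h, ht, ← this]
    group

theorem IsSpherical.eq_aMat_height {f : SL(2, 𝕂) → ℂ} (hf : IsSpherical f) (g : SL(2, 𝕂)) :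
    f g = f (aMat (height g)) := by
  obtain ⟨k₁, h₁, k₂, h₂, h⟩ := exists_eq_mul_aMat_height_mul g
  conv_lhs => rw [h, hf k₁ h₁ k₂ h₂]

theorem IsSpherical.eq_of_coshHeight_eq {f : SL(2, 𝕂) → ℂ} (hf : IsSpherical f) {g h : SL(2, 𝕂)}
    (hgh : coshHeight g = coshHeight h) : f g = f h := by
  rw [hf.eq_aMat_height g, hf.eq_aMat_height h, height, height, hgh]

/-- By the Cartan decomposition only `a(s) k a(t)` matters. Its `coshHeight` is the convex
combination of `cosh (s + t)` and `cosh (s - t)` with weights `‖k 0 0‖ ^ 2` and `‖k 0 1‖ ^ 2`. -/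
theorem height_mul_le (g h : SL(2, 𝕂)) : height (g * h) ≤ height g + height h := by
  have hs : 0 ≤ height g + height h := add_nonneg (height_nonneg g) (height_nonneg h)
  rw [← abs_of_nonneg (height_nonneg (g * h)), ← abs_of_nonneg hs, ← Real.cosh_le_cosh, cosh_height]
  obtain ⟨k₁, h₁, k₂, h₂, hg⟩ := exists_eq_mul_aMat_height_mul g
  obtain ⟨k₃, h₃, k₄, h₄, hh⟩ := exists_eq_mul_aMat_height_mul h
  set s := height g
  set t := height h
  set k := k₂ * k₃ with hk
  have hkK : k ∈ maxCompact 𝕂 := mul_mem h₂ h₃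
  have : coshHeight (g * h) = coshHeight (aMat s * k * aMat t) := by
    rw [hg, hh, show k₁ * aMat s * k₂ * (k₃ * aMat t * k₄) = k₁ * (aMat s * k * aMat t) * k₄ by
      rw [hk]; group, coshHeight_mul_right h₄, coshHeight_mul_left h₁]
  rw [this, coshHeight_eq]
  obtain ⟨e1, e2⟩ := mem_maxCompact_iff.1 hkK
  have e3 := norm_sq_add_of_mem_maxCompact hkK
  simp only [mul_entry, aMat_zero_zero, aMat_zero_one, aMat_one_zero, aMat_one_one, mul_zero,
    zero_mul, add_zero, zero_add, e1, e2, norm_mul, norm_neg, RCLike.norm_conj, RCLike.norm_ofReal,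
    Real.abs_exp, mul_pow]
  have hsq : ∀ x : ℝ, Real.exp (x / 2) ^ 2 = Real.exp x := fun x => by rw [sq, exp_half_mul_self]
  rw [hsq, hsq, hsq, hsq]
  have h1 : Real.cosh (s - t) ≤ Real.cosh (s + t) := by
    rw [Real.cosh_sub, Real.cosh_add]
    nlinarith [mul_nonneg (Real.sinh_nonneg_iff.2 (height_nonneg g))
      (Real.sinh_nonneg_iff.2 (height_nonneg h))]
  have h2 : Real.cosh (s + t) = (Real.exp s * Real.exp t + Real.exp (-s) * Real.exp (-t)) / 2 := by
    rw [Real.cosh_eq, ← Real.exp_add, ← Real.exp_add]; ring_nf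
  have h3 : Real.cosh (s - t) = (Real.exp s * Real.exp (-t) + Real.exp (-s) * Real.exp t) / 2 := by
    rw [Real.cosh_eq, ← Real.exp_add, ← Real.exp_add]; ring_nf
  calc _ = ‖k 0 0‖ ^ 2 * Real.cosh (s + t) + ‖k 0 1‖ ^ 2 * Real.cosh (s - t) := by
        rw [h2, h3]; ring
    _ ≤ ‖k 0 0‖ ^ 2 * Real.cosh (s + t) + ‖k 0 1‖ ^ 2 * Real.cosh (s + t) := by gcongr
    _ = Real.cosh (s + t) := by rw [← add_mul, e3, one_mul]

theorem height_inv (g : SL(2, 𝕂)) : height g⁻¹ = height g := by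
  rw [height, coshHeight_inv, height]

theorem height_le_iff {g : SL(2, 𝕂)} {r : ℝ} (hr : 0 ≤ r) :
    height g ≤ r ↔ coshHeight g ≤ Real.cosh r := by
  rw [← cosh_height, Real.cosh_le_cosh, abs_of_nonneg (height_nonneg g), abs_of_nonneg hr]

end Height

/-! ### Topology of `SL₂(𝕂)` and compactness of height balls. -/

section Topology

theorem isClosedEmbedding_val : Topology.IsClosedEmbedding
    (Subtype.val : SL(2, 𝕂) → Matrix (Fin 2) (Fin 2) 𝕂) :=
  IsClosed.isClosedEmbedding_subtypeVal
    (isClosed_eq (Continuous.matrix_det continuous_id) continuous_const)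

instance instSecondCountableTopologySL : SecondCountableTopology SL(2, 𝕂) :=
  haveI : SecondCountableTopology (Matrix (Fin 2) (Fin 2) 𝕂) :=
    inferInstanceAs (SecondCountableTopology (Fin 2 → Fin 2 → 𝕂))
  isClosedEmbedding_val.isEmbedding.secondCountableTopology

instance instLocallyCompactSpaceSL : LocallyCompactSpace SL(2, 𝕂) :=
  haveI : LocallyCompactSpace (Matrix (Fin 2) (Fin 2) 𝕂) :=
    inferInstanceAs (LocallyCompactSpace (Fin 2 → Fin 2 → 𝕂))
  isClosedEmbedding_val.locallyCompactSpace

@[fun_prop]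
theorem continuous_entry (i j : Fin 2) : Continuous fun g : SL(2, 𝕂) => g i j :=
  (continuous_apply j).comp ((continuous_apply i).comp continuous_subtype_val)

theorem continuous_of_entries {X : Type*} [TopologicalSpace X] {f : X → SL(2, 𝕂)}
    (h : ∀ i j, Continuous fun x => f x i j) : Continuous f :=
  continuous_induced_rng.2 (continuous_pi fun i => continuous_pi fun j => h i j)

@[fun_prop]
theorem continuous_aMat : Continuous (aMat : ℝ → SL(2, 𝕂)) := by
  refine continuous_of_entries fun i j => ?_
  fin_cases i <;> fin_cases j <;>
    simp only [Fin.zero_eta, Fin.mk_one, aMat_zero_zero, aMat_zero_one, aMat_one_zero, aMat_one_one]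
  · exact RCLike.continuous_ofReal.comp (by fun_prop)
  · exact continuous_const
  · exact continuous_const
  · exact RCLike.continuous_ofReal.comp (by fun_prop)

@[fun_prop]
theorem continuous_nMat : Continuous (nMat : 𝕂 → SL(2, 𝕂)) := by
  refine continuous_of_entries fun i j => ?_
  fin_cases i <;> fin_cases j <;>
    simp only [Fin.zero_eta, Fin.mk_one, nMat_zero_zero, nMat_zero_one, nMat_one_zero,
      nMat_one_one] <;> fun_prop

@[fun_prop]
theorem continuous_coshHeight : Continuous (coshHeight : SL(2, 𝕂) → ℝ) := by
  unfold coshHeight; fun_prop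

theorem isCompact_coshHeight_le (r : ℝ) : IsCompact {g : SL(2, 𝕂) | coshHeight g ≤ r} := by
  have hbox : IsCompact (Set.univ.pi fun _ : Fin 2 => Set.univ.pi fun _ : Fin 2 =>
      Metric.closedBall (0 : 𝕂) (Real.sqrt (2 * r))) :=
    isCompact_univ_pi fun _ => isCompact_univ_pi fun _ => isCompact_closedBall _ _
  refine (isClosedEmbedding_val.isCompact_preimage hbox).of_isClosed_subset
    (isClosed_le continuous_coshHeight continuous_const) ?_
  intro (g : SL(2, 𝕂)) hg i _ j _
  rw [Metric.mem_closedBall, dist_zero_right]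
  apply Real.le_sqrt_of_sq_le
  have h := coshHeight_eq g
  have hg' : coshHeight g ≤ r := hg
  have h0 := sq_nonneg ‖g 0 0‖
  have h1 := sq_nonneg ‖g 0 1‖
  have h2 := sq_nonneg ‖g 1 0‖
  have h3 := sq_nonneg ‖g 1 1‖
  change ‖g i j‖ ^ 2 ≤ 2 * r
  fin_cases i <;> fin_cases j <;> simp <;> linarith

theorem heightBall_eq {r : ℝ} (hr : 0 ≤ r) :
    heightBall 𝕂 r = {g | coshHeight g ≤ Real.cosh r} := by
  ext g; exact height_le_iff hr

theorem continuous_height : Continuous (height : SL(2, 𝕂) → ℝ) :=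
  Real.continuousOn_arcosh.comp_continuous continuous_coshHeight one_le_coshHeight

theorem isClosed_heightBall (r : ℝ) : IsClosed (heightBall 𝕂 r) :=
  isClosed_le continuous_height continuous_const

end Topology

/-! ### The Iwasawa decomposition. -/

section Iwasawa

/-- The `N`-component of the Iwasawa decomposition `g = a(t) n(z) k`. -/
def iwasawaZ (g : SL(2, 𝕂)) : 𝕂 := g 0 0 * conj (g 1 0) + g 0 1 * conj (g 1 1)

/-- The `A`-component of the Iwasawa decomposition `g = a(t) n(z) k`. -/
def iwasawaT (g : SL(2, 𝕂)) : ℝ := Real.log (iwasawaY g)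

theorem row_pos (g : SL(2, 𝕂)) : 0 < ‖g 1 0‖ ^ 2 + ‖g 1 1‖ ^ 2 := by
  by_contra h
  have h0 : ‖g 1 0‖ ^ 2 = 0 := by nlinarith [sq_nonneg ‖g 1 0‖, sq_nonneg ‖g 1 1‖]
  have h1 : ‖g 1 1‖ ^ 2 = 0 := by nlinarith [sq_nonneg ‖g 1 0‖, sq_nonneg ‖g 1 1‖]
  have := det_entries g
  simp only [ne_eq, OfNat.ofNat_ne_zero, not_false_eq_true, pow_eq_zero_iff, norm_eq_zero] at h0 h1
  simp [h0, h1] at this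

theorem iwasawaY_pos (g : SL(2, 𝕂)) : 0 < iwasawaY g := inv_pos.2 (row_pos g)

theorem exp_iwasawaT (g : SL(2, 𝕂)) : Real.exp (iwasawaT g) = iwasawaY g :=
  Real.exp_log (iwasawaY_pos g)

@[fun_prop]
theorem continuous_iwasawaY : Continuous (iwasawaY : SL(2, 𝕂) → ℝ) := by
  unfold iwasawaY
  exact Continuous.inv₀ (by fun_prop) fun g => (row_pos g).ne'

@[fun_prop]
theorem continuous_iwasawaT : Continuous (iwasawaT : SL(2, 𝕂) → ℝ) :=
  Continuous.log continuous_iwasawaY fun g => (iwasawaY_pos g).ne'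

/-- Gram–Schmidt on the rows of `g`: the length of the bottom row determines `t`, the Hermitian
product of the two rows is `z`. -/
theorem iwasawa (g : SL(2, 𝕂)) :
    ∃ k ∈ maxCompact 𝕂, g = aMat (iwasawaT g) * nMat (iwasawaZ g) * k := by
  set t := iwasawaT g with ht
  set z := iwasawaZ g with hz
  refine ⟨(aMat t * nMat z)⁻¹ * g, ?_, by group⟩
  rw [mul_inv_rev, ← aMat_neg, ← nMat_neg, mem_maxCompact_iff]
  have he : Real.exp (-t) = ‖g 1 0‖ ^ 2 + ‖g 1 1‖ ^ 2 := by
    rw [Real.exp_neg, exp_iwasawaT, iwasawaY, inv_inv]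
  have hd := det_entries g
  have hdc : conj (g 0 0) * conj (g 1 1) - conj (g 0 1) * conj (g 1 0) = 1 := by
    have := congrArg conj hd
    simpa using this
  have he' : ((Real.exp (t / 2) : ℝ) : 𝕂) * (g 1 0 * conj (g 1 0) + g 1 1 * conj (g 1 1)) =
      ((Real.exp (-t / 2) : ℝ) : 𝕂) := by
    rw [RCLike.mul_conj, RCLike.mul_conj]
    have : Real.exp (t / 2) * (‖g 1 0‖ ^ 2 + ‖g 1 1‖ ^ 2) = Real.exp (-t / 2) := by
      rw [← he, ← Real.exp_add]; ring_nf
    exact_mod_cast this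
  simp only [mul_entry, aMat_zero_zero, nMat_zero_zero, aMat_zero_one, nMat_one_zero,
    mul_zero, add_zero, nMat_zero_one, nMat_one_one, zero_add, aMat_one_zero, zero_mul, neg_neg,
    aMat_one_one, one_mul, map_add, map_mul, map_neg, RCLike.conj_ofReal]
  rw [← he', hz, iwasawaZ]
  simp only [map_add, map_mul, RCLike.conj_conj]
  constructor
  · linear_combination (-((Real.exp (t / 2) : ℝ) : 𝕂) * g 1 1) * hdc
  · linear_combination (-((Real.exp (t / 2) : ℝ) : 𝕂) * g 1 0) * hdc

theorem iwasawaY_mul_right {k : SL(2, 𝕂)} (hk : k ∈ maxCompact 𝕂) (g : SL(2, 𝕂)) :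
    iwasawaY (g * k) = iwasawaY g := by
  obtain ⟨h1, h2⟩ := mem_maxCompact_iff.1 hk
  have hd := det_entries k
  rw [h1, h2] at hd
  have : ((‖(g * k) 1 0‖ ^ 2 + ‖(g * k) 1 1‖ ^ 2 : ℝ) : 𝕂) =
      ((‖g 1 0‖ ^ 2 + ‖g 1 1‖ ^ 2 : ℝ) : 𝕂) := by
    push_cast
    simp only [← RCLike.mul_conj, mul_entry, h1, h2, map_add, map_mul, map_neg, RCLike.conj_conj]
    linear_combination (g 1 0 * conj (g 1 0) + g 1 1 * conj (g 1 1)) * hd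
  rw [iwasawaY, iwasawaY, RCLike.ofReal_injective this]

theorem iwasawaY_aMat_mul (t : ℝ) (g : SL(2, 𝕂)) :
    iwasawaY (aMat t * g) = Real.exp t * iwasawaY g := by
  have h : ‖(aMat t * g : SL(2, 𝕂)) 1 0‖ ^ 2 + ‖(aMat t * g : SL(2, 𝕂)) 1 1‖ ^ 2 =
      Real.exp (-t) * (‖g 1 0‖ ^ 2 + ‖g 1 1‖ ^ 2) := by
    rw [← exp_half_mul_self (-t)]
    simp only [mul_entry, aMat_one_zero, aMat_one_one, zero_mul, zero_add, norm_mul,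
      RCLike.norm_ofReal, Real.abs_exp]
    ring
  rw [iwasawaY, h, mul_inv, Real.exp_neg, inv_inv, iwasawaY]

theorem iwasawaY_nMat_mul (z : 𝕂) (g : SL(2, 𝕂)) : iwasawaY (nMat z * g) = iwasawaY g := by
  simp [iwasawaY, mul_entry]

theorem iwasawaY_of_mem {k : SL(2, 𝕂)} (hk : k ∈ maxCompact 𝕂) : iwasawaY k = 1 := by
  have := iwasawaY_mul_right hk 1
  rw [one_mul] at this
  rw [this]; simp [iwasawaY]

theorem iwasawaY_aMat_mul_nMat_mul (t : ℝ) (z : 𝕂) {k : SL(2, 𝕂)} (hk : k ∈ maxCompact 𝕂) :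
    iwasawaY (aMat t * nMat z * k) = Real.exp t := by
  rw [iwasawaY_mul_right hk, iwasawaY_aMat_mul, ← mul_one (nMat z), iwasawaY_nMat_mul,
    iwasawaY_of_mem (one_mem _), mul_one]

end Iwasawa

/-! ### The diagonal subgroup and its polar decomposition. -/

section Diagonal

theorem mem_compactTorus_iff {g : SL(2, 𝕂)} :
    g ∈ compactTorus 𝕂 ↔ g ∈ diagSubgroup 𝕂 ∧ g ∈ maxCompact 𝕂 := Iff.rfl

theorem aMat_mem_diagSubgroup (t : ℝ) : aMat t ∈ diagSubgroup 𝕂 := ⟨rfl, rfl⟩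

theorem diagSubgroup_mul_comm {d e : SL(2, 𝕂)} (hd : d ∈ diagSubgroup 𝕂)
    (he : e ∈ diagSubgroup 𝕂) : d * e = e * d := by
  obtain ⟨h1, h2⟩ := hd
  obtain ⟨h3, h4⟩ := he
  apply ext_entries <;> simp [mul_entry, h1, h2, h3, h4, mul_comm]

theorem diag_mul_eq_one {d : SL(2, 𝕂)} (hd : d ∈ diagSubgroup 𝕂) : d 0 0 * d 1 1 = 1 := by
  have := det_entries d
  rwa [hd.1, zero_mul, sub_zero] at this

theorem diag_ne_zero {d : SL(2, 𝕂)} (hd : d ∈ diagSubgroup 𝕂) : d 0 0 ≠ 0 :=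
  left_ne_zero_of_mul_eq_one (diag_mul_eq_one hd)

theorem diag_mul_nMat {d : SL(2, 𝕂)} (hd : d ∈ diagSubgroup 𝕂) (z : 𝕂) :
    d * nMat z = nMat (d 0 0 ^ 2 * z) * d := by
  have h := diag_mul_eq_one hd
  obtain ⟨h1, h2⟩ := hd
  apply ext_entries <;> simp [mul_entry, h1, h2]
  linear_combination (-z * d 0 0) * h

theorem norm_of_mem_compactTorus {τ : SL(2, 𝕂)} (h : τ ∈ compactTorus 𝕂) : ‖τ 0 0‖ = 1 := by
  have h1 := norm_sq_add_of_mem_maxCompact h.2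
  rw [h.1.1, norm_zero] at h1
  have := norm_nonneg (τ 0 0)
  nlinarith

/-- The polar decomposition of a diagonal matrix. -/
theorem exists_compactTorus_eq_aMat_mul {d : SL(2, 𝕂)} (hd : d ∈ diagSubgroup 𝕂) :
    ∃ τ ∈ compactTorus 𝕂, d = aMat (2 * Real.log ‖d 0 0‖) * τ := by
  set t := 2 * Real.log ‖d 0 0‖ with ht
  have hn : 0 < ‖d 0 0‖ := norm_pos_iff.2 (diag_ne_zero hd)
  have hτ : (aMat t)⁻¹ * d ∈ diagSubgroup 𝕂 := mul_mem (inv_mem (aMat_mem_diagSubgroup t)) hd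
  refine ⟨(aMat t)⁻¹ * d, mem_compactTorus_iff.2 ⟨hτ, ?_⟩, by group⟩
  rw [mem_maxCompact_iff, hτ.1, hτ.2]
  refine ⟨?_, by simp⟩
  have h11 := diag_mul_eq_one hτ
  have h00 : ‖((aMat t)⁻¹ * d : SL(2, 𝕂)) 0 0‖ = 1 := by
    rw [← aMat_neg, mul_entry, aMat_zero_zero, aMat_zero_one, zero_mul, add_zero, norm_mul,
      RCLike.norm_ofReal, Real.abs_exp, ht,
      show -(2 * Real.log ‖d 0 0‖) / 2 = -Real.log ‖d 0 0‖ by ring, Real.exp_neg, Real.exp_log hn,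
      inv_mul_cancel₀ hn.ne']
  have h := RCLike.mul_conj (((aMat t)⁻¹ * d : SL(2, 𝕂)) 0 0)
  rw [h00] at h
  have hne := left_ne_zero_of_mul_eq_one h11
  apply mul_left_cancel₀ hne
  rw [h11, h]; simp

end Diagonal

/-! ### Haar probability measures of compact subgroups. -/

section CompactHaar

/-- Uniqueness is what yields right invariance and inversion invariance below: the translated or
inverted measure is again a left invariant probability measure. -/
theorem eq_haarMeasure_top {H : Type*} [Group H] [TopologicalSpace H] [IsTopologicalGroup H]
    [CompactSpace H] [MeasurableSpace H] [BorelSpace H] (ν : Measure H) [ν.IsMulLeftInvariant]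
    [IsProbabilityMeasure ν] : ν = Measure.haarMeasure (⊤ : PositiveCompacts H) := by
  have h := Measure.isMulInvariant_eq_smul_of_compactSpace ν
    (Measure.haarMeasure (⊤ : PositiveCompacts H))
  have h1 : Measure.haarMeasure (⊤ : PositiveCompacts H) Set.univ = 1 :=
    Measure.haarMeasure_self (K₀ := (⊤ : PositiveCompacts H))
  have h2 := congrArg (fun m => m Set.univ) h
  simp only [measure_univ, Measure.smul_apply, h1, ENNReal.smul_def, smul_eq_mul, mul_one] at h2
  rw [h, show Measure.haarScalarFactor ν (Measure.haarMeasure (⊤ : PositiveCompacts H)) = 1 by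
    exact_mod_cast h2.symm, one_smul]

instance {H : Type*} [Group H] [TopologicalSpace H] [IsTopologicalGroup H]
    [CompactSpace H] [MeasurableSpace H] [BorelSpace H] :
    IsProbabilityMeasure (Measure.haarMeasure (⊤ : PositiveCompacts H)) :=
  ⟨Measure.haarMeasure_self (K₀ := (⊤ : PositiveCompacts H))⟩

variable (H : Subgroup SL(2, 𝕂)) [CompactSpace H]

instance instIsProbabilityMeasureHaarProb : IsProbabilityMeasure (haarProb H) :=
  Measure.isProbabilityMeasure_map measurable_subtype_coe.aemeasurable

variable {H}

theorem lintegral_haarProb {f : SL(2, 𝕂) → ℝ≥0∞} (hf : Measurable f) :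
    ∫⁻ k, f k ∂haarProb H = ∫⁻ k : H, f k ∂Measure.haarMeasure (⊤ : PositiveCompacts H) :=
  lintegral_map hf measurable_subtype_coe

theorem lintegral_haarProb_congr {f f' : SL(2, 𝕂) → ℝ≥0∞} (hf : Measurable f)
    (hf' : Measurable f') (h : ∀ k ∈ H, f k = f' k) :
    ∫⁻ k, f k ∂haarProb H = ∫⁻ k, f' k ∂haarProb H := by
  rw [lintegral_haarProb hf, lintegral_haarProb hf']
  exact lintegral_congr fun k => h k k.2

theorem lintegral_haarProb_mul_left {f : SL(2, 𝕂) → ℝ≥0∞} (hf : Measurable f)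
    {h : SL(2, 𝕂)} (hh : h ∈ H) : ∫⁻ k, f (h * k) ∂haarProb H = ∫⁻ k, f k ∂haarProb H := by
  rw [lintegral_haarProb (f := fun k => f (h * k)) (by fun_prop), lintegral_haarProb hf]
  exact lintegral_mul_left_eq_self (fun k : H => f k) (⟨h, hh⟩ : H)

theorem lintegral_haarProb_mul_right {f : SL(2, 𝕂) → ℝ≥0∞} (hf : Measurable f)
    {h : SL(2, 𝕂)} (hh : h ∈ H) : ∫⁻ k, f (k * h) ∂haarProb H = ∫⁻ k, f k ∂haarProb H := by
  rw [lintegral_haarProb (f := fun k => f (k * h)) (by fun_prop), lintegral_haarProb hf]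
  have hp : IsProbabilityMeasure
      ((Measure.haarMeasure (⊤ : PositiveCompacts H)).map (· * (⟨h, hh⟩ : H))) :=
    Measure.isProbabilityMeasure_map (measurable_mul_const _).aemeasurable
  conv_rhs => rw [← eq_haarMeasure_top
    ((Measure.haarMeasure (⊤ : PositiveCompacts H)).map (· * (⟨h, hh⟩ : H)))]
  rw [lintegral_map (by fun_prop) (measurable_mul_const _)]
  rfl

theorem lintegral_haarProb_inv {f : SL(2, 𝕂) → ℝ≥0∞} (hf : Measurable f) :
    ∫⁻ k, f k⁻¹ ∂haarProb H = ∫⁻ k, f k ∂haarProb H := by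
  rw [lintegral_haarProb (f := fun k => f k⁻¹) (by fun_prop), lintegral_haarProb hf]
  have hr : (Measure.haarMeasure (⊤ : PositiveCompacts H)).IsMulRightInvariant := by
    refine ⟨fun h => ?_⟩
    have hp : IsProbabilityMeasure
      ((Measure.haarMeasure (⊤ : PositiveCompacts H)).map (· * h)) :=
      Measure.isProbabilityMeasure_map (measurable_mul_const _).aemeasurable
    exact eq_haarMeasure_top _
  have hp : IsProbabilityMeasure (Measure.haarMeasure (⊤ : PositiveCompacts H)).inv :=
    Measure.isProbabilityMeasure_map measurable_inv.aemeasurable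
  conv_rhs => rw [← eq_haarMeasure_top (Measure.haarMeasure (⊤ : PositiveCompacts H)).inv]
  rw [Measure.inv, lintegral_map (by fun_prop) measurable_inv]
  rfl

theorem ae_haarProb_mem (hH : MeasurableSet (H : Set SL(2, 𝕂))) : ∀ᵐ k ∂haarProb H, k ∈ H := by
  exact (ae_map_iff measurable_subtype_coe.aemeasurable hH).2
    (Filter.Eventually.of_forall fun k => k.2)

theorem isClosed_maxCompact : IsClosed (maxCompact 𝕂 : Set SL(2, 𝕂)) :=
  (isCompact_maxCompact 𝕂).isClosed

theorem isClosed_compactTorus : IsClosed (compactTorus 𝕂 : Set SL(2, 𝕂)) :=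
  (isClosed_diagSubgroup 𝕂).inter isClosed_maxCompact

theorem ae_mem_maxCompact : ∀ᵐ k ∂haarProb (maxCompact 𝕂), k ∈ maxCompact 𝕂 :=
  ae_haarProb_mem isClosed_maxCompact.measurableSet

theorem ae_mem_compactTorus : ∀ᵐ k ∂haarProb (compactTorus 𝕂), k ∈ compactTorus 𝕂 :=
  ae_haarProb_mem isClosed_compactTorus.measurableSet

end CompactHaar

theorem degree_pos : 0 < degree 𝕂 := Module.finrank_pos

theorem modulus_pos {c : 𝕂} (hc : c ≠ 0) : 0 < modulus c := pow_pos (norm_pos_iff.2 hc) _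

theorem modulus_mul (a b : 𝕂) : modulus (a * b) = modulus a * modulus b := by
  simp [modulus, mul_pow]

/-! ### Lebesgue measure under real-linear similarities of `𝕂`. -/

section Lebesgue

variable [MeasureSpace 𝕂] [BorelSpace 𝕂] [(volume : Measure 𝕂).IsAddHaarMeasure]

/-- The preimage of the unit ball is the ball of radius `r⁻¹`, and comparing volumes gives the
determinant. This serves both scalar multiplication and `z ↦ -conj z`. -/
theorem map_volume_of_norm_eq (f : 𝕂 →ₗ[ℝ] 𝕂) {r : ℝ} (hr : 0 < r) (hf : ∀ z, ‖f z‖ = r * ‖z‖) :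
    (volume : Measure 𝕂).map f = ENNReal.ofReal ((r ^ degree 𝕂)⁻¹) • volume := by
  have hinj : LinearMap.ker f = ⊥ := by
    rw [LinearMap.ker_eq_bot']
    intro z hz
    have := hf z
    rw [hz, norm_zero] at this
    rcases mul_eq_zero.1 this.symm with h | h
    · exact absurd h hr.ne'
    · exact norm_eq_zero.1 h
  have hdet : LinearMap.det f ≠ 0 := by
    intro h
    exact (LinearMap.bot_lt_ker_of_det_eq_zero h).ne' hinj
  rw [Measure.map_linearMap_addHaar_eq_smul_addHaar _ hdet]
  have hball : f ⁻¹' Metric.closedBall 0 1 = Metric.closedBall 0 r⁻¹ := by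
    ext z
    rw [Set.mem_preimage, mem_closedBall_zero_iff, mem_closedBall_zero_iff, hf,
      ← one_div, le_div_iff₀' hr]
  have h1 := Measure.addHaar_preimage_linearMap (volume : Measure 𝕂) hdet (Metric.closedBall 0 1)
  rw [hball, Measure.addHaar_closedBall _ _ (inv_nonneg.2 hr.le),
    Measure.addHaar_closedBall _ _ zero_le_one, one_pow, ENNReal.ofReal_one, one_mul] at h1
  have h2 := (ENNReal.mul_left_inj (Metric.measure_ball_pos volume (0 : 𝕂) one_pos).ne'
    measure_ball_lt_top.ne).1 h1
  rw [← h2, inv_pow]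
  rfl

theorem map_volume_mul_left {c : 𝕂} (hc : c ≠ 0) : (volume : Measure 𝕂).map (c * ·) =
    ENNReal.ofReal ((modulus c)⁻¹) • volume :=
  map_volume_of_norm_eq (LinearMap.mulLeft ℝ c) (norm_pos_iff.2 hc) fun z => norm_mul c z

theorem lintegral_comp_mul_left {c : 𝕂} (hc : c ≠ 0) {f : 𝕂 → ℝ≥0∞} (hf : Measurable f) :
    ∫⁻ z, f (c * z) = ENNReal.ofReal ((modulus c)⁻¹) * ∫⁻ z, f z := by
  rw [← lintegral_map (μ := (volume : Measure 𝕂)) hf (measurable_const_mul c),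
    map_volume_mul_left hc, lintegral_smul_measure, smul_eq_mul]

theorem integral_comp_mul_left_modulus {c : 𝕂} (hc : c ≠ 0) (f : 𝕂 → ℂ) :
    ∫ z, f (c * z) = (modulus c)⁻¹ • ∫ z, f z := by
  have he : MeasurableEmbedding (c * · : 𝕂 → 𝕂) := measurableEmbedding_mulLeft₀ hc
  rw [← he.integral_map, map_volume_mul_left hc, integral_smul_measure,
    ENNReal.toReal_ofReal (inv_nonneg.2 (modulus_pos hc).le)]

theorem measurePreserving_neg_conj :
    MeasurePreserving (fun z : 𝕂 => -conj z) volume volume := by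
  refine ⟨RCLike.continuous_conj.neg.measurable, ?_⟩
  have := map_volume_of_norm_eq (𝕂 := 𝕂)
    (-(RCLike.conjLIE : 𝕂 ≃ₗᵢ[ℝ] 𝕂).toLinearEquiv.toLinearMap) one_pos (fun z => by simp)
  rw [one_pow, inv_one, ENNReal.ofReal_one, one_smul] at this
  exact this

end Lebesgue

/-! ### Right `K`-invariant functions, the Weyl element and the Bruhat decomposition. -/

section RightInvariant

/-- Invariance under right translation by `maxCompact`. -/
def IsRightInvariant {E : Type*} (f : SL(2, 𝕂) → E) : Prop :=
  ∀ k ∈ maxCompact 𝕂, ∀ g, f (g * k) = f g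

theorem IsRightInvariant.lintegral_maxCompact {f : SL(2, 𝕂) → ℝ≥0∞} (hf : Measurable f)
    (hi : IsRightInvariant f) (g : SL(2, 𝕂)) : ∫⁻ k, f (g * k) ∂haarProb (maxCompact 𝕂) = f g := by
  rw [lintegral_haarProb_congr (f' := fun _ => f g) (by fun_prop) measurable_const
    fun k hk => hi k hk g]
  simp

theorem IsRightInvariant.eq_iwasawa {E : Type*} {f : SL(2, 𝕂) → E} (hi : IsRightInvariant f)
    (g : SL(2, 𝕂)) : f g = f (aMat (iwasawaT g) * nMat (iwasawaZ g)) := by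
  obtain ⟨k, hk, h⟩ := iwasawa g
  conv_lhs => rw [h, hi k hk]

theorem IsRightInvariant.comp_mul_left {E : Type*} {f : SL(2, 𝕂) → E} (hi : IsRightInvariant f)
    (g₀ : SL(2, 𝕂)) : IsRightInvariant fun g => f (g₀ * g) := fun k hk g => by
  simp only [← mul_assoc, hi k hk]

/-- In Iwasawa coordinates the Weyl element acts by a reflection in `t` depending on `z` and an
isometry in `z`, which visibly preserves `dt dz`. -/
theorem iwasawa_weylMat_mul (t : ℝ) (z : 𝕂) :
    iwasawaT (weylMat 𝕂 * (aMat t * nMat z)) = -Real.log (1 + ‖z‖ ^ 2) - t ∧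
    iwasawaZ (weylMat 𝕂 * (aMat t * nMat z)) = -conj z := by
  constructor
  · have hp : (0 : ℝ) < 1 + ‖z‖ ^ 2 := by positivity
    have : iwasawaY (weylMat 𝕂 * (aMat t * nMat z)) = ((1 + ‖z‖ ^ 2) * Real.exp t)⁻¹ := by
      rw [iwasawaY, ← exp_half_mul_self t]
      simp only [mul_entry, weylMat_one_zero, weylMat_one_one, aMat_zero_zero, aMat_zero_one,
        nMat_zero_zero, nMat_one_zero, nMat_zero_one, nMat_one_one, zero_mul, add_zero, mul_zero,
        mul_one, neg_mul, one_mul, norm_neg, norm_mul, RCLike.norm_ofReal, Real.abs_exp]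
      congr 1; ring
    rw [iwasawaT, this, Real.log_inv, Real.log_mul hp.ne' (Real.exp_pos t).ne', Real.log_exp]
    ring
  · have h1 : ((Real.exp (-t / 2) : ℝ) : 𝕂) * ((Real.exp (t / 2) : ℝ) : 𝕂) = 1 := by
      rw [← RCLike.ofReal_mul, ← Real.exp_add]; ring_nf; simp
    simp only [iwasawaZ, mul_entry, weylMat_zero_zero, weylMat_zero_one, weylMat_one_zero,
      weylMat_one_one, aMat_zero_zero, aMat_zero_one, aMat_one_zero, aMat_one_one,
      nMat_zero_zero, nMat_one_zero, nMat_zero_one, nMat_one_one, zero_mul, add_zero, mul_zero,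
      mul_one, neg_mul, one_mul, zero_add, map_neg, map_mul, RCLike.conj_ofReal]
    linear_combination (-conj z) * h1

/-- The diagonal matrix with entries `x` and `x⁻¹`. -/
def diagMat (x : 𝕂) (hx : x ≠ 0) : SL(2, 𝕂) :=
  ⟨!![x, 0; 0, x⁻¹], by simp [Matrix.det_fin_two_of, hx]⟩

@[simp] theorem diagMat_zero_zero (x : 𝕂) (hx : x ≠ 0) : diagMat x hx 0 0 = x := rfl
@[simp] theorem diagMat_zero_one (x : 𝕂) (hx : x ≠ 0) : diagMat x hx 0 1 = 0 := rfl
@[simp] theorem diagMat_one_zero (x : 𝕂) (hx : x ≠ 0) : diagMat x hx 1 0 = 0 := rfl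
@[simp] theorem diagMat_one_one (x : 𝕂) (hx : x ≠ 0) : diagMat x hx 1 1 = x⁻¹ := rfl

theorem diagMat_mem_diagSubgroup (x : 𝕂) (hx : x ≠ 0) : diagMat x hx ∈ diagSubgroup 𝕂 := ⟨rfl, rfl⟩

/-- The Bruhat decomposition. -/
theorem bruhat (g : SL(2, 𝕂)) : (∃ d ∈ diagSubgroup 𝕂, ∃ x, g = d * nMat x) ∨
    ∃ x, ∃ d ∈ diagSubgroup 𝕂, ∃ y, g = nMat x * (weylMat 𝕂 * (d * nMat y)) := by
  have hd := det_entries g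
  by_cases hc : g 1 0 = 0
  · left
    rw [hc, mul_zero, sub_zero] at hd
    have h0 : g 0 0 ≠ 0 := left_ne_zero_of_mul_eq_one hd
    refine ⟨diagMat (g 0 0) h0, diagMat_mem_diagSubgroup _ _, g 0 1 / g 0 0, ?_⟩
    apply ext_entries
    · simp [mul_entry]
    · simp [mul_entry]; field_simp
    · simp [mul_entry, hc]
    · simpa [mul_entry] using eq_inv_of_mul_eq_one_right hd
  · right
    refine ⟨g 0 0 / g 1 0, diagMat (-g 1 0) (neg_ne_zero.2 hc), diagMat_mem_diagSubgroup _ _,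
      g 1 1 / g 1 0, ?_⟩
    apply ext_entries
    · simp [mul_entry]; field_simp
    · simp [mul_entry]; field_simp
      linear_combination -hd
    · simp [mul_entry]
    · simp [mul_entry]; field_simp

end RightInvariant

/-! ### Left invariance of the Iwasawa measure, and volumes of height balls. -/

section HaarG

variable [MeasureSpace 𝕂] [BorelSpace 𝕂] [(volume : Measure 𝕂).IsAddHaarMeasure]

theorem measurable_iwasawaMap : Measurable fun p : ℝ × 𝕂 × SL(2, 𝕂) =>
    (aMat p.1 * nMat p.2.1 * p.2.2 : SL(2, 𝕂)) :=
  Continuous.measurable (by fun_prop)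

instance instSFiniteHaarG : SFinite (haarG 𝕂) := by
  unfold haarG; infer_instance

theorem lintegral_haarG {f : SL(2, 𝕂) → ℝ≥0∞} (hf : Measurable f) :
    ∫⁻ g, f g ∂haarG 𝕂 =
      ∫⁻ t : ℝ, ∫⁻ z : 𝕂, ∫⁻ k, f (aMat t * nMat z * k) ∂haarProb (maxCompact 𝕂) := by
  have hm : Measurable fun p : ℝ × 𝕂 × SL(2, 𝕂) => f (aMat p.1 * nMat p.2.1 * p.2.2) :=
    hf.comp measurable_iwasawaMap
  rw [haarG, lintegral_map hf measurable_iwasawaMap, lintegral_prod _ hm.aemeasurable]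
  refine lintegral_congr fun t => ?_
  exact lintegral_prod (fun y : 𝕂 × SL(2, 𝕂) => f (aMat t * nMat y.1 * y.2))
    (hm.comp measurable_prodMk_left).aemeasurable

theorem IsRightInvariant.lintegral_haarG {f : SL(2, 𝕂) → ℝ≥0∞} (hf : Measurable f)
    (hi : IsRightInvariant f) :
    ∫⁻ g, f g ∂haarG 𝕂 = ∫⁻ t : ℝ, ∫⁻ z : 𝕂, f (aMat t * nMat z) := by
  rw [SphericalSL2.lintegral_haarG hf]
  simp_rw [hi.lintegral_maxCompact hf]

/-- The property of preserving integrals of right-invariant functions under left translation. -/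
def PreservesIntegral (g₀ : SL(2, 𝕂)) : Prop :=
  ∀ f : SL(2, 𝕂) → ℝ≥0∞, Measurable f → IsRightInvariant f →
    ∫⁻ t : ℝ, ∫⁻ z : 𝕂, f (g₀ * (aMat t * nMat z)) = ∫⁻ t : ℝ, ∫⁻ z : 𝕂, f (aMat t * nMat z)

theorem PreservesIntegral.mul {g h : SL(2, 𝕂)} (hg : PreservesIntegral g)
    (hh : PreservesIntegral h) : PreservesIntegral (g * h) := fun f hf hi => by
  rw [← hg f hf hi, ← hh (fun x => f (g * x)) (by fun_prop) (hi.comp_mul_left g)]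
  simp_rw [mul_assoc]

theorem preservesIntegral_aMat (s : ℝ) : PreservesIntegral (aMat s : SL(2, 𝕂)) := fun f _ _ => by
  simp_rw [← mul_assoc, ← aMat_add]
  exact lintegral_add_left_eq_self (fun t : ℝ => ∫⁻ z : 𝕂, f (aMat t * nMat z)) s

theorem preservesIntegral_nMat (w : 𝕂) : PreservesIntegral (nMat w) := fun f _ _ => by
  refine lintegral_congr fun t => ?_
  simp_rw [← mul_assoc, nMat_mul_aMat, mul_assoc, ← nMat_add]
  exact lintegral_add_left_eq_self (fun z : 𝕂 => f (aMat t * nMat z)) _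

theorem preservesIntegral_compactTorus {τ : SL(2, 𝕂)} (h : τ ∈ compactTorus 𝕂) :
    PreservesIntegral τ := fun f hf hi => by
  refine lintegral_congr fun t => ?_
  have hz : ∀ z : 𝕂, f (τ * (aMat t * nMat z)) = f (aMat t * nMat (τ 0 0 ^ 2 * z)) := fun z => by
    rw [← mul_assoc, diagSubgroup_mul_comm h.1 (aMat_mem_diagSubgroup t), mul_assoc,
      diag_mul_nMat h.1, ← mul_assoc, hi τ h.2]
  simp_rw [hz]
  rw [lintegral_comp_mul_left (pow_ne_zero 2 (diag_ne_zero h.1))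
    (f := fun z => f (aMat t * nMat z)) (hf.comp (by fun_prop))]
  simp [modulus, norm_of_mem_compactTorus h]

theorem preservesIntegral_weylMat : PreservesIntegral (weylMat 𝕂) := fun f hf hi => by
  have h1 : ∀ (t : ℝ) (z : 𝕂), f (weylMat 𝕂 * (aMat t * nMat z)) =
      f (aMat (-Real.log (1 + ‖z‖ ^ 2) - t) * nMat (-conj z)) := fun t z => by
    rw [hi.eq_iwasawa (weylMat 𝕂 * (aMat t * nMat z)), (iwasawa_weylMat_mul t z).1,
      (iwasawa_weylMat_mul t z).2]
  simp_rw [h1]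
  have hc1 : Continuous fun p : ℝ × 𝕂 =>
      (aMat (-Real.log (1 + ‖p.2‖ ^ 2) - p.1) * nMat (-conj p.2) : SL(2, 𝕂)) := by
    have h3 : Continuous fun p : ℝ × 𝕂 => Real.log (1 + ‖p.2‖ ^ 2) :=
      Continuous.log (by fun_prop) fun p => by positivity
    have h4 : Continuous fun p : ℝ × 𝕂 => conj p.2 := RCLike.continuous_conj.comp continuous_snd
    fun_prop
  have hc2 : Continuous fun p : ℝ × 𝕂 => (aMat p.1 * nMat (-conj p.2) : SL(2, 𝕂)) := by
    have h4 : Continuous fun p : ℝ × 𝕂 => conj p.2 := RCLike.continuous_conj.comp continuous_snd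
    fun_prop
  have hm1 : Measurable fun p : ℝ × 𝕂 => f (aMat (-Real.log (1 + ‖p.2‖ ^ 2) - p.1) *
      nMat (-conj p.2)) := hf.comp hc1.measurable
  have hm2 : Measurable fun p : ℝ × 𝕂 => f (aMat p.1 * nMat (-conj p.2)) :=
    hf.comp hc2.measurable
  rw [lintegral_lintegral_swap hm1.aemeasurable]
  have h2 : ∀ z : 𝕂, ∫⁻ t : ℝ, f (aMat (-Real.log (1 + ‖z‖ ^ 2) - t) * nMat (-conj z)) =
      ∫⁻ t : ℝ, f (aMat t * nMat (-conj z)) := fun z =>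
    lintegral_sub_left_eq_self (fun t => f (aMat t * nMat (-conj z))) _
  simp_rw [h2]
  rw [← lintegral_lintegral_swap hm2.aemeasurable]
  exact lintegral_congr fun t => measurePreserving_neg_conj.lintegral_comp
    (f := fun z => f (aMat t * nMat z)) (hf.comp (by fun_prop))

theorem preservesIntegral_diagSubgroup {d : SL(2, 𝕂)} (hd : d ∈ diagSubgroup 𝕂) :
    PreservesIntegral d := by
  obtain ⟨τ, hτ, h⟩ := exists_compactTorus_eq_aMat_mul hd
  rw [h]
  exact (preservesIntegral_aMat _).mul (preservesIntegral_compactTorus hτ)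

theorem preservesIntegral (g : SL(2, 𝕂)) : PreservesIntegral g := by
  rcases bruhat g with ⟨d, hd, x, h⟩ | ⟨x, d, hd, y, h⟩
  · rw [h]; exact (preservesIntegral_diagSubgroup hd).mul (preservesIntegral_nMat x)
  · rw [h]
    exact (preservesIntegral_nMat x).mul (preservesIntegral_weylMat.mul
      ((preservesIntegral_diagSubgroup hd).mul (preservesIntegral_nMat y)))

/-- Averaging over `K` on the right reduces to right invariant functions, where invariance is
checked on the Bruhat factors of `g₀`. -/
theorem lintegral_haarG_mul_left {f : SL(2, 𝕂) → ℝ≥0∞} (hf : Measurable f) (g₀ : SL(2, 𝕂)) :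
    ∫⁻ g, f (g₀ * g) ∂haarG 𝕂 = ∫⁻ g, f g ∂haarG 𝕂 := by
  set F : SL(2, 𝕂) → ℝ≥0∞ := fun g => ∫⁻ k, f (g * k) ∂haarProb (maxCompact 𝕂) with hF
  have hFm : Measurable F :=
    Measurable.lintegral_prod_right' (f := fun p : SL(2, 𝕂) × SL(2, 𝕂) => f (p.1 * p.2))
      (by fun_prop)
  have hFi : IsRightInvariant F := fun k hk g => by
    simp only [hF, mul_assoc]
    exact lintegral_haarProb_mul_left (f := fun x => f (g * x)) (by fun_prop) hk
  rw [lintegral_haarG hf, lintegral_haarG (f := fun g => f (g₀ * g)) (by fun_prop)]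
  have := preservesIntegral g₀ F hFm hFi
  simpa only [hF, mul_assoc] using this

instance instIsMulLeftInvariantHaarG : (haarG 𝕂).IsMulLeftInvariant := by
  refine ⟨fun g => Measure.ext_of_lintegral _ fun f hf => ?_⟩
  rw [lintegral_map hf (measurable_const_mul g), lintegral_haarG_mul_left hf]

/-- With `L = log (2X)`, the condition forces `t > -L` and `‖z‖² ≤ e^{L - t}`. Integrating `e^{ρ(L -
t)/2}` over `t > -L` gives `(2/ρ)(2X)^ρ`. -/
theorem haarG_coshHeight_le {X : ℝ} (hX : 0 < X) : haarG 𝕂 {g | coshHeight g ≤ X} ≤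
    ENNReal.ofReal (2 * (2 * X) ^ degree 𝕂) * volume (Metric.ball (0 : 𝕂) 1) := by
  set V := volume (Metric.ball (0 : 𝕂) 1) with hV
  set ρ := degree 𝕂 with hρ
  have hρ1 : (1 : ℝ) ≤ ρ := by exact_mod_cast degree_pos (𝕂 := 𝕂)
  have hms : MeasurableSet {g : SL(2, 𝕂) | coshHeight g ≤ X} :=
    (isClosed_le continuous_coshHeight continuous_const).measurableSet
  have hi : IsRightInvariant ({g : SL(2, 𝕂) | coshHeight g ≤ X}.indicator (1 : SL(2, 𝕂) → ℝ≥0∞)) :=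
    fun k hk g => by simp only [Set.indicator, Set.mem_ofPred_eq, coshHeight_mul_right hk]; rfl
  rw [← lintegral_indicator_one hms, hi.lintegral_haarG (measurable_one.indicator hms)]
  set L := Real.log (2 * X) with hL
  have hLe : Real.exp L = 2 * X := Real.exp_log (by positivity)
  have key : ∀ t : ℝ, ∫⁻ z : 𝕂, ({g : SL(2, 𝕂) | coshHeight g ≤ X}.indicator
      (1 : SL(2, 𝕂) → ℝ≥0∞)) (aMat t * nMat z) ≤ (Set.Ioi (-L)).indicator (fun t =>
        ENNReal.ofReal (Real.exp (ρ * L / 2) * Real.exp (-(ρ / 2) * t)) * V) t := by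
    intro t
    have hle : ∀ z : 𝕂, ({g : SL(2, 𝕂) | coshHeight g ≤ X}.indicator
        (1 : SL(2, 𝕂) → ℝ≥0∞)) (aMat t * nMat z) ≤ (Set.Ioi (-L)).indicator (fun t =>
          (Metric.closedBall (0 : 𝕂) (Real.exp ((L - t) / 2))).indicator 1 z) t := by
      intro z
      by_cases hz : coshHeight (aMat t * nMat z) ≤ X
      · have h1 := hz
        rw [coshHeight_aMat_mul_nMat, Real.cosh_eq] at h1
        have het := Real.exp_pos t
        have het' := Real.exp_pos (-t)
        have hn : 0 ≤ Real.exp t * ‖z‖ ^ 2 / 2 := by positivity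
        have h2 : -L < t := by
          rw [neg_lt, ← Real.exp_lt_exp, hLe]; linarith
        have h3 : ‖z‖ ≤ Real.exp ((L - t) / 2) := by
          apply le_of_sq_le_sq _ (Real.exp_pos _).le
          rw [sq (Real.exp _), exp_half_mul_self, Real.exp_sub, hLe, le_div_iff₀ het]
          linarith
        rw [Set.indicator_of_mem (show t ∈ Set.Ioi (-L) from h2), Set.indicator_of_mem (by exact hz),
          Set.indicator_of_mem (by simpa using h3)]
        exact le_rfl
      · rw [Set.indicator_of_notMem (by exact hz)]
        exact bot_le
    refine (lintegral_mono hle).trans ?_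
    by_cases ht : t ∈ Set.Ioi (-L)
    · simp only [Set.indicator_of_mem ht]
      rw [lintegral_indicator_one Metric.isClosed_closedBall.measurableSet,
        Measure.addHaar_closedBall _ _ (Real.exp_pos _).le, ← Real.exp_nat_mul, ← Real.exp_add]
      gcongr
      apply le_of_eq
      change (ρ : ℝ) * _ = _
      ring
    · simp [Set.indicator_of_notMem ht]
  refine (lintegral_mono key).trans ?_
  rw [lintegral_indicator measurableSet_Ioi, lintegral_mul_const _ (by fun_prop)]
  gcongr
  have hneg : -((ρ : ℝ) / 2) < 0 := by linarith
  rw [← ofReal_integral_eq_lintegral_ofReal ((integrableOn_exp_mul_Ioi hneg _).const_mul _)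
    (Filter.Eventually.of_forall fun t => by positivity), integral_const_mul,
    integral_exp_mul_Ioi hneg]
  apply ENNReal.ofReal_le_ofReal
  have h1 : Real.exp (-((ρ : ℝ) / 2) * -L) = Real.exp (ρ * L / 2) := by ring_nf
  have h2 : Real.exp (ρ * L / 2) * Real.exp (ρ * L / 2) = (2 * X) ^ ρ := by
    rw [exp_half_mul_self, ← hLe, ← Real.exp_nat_mul]
  rw [h1, neg_div_neg_eq, mul_div_assoc', h2, div_le_iff₀ (by positivity)]
  have : 0 < (2 * X) ^ ρ := by positivity
  nlinarith

instance instIsFiniteMeasureOnCompactsHaarG : IsFiniteMeasureOnCompacts (haarG 𝕂) := by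
  refine ⟨fun s hs => ?_⟩
  obtain ⟨b, hb⟩ := hs.exists_bound_of_continuousOn (continuous_coshHeight (𝕂 := 𝕂)).continuousOn
  have hsub : s ⊆ {g | coshHeight g ≤ max b 1} := fun g hg =>
    ((le_abs_self _).trans (hb g hg)).trans (le_max_left _ _)
  refine (measure_mono hsub).trans_lt ((haarG_coshHeight_le (by positivity)).trans_lt ?_)
  exact ENNReal.mul_lt_top ENNReal.ofReal_lt_top measure_ball_lt_top

instance instIsLocallyFiniteMeasureHaarG : IsLocallyFiniteMeasure (haarG 𝕂) :=
  isLocallyFiniteMeasure_of_isFiniteMeasureOnCompacts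

end HaarG

/-! ### Convolution, positive definiteness, support and size of `u ∗ ǔ`. -/

section Convolution

theorem continuous_check {u : SL(2, 𝕂) → ℂ} (hu : Continuous u) : Continuous (check u) :=
  Complex.continuous_conj.comp (hu.comp continuous_inv)

theorem IsSpherical.check {u : SL(2, 𝕂) → ℂ} (hu : IsSpherical u) : IsSpherical (check u) :=
  fun k₁ h₁ k₂ h₂ g => by
    simp only [SphericalSL2.check, mul_inv_rev]
    rw [← mul_assoc, hu _ (inv_mem h₂) _ (inv_mem h₁)]

theorem IsSpherical.right {E : SL(2, 𝕂) → ℂ} (hu : IsSpherical E) : IsRightInvariant E :=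
  fun k hk g => by simpa using hu 1 (one_mem _) k hk g

theorem IsSpherical.left {u : SL(2, 𝕂) → ℂ} (hu : IsSpherical u) {k : SL(2, 𝕂)}
    (hk : k ∈ maxCompact 𝕂) (g : SL(2, 𝕂)) : u (k * g) = u g := by
  simpa using hu k hk 1 (one_mem _) g

variable [MeasureSpace 𝕂] [BorelSpace 𝕂] [(volume : Measure 𝕂).IsAddHaarMeasure]

theorem conv_check_apply (u : SL(2, 𝕂) → ℂ) (g : SL(2, 𝕂)) :
    conv u (check u) g = ∫ x, u x * (starRingEnd ℂ) (u (g⁻¹ * x)) ∂haarG 𝕂 := by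
  simp [conv, check, mul_inv_rev]

theorem continuous_conv {u v : SL(2, 𝕂) → ℂ} (hu : Continuous u) (hc : HasCompactSupport u)
    (hv : Continuous v) : Continuous (conv u v) := by
  have h : ∀ g, conv u v g = ∫ x in tsupport u, u x * v (x⁻¹ * g) ∂haarG 𝕂 := fun g => by
    rw [conv, setIntegral_eq_integral_of_forall_compl_eq_zero]
    intro x hx
    rw [image_eq_zero_of_notMem_tsupport hx, zero_mul]
  rw [show conv u v = fun g => ∫ x in tsupport u, u x * v (x⁻¹ * g) ∂haarG 𝕂 from funext h]
  exact continuous_parametric_integral_of_continuous (by fun_prop) hc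

theorem IsSpherical.conv {u v : SL(2, 𝕂) → ℂ} (hu : IsSpherical u) (hv : IsSpherical v) :
    IsSpherical (conv u v) := fun k₁ h₁ k₂ h₂ g => by
  rw [SphericalSL2.conv, SphericalSL2.conv]
  rw [← integral_mul_left_eq_self (fun x => u x * v (x⁻¹ * (k₁ * g * k₂))) k₁]
  refine integral_congr_ae (Filter.Eventually.of_forall fun x => ?_)
  simp only [hu.left h₁, mul_inv_rev]
  rw [show x⁻¹ * k₁⁻¹ * (k₁ * g * k₂) = x⁻¹ * g * k₂ by group, hv.right k₂ h₂]

theorem integrable_mul_conj_translate {u : SL(2, 𝕂) → ℂ} (hu : Continuous u)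
    (hc : HasCompactSupport u) (g h : SL(2, 𝕂)) :
    Integrable (fun x => u (g * x) * (starRingEnd ℂ) (u (h * x))) (haarG 𝕂) := by
  have h1 : Continuous fun x => (starRingEnd ℂ) (u (h * x)) :=
    Complex.continuous_conj.comp (by fun_prop)
  have h2 : Continuous fun x => u (g * x) := by fun_prop
  exact (h2.mul h1).integrable_of_hasCompactSupport
    ((hc.comp_homeomorph (Homeomorph.mulLeft g)).mul_right)

theorem conv_check_translate (u : SL(2, 𝕂) → ℂ) (g h : SL(2, 𝕂)) :
    conv u (check u) (g⁻¹ * h) =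
      ∫ x, u (g⁻¹ * x) * (starRingEnd ℂ) (u (h⁻¹ * x)) ∂haarG 𝕂 := by
  rw [conv_check_apply,
    ← integral_mul_left_eq_self (fun x => u x * (starRingEnd ℂ) (u ((g⁻¹ * h)⁻¹ * x))) g⁻¹]
  refine integral_congr_ae (Filter.Eventually.of_forall fun x => ?_)
  simp only
  rw [show (g⁻¹ * h)⁻¹ * (g⁻¹ * x) = h⁻¹ * x by group]

/-- The matrix is the Gram matrix of the left translates of `u` in `L²(G)`, so its quadratic form is
the integral of `‖w x‖ ^ 2`. -/
theorem isPositiveDefinite_conv_check {u : SL(2, 𝕂) → ℂ} (hu : Continuous u)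
    (hc : HasCompactSupport u) : IsPositiveDefinite (conv u (check u)) := by
  intro n g
  refine Matrix.PosSemidef.of_dotProduct_mulVec_nonneg ?_ fun c => ?_
  · ext i j
    rw [Matrix.conjTranspose_apply, Matrix.of_apply, Matrix.of_apply, conv_check_translate,
      conv_check_translate, ← starRingEnd_apply, ← integral_conj]
    refine integral_congr_ae (Filter.Eventually.of_forall fun x => ?_)
    simp [mul_comm]
  · set w : SL(2, 𝕂) → ℂ := fun x => ∑ i, (starRingEnd ℂ) (c i) * u ((g i)⁻¹ * x) with hw
    have h : star c ⬝ᵥ ((Matrix.of fun i j => conv u (check u) ((g i)⁻¹ * g j)).mulVec c) =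
        ∫ x, ((‖w x‖ ^ 2 : ℝ) : ℂ) ∂haarG 𝕂 := by
      have h1 : ∀ x, ((‖w x‖ ^ 2 : ℝ) : ℂ) = ∑ i, ∑ j, (starRingEnd ℂ (c i) * c j) *
          (u ((g i)⁻¹ * x) * (starRingEnd ℂ) (u ((g j)⁻¹ * x))) := fun x => by
        have : ((‖w x‖ ^ 2 : ℝ) : ℂ) = w x * (starRingEnd ℂ) (w x) := by
          rw [Complex.mul_conj, Complex.normSq_eq_norm_sq]
        rw [this, hw, map_sum, Finset.sum_mul_sum]
        refine Finset.sum_congr rfl fun i _ => Finset.sum_congr rfl fun j _ => ?_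
        simp only [map_mul, Complex.conj_conj]
        ring
      simp_rw [h1]
      rw [integral_finsetSum _ fun i _ => integrable_finsetSum _ fun j _ =>
        (integrable_mul_conj_translate hu hc _ _).const_mul _]
      simp only [dotProduct, Matrix.mulVec, Matrix.of_apply]
      refine Finset.sum_congr rfl fun i _ => ?_
      rw [integral_finsetSum _ fun j _ => (integrable_mul_conj_translate hu hc _ _).const_mul _,
        Finset.mul_sum]
      refine Finset.sum_congr rfl fun j _ => ?_
      rw [integral_const_mul, conv_check_translate]
      simp only [Pi.star_apply, RCLike.star_def]
      ring
    rw [h, integral_complex_ofReal]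
    exact Complex.zero_le_real.2 (integral_nonneg fun x => by positivity)

/-- A nonzero integrand requires both `x` and `x⁻¹ g` to have height at most `r`, and the height is
subadditive. -/
theorem tsupport_conv_check_subset {u : SL(2, 𝕂) → ℂ} {r : ℝ}
    (hu : ∀ g, u g ≠ 0 → height g ≤ r) :
    tsupport (conv u (check u)) ⊆ heightBall 𝕂 (2 * r) := by
  refine closure_minimal (fun g hg => ?_) (isClosed_heightBall _)
  by_contra hgr
  refine hg ?_
  rw [conv_check_apply]
  refine integral_eq_zero_of_ae (Filter.Eventually.of_forall fun x => ?_)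
  simp only [Pi.zero_apply, mul_eq_zero, map_eq_zero]
  by_contra! h
  have h1 := hu _ h.1
  have h2 := hu _ h.2
  rw [← height_inv, mul_inv_rev, inv_inv] at h2
  have h3 := height_mul_le x (x⁻¹ * g)
  rw [mul_inv_cancel_left] at h3
  exact hgr (show height g ≤ 2 * r by linarith)

theorem norm_conv_check_le {u : SL(2, 𝕂) → ℂ} {b X : ℝ} (hX : 0 < X) (hb : ∀ g, ‖u g‖ ≤ b)
    (hsupp : ∀ g, u g ≠ 0 → coshHeight g ≤ X) (g : SL(2, 𝕂)) :
    ‖conv u (check u) g‖ ≤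
      b ^ 2 * (2 * (2 * X) ^ degree 𝕂 * (volume (Metric.ball (0 : 𝕂) 1)).toReal) := by
  have hb0 : 0 ≤ b := (norm_nonneg _).trans (hb 1)
  rw [conv_check_apply, ← setIntegral_eq_integral_of_forall_compl_eq_zero
    (s := {x | coshHeight x ≤ X}) fun x hx => by
      rw [show u x = 0 by by_contra h; exact hx (hsupp x h), zero_mul]]
  have hV := haarG_coshHeight_le (𝕂 := 𝕂) hX
  have hlt : haarG 𝕂 {x | coshHeight x ≤ X} < (⊤ : ℝ≥0∞) :=
    (isCompact_coshHeight_le X).measure_lt_top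
  refine (norm_setIntegral_le_of_norm_le_const (C := b ^ 2) hlt fun x _ => ?_).trans ?_
  · rw [norm_mul, RCLike.norm_conj, sq]
    exact mul_le_mul (hb _) (hb _) (norm_nonneg _) hb0
  · refine mul_le_mul_of_nonneg_left ?_ (sq_nonneg b)
    refine (ENNReal.toReal_mono ?_ hV).trans ?_
    · exact (ENNReal.mul_lt_top ENNReal.ofReal_lt_top measure_ball_lt_top).ne
    · rw [ENNReal.toReal_mul, ENNReal.toReal_ofReal (by positivity)]

end Convolution

/-! ### The Abel transform, convolution and the spherical transform. -/

section Abel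

theorem abs_le_of_cosh_le {s M : ℝ} (h : Real.cosh s ≤ M) : |s| ≤ M := by
  rw [← Real.cosh_abs] at h
  have h1 := Real.add_one_le_exp |s|
  have h2 := Real.exp_pos (-|s|)
  have h3 := Real.add_one_le_exp (-|s|)
  have h4 := Real.cosh_eq |s|
  have h5 := Real.quadratic_le_exp_of_nonneg (abs_nonneg s)
  nlinarith [sq_nonneg (|s| - 1), abs_nonneg s]

theorem norm_le_of_coshHeight_le {s M : ℝ} {y : 𝕂} (h : coshHeight (aMat s * nMat y) ≤ M) :
    ‖s‖ ≤ M ∧ ‖y‖ ≤ Real.sqrt (2 * M * Real.exp M) := by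
  rw [coshHeight_aMat_mul_nMat] at h
  have hc := Real.one_le_cosh s
  have hn : 0 ≤ Real.exp s * ‖y‖ ^ 2 / 2 := by positivity
  have h1 : |s| ≤ M := abs_le_of_cosh_le (by linarith)
  refine ⟨h1, Real.le_sqrt_of_sq_le ?_⟩
  have h2 : Real.exp s * ‖y‖ ^ 2 ≤ 2 * M := by linarith
  have h3 : Real.exp (-s) ≤ Real.exp M := Real.exp_le_exp.2 ((neg_le_abs s).trans h1)
  calc ‖y‖ ^ 2 = Real.exp (-s) * (Real.exp s * ‖y‖ ^ 2) := by
        rw [← mul_assoc, ← Real.exp_add]; simp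
    _ ≤ Real.exp M * (2 * M) := by gcongr
    _ = _ := by ring

theorem exists_coshHeight_bound {f : SL(2, 𝕂) → ℂ} (hc : HasCompactSupport f) :
    ∃ M : ℝ, 0 ≤ M ∧ ∀ g, f g ≠ 0 → coshHeight g ≤ M := by
  obtain ⟨b, hb⟩ := hc.isCompact.exists_bound_of_continuousOn
    (continuous_coshHeight (𝕂 := 𝕂)).continuousOn
  refine ⟨max b 0, le_max_right _ _, fun g hg => ?_⟩
  exact ((le_abs_self _).trans (hb g (subset_tsupport f hg))).trans (le_max_left _ _)

theorem hasCompactSupport_of_coshHeight_bound {f : SL(2, 𝕂) → ℂ} {M : ℝ}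
    (h : ∀ g, f g ≠ 0 → coshHeight g ≤ M) : HasCompactSupport f :=
  HasCompactSupport.of_support_subset_isCompact (isCompact_coshHeight_le M) h

theorem hasCompactSupport_comp_aMat_mul_nMat {f : SL(2, 𝕂) → ℂ} (hc : HasCompactSupport f) :
    HasCompactSupport fun p : ℝ × 𝕂 => f (aMat p.1 * nMat p.2) := by
  obtain ⟨M, hM0, hM⟩ := exists_coshHeight_bound hc
  refine HasCompactSupport.of_support_subset_isCompact ((isCompact_closedBall (0 : ℝ) M).prod
    (isCompact_closedBall (0 : 𝕂) (Real.sqrt (2 * M * Real.exp M)))) fun p hp => ?_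
  simpa using norm_le_of_coshHeight_le (hM _ hp)

variable [MeasureSpace 𝕂] [BorelSpace 𝕂] [(volume : Measure 𝕂).IsAddHaarMeasure]

theorem IsRightInvariant.integral_haarG {f : SL(2, 𝕂) → ℂ} (hf : Measurable f)
    (hi : IsRightInvariant f) :
    ∫ g, f g ∂haarG 𝕂 =
      ∫ p : ℝ × 𝕂, f (aMat p.1 * nMat p.2) ∂(volume : Measure ℝ).prod (volume : Measure 𝕂) := by
  have hp : MeasurePreserving (fun p : ℝ × 𝕂 × SL(2, 𝕂) => (p.1, p.2.1))
      ((volume : Measure ℝ).prod ((volume : Measure 𝕂).prod (haarProb (maxCompact 𝕂))))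
      ((volume : Measure ℝ).prod (volume : Measure 𝕂)) :=
    (MeasurePreserving.id _).prod measurePreserving_fst
  have hm : Measurable fun p : ℝ × 𝕂 => f (aMat p.1 * nMat p.2) :=
    hf.comp (Continuous.measurable (by fun_prop))
  rw [haarG, integral_map measurable_iwasawaMap.aemeasurable hf.aestronglyMeasurable, ← hp.map_eq,
    integral_map hp.measurable.aemeasurable hm.aestronglyMeasurable]
  refine integral_congr_ae ?_
  have h2 : ∀ᵐ q ∂((volume : Measure 𝕂).prod (haarProb (maxCompact 𝕂))), q.2 ∈ maxCompact 𝕂 :=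
    Measure.quasiMeasurePreserving_snd.ae ae_mem_maxCompact
  have h3 : ∀ᵐ p ∂((volume : Measure ℝ).prod
      ((volume : Measure 𝕂).prod (haarProb (maxCompact 𝕂)))), p.2.2 ∈ maxCompact 𝕂 :=
    Measure.quasiMeasurePreserving_snd.ae h2
  filter_upwards [h3] with p hp
  exact hi _ hp _

/-- The integral of `f` along `a(t) N`. -/
def unipotentIntegral (f : SL(2, 𝕂) → ℂ) (t : ℝ) : ℂ := ∫ z : 𝕂, f (aMat t * nMat z)

/-- The Abel (Harish-Chandra) transform. -/
def abelTransform (f : SL(2, 𝕂) → ℂ) (t : ℝ) : ℂ :=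
  (Real.exp (degree 𝕂 * t / 2) : ℂ) * unipotentIntegral f t

/-- Since `A` normalizes `N`, the point `(a(s) n(y))⁻¹ a(t) n(z)` is `a(t - s)` times `n` of a
translate of `z`. Integrating over `z` first removes the translation and separates the variables. -/
theorem unipotentIntegral_conv {u v : SL(2, 𝕂) → ℂ} (hu : Continuous u)
    (huc : HasCompactSupport u) (hus : IsSpherical u) (hv : Continuous v)
    (hvc : HasCompactSupport v) (hvs : IsSpherical v) (t : ℝ) :
    unipotentIntegral (conv u v) t =
      ∫ s, unipotentIntegral u s * unipotentIntegral v (t - s) := by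
  have hcoord : ∀ (z : 𝕂) (p : ℝ × 𝕂), (aMat p.1 * nMat p.2)⁻¹ * (aMat t * nMat z) =
      aMat (t - p.1) * nMat (z - ((Real.exp (-(t - p.1)) : ℝ) : 𝕂) * p.2) := by
    intro z p
    rw [mul_inv_rev, ← nMat_neg, ← aMat_neg, mul_assoc, ← mul_assoc (aMat (-p.1)), ← aMat_add,
      ← mul_assoc, neg_add_eq_sub, nMat_mul_aMat, mul_assoc, ← nMat_add]
    congr 2
    ring
  have hconv : ∀ z : 𝕂, conv u v (aMat t * nMat z) = ∫ p : ℝ × 𝕂, u (aMat p.1 * nMat p.2) *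
      v (aMat (t - p.1) * nMat (z - ((Real.exp (-(t - p.1)) : ℝ) : 𝕂) * p.2))
        ∂(volume : Measure ℝ).prod (volume : Measure 𝕂) := by
    intro z
    rw [conv, IsRightInvariant.integral_haarG]
    · simp_rw [hcoord]
    · exact Continuous.measurable (by fun_prop)
    · intro k hk g
      simp only [hus.right k hk, mul_inv_rev, mul_assoc, hvs.left (inv_mem hk)]
  have hexpc : Continuous fun q : 𝕂 × ℝ × 𝕂 => ((Real.exp (-(t - q.2.1)) : ℝ) : 𝕂) :=
    RCLike.continuous_ofReal.comp (by fun_prop)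
  have hJc : Continuous fun q : 𝕂 × ℝ × 𝕂 => u (aMat q.2.1 * nMat q.2.2) *
      v (aMat (t - q.2.1) * nMat (q.1 - ((Real.exp (-(t - q.2.1)) : ℝ) : 𝕂) * q.2.2)) := by
    fun_prop
  have hJs : HasCompactSupport fun q : 𝕂 × ℝ × 𝕂 => u (aMat q.2.1 * nMat q.2.2) *
      v (aMat (t - q.2.1) * nMat (q.1 - ((Real.exp (-(t - q.2.1)) : ℝ) : 𝕂) * q.2.2)) := by
    obtain ⟨M, hM0, hM⟩ := exists_coshHeight_bound huc
    obtain ⟨M', hM0', hM'⟩ := exists_coshHeight_bound hvc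
    refine HasCompactSupport.of_support_subset_isCompact ((isCompact_closedBall (0 : 𝕂)
      (Real.sqrt (2 * M' * Real.exp M') + Real.exp M' * Real.sqrt (2 * M * Real.exp M))).prod
      ((isCompact_closedBall (0 : ℝ) M).prod
      (isCompact_closedBall (0 : 𝕂) (Real.sqrt (2 * M * Real.exp M))))) fun q hq => ?_
    have h1 := norm_le_of_coshHeight_le (hM _ (left_ne_zero_of_mul hq))
    have h2 := norm_le_of_coshHeight_le (hM' _ (right_ne_zero_of_mul hq))
    simp only [Set.mem_prod, mem_closedBall_zero_iff]
    refine ⟨?_, h1⟩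
    have h3 : ‖((Real.exp (-(t - q.2.1)) : ℝ) : 𝕂) * q.2.2‖ ≤
        Real.exp M' * Real.sqrt (2 * M * Real.exp M) := by
      rw [norm_mul, RCLike.norm_ofReal, Real.abs_exp]
      gcongr
      · exact (neg_le_abs _).trans h2.1
      · exact h1.2
    calc ‖q.1‖ = ‖(q.1 - ((Real.exp (-(t - q.2.1)) : ℝ) : 𝕂) * q.2.2) +
          ((Real.exp (-(t - q.2.1)) : ℝ) : 𝕂) * q.2.2‖ := by rw [sub_add_cancel]
      _ ≤ _ := (norm_add_le _ _).trans (add_le_add h2.2 h3)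
  have hJ : Integrable (Function.uncurry fun (z : 𝕂) (p : ℝ × 𝕂) => u (aMat p.1 * nMat p.2) *
      v (aMat (t - p.1) * nMat (z - ((Real.exp (-(t - p.1)) : ℝ) : 𝕂) * p.2)))
      ((volume : Measure 𝕂).prod ((volume : Measure ℝ).prod (volume : Measure 𝕂))) :=
    hJc.integrable_of_hasCompactSupport hJs
  have hinner : ∀ p : ℝ × 𝕂, ∫ z : 𝕂, u (aMat p.1 * nMat p.2) *
      v (aMat (t - p.1) * nMat (z - ((Real.exp (-(t - p.1)) : ℝ) : 𝕂) * p.2)) =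
      u (aMat p.1 * nMat p.2) * unipotentIntegral v (t - p.1) := fun p => by
    rw [integral_const_mul]
    congr 1
    exact integral_sub_right_eq_self (fun z : 𝕂 => v (aMat (t - p.1) * nMat z)) _
  have hI := hJ.integral_prod_right
  simp only [Function.uncurry_apply_pair, hinner] at hI
  rw [unipotentIntegral]
  simp_rw [hconv]
  rw [integral_integral_swap hJ]
  simp_rw [hinner]
  rw [integral_prod _ hI]
  refine integral_congr_ae (Filter.Eventually.of_forall fun s => ?_)
  simp only [unipotentIntegral]
  rw [integral_mul_const]

theorem abelTransform_conv {u v : SL(2, 𝕂) → ℂ} (hu : Continuous u)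
    (huc : HasCompactSupport u) (hus : IsSpherical u) (hv : Continuous v)
    (hvc : HasCompactSupport v) (hvs : IsSpherical v) (t : ℝ) :
    abelTransform (conv u v) t = ∫ s, abelTransform u s * abelTransform v (t - s) := by
  rw [abelTransform, unipotentIntegral_conv hu huc hus hv hvc hvs, ← integral_const_mul]
  refine integral_congr_ae (Filter.Eventually.of_forall fun s => ?_)
  simp only [abelTransform]
  rw [show degree 𝕂 * t / 2 = degree 𝕂 * s / 2 + degree 𝕂 * (t - s) / 2 by ring, Real.exp_add]
  push_cast
  ring

theorem sphericalVector_aMat_mul_nMat_mul (σ t : ℝ) (z : 𝕂) {k : SL(2, 𝕂)}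
    (hk : k ∈ maxCompact 𝕂) : sphericalVector σ (aMat t * nMat z * k) =
      ((Real.exp (degree 𝕂 * t * σ) * Real.exp (degree 𝕂 * t / 2) : ℝ) : ℂ) := by
  rw [sphericalVector, iwasawaY_aMat_mul_nMat_mul t z hk, ← Real.exp_nat_mul,
    show ((σ : ℂ) + 1 / 2) = ((σ + 1 / 2 : ℝ) : ℂ) by push_cast; ring,
    ← Complex.ofReal_cpow (Real.exp_pos _).le, ← Real.exp_mul, ← Real.exp_add]
  ring_nf

theorem continuous_sphericalVector (s : ℂ) :
    Continuous (sphericalVector s : SL(2, 𝕂) → ℂ) := by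
  unfold sphericalVector
  refine Continuous.cpow ?_ continuous_const fun g => ?_
  · exact Complex.continuous_ofReal.comp (continuous_iwasawaY.pow _)
  · exact Complex.ofReal_mem_slitPlane.2 (pow_pos (iwasawaY_pos g) _)

/-- The `K`-average defining the spherical function is absorbed by left invariance of the Haar
measure and of `f`. -/
theorem sphericalTransform_eq_integral_sphericalVector {f : SL(2, 𝕂) → ℂ} (hf : Continuous f)
    (hc : HasCompactSupport f) (hs : IsSpherical f) (s : ℂ) :
    sphericalTransform f s = ∫ g, f g * sphericalVector s g ∂haarG 𝕂 := by
  have hv := continuous_sphericalVector (𝕂 := 𝕂) s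
  have h1 : ∀ g, f g * sphericalFunction s g = ∫ k : maxCompact 𝕂,
      f g * sphericalVector s ((k : SL(2, 𝕂)) * g)
        ∂Measure.haarMeasure (⊤ : PositiveCompacts (maxCompact 𝕂)) := fun g => by
    have hm : AEStronglyMeasurable (fun k => sphericalVector s (k * g))
        (haarProb (maxCompact 𝕂)) := Continuous.aestronglyMeasurable (by fun_prop)
    rw [sphericalFunction, haarProb, integral_map measurable_subtype_coe.aemeasurable hm,
      integral_const_mul]
  rw [sphericalTransform]
  simp_rw [h1]
  rw [integral_integral_swap_of_hasCompactSupport]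
  · have h2 : ∀ k : maxCompact 𝕂, ∫ g, f g * sphericalVector s ((k : SL(2, 𝕂)) * g) ∂haarG 𝕂 =
        ∫ g, f g * sphericalVector s g ∂haarG 𝕂 := fun k => by
      rw [← integral_mul_left_eq_self (fun g => f g * sphericalVector s g) (k : SL(2, 𝕂))]
      simp_rw [hs.left k.2]
    simp_rw [h2]
    rw [integral_const, probReal_univ, one_smul]
  · simp only [Function.uncurry_def]
    fun_prop
  · refine HasCompactSupport.of_support_subset_isCompact
      (hc.isCompact.prod (isCompact_univ (X := maxCompact 𝕂))) fun p hp => ?_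
    exact ⟨subset_tsupport f (left_ne_zero_of_mul hp), Set.mem_univ _⟩

/-- On `a(t) n(z)` the spherical vector equals `e^{ρt(σ + 1/2)}`; the summand `1/2` in the exponent
is the weight in `abelTransform`. -/
theorem sphericalTransform_eq_integral_abelTransform {f : SL(2, 𝕂) → ℂ} (hf : Continuous f)
    (hc : HasCompactSupport f) (hs : IsSpherical f) (σ : ℝ) :
    sphericalTransform f σ =
      ∫ t : ℝ, ((Real.exp (degree 𝕂 * t * σ) : ℝ) : ℂ) * abelTransform f t := by
  rw [sphericalTransform_eq_integral_sphericalVector hf hc hs]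
  have hv := continuous_sphericalVector (𝕂 := 𝕂) σ
  rw [IsRightInvariant.integral_haarG (f := fun g => f g * sphericalVector σ g)
    (Continuous.measurable (by fun_prop)), integral_prod]
  · refine integral_congr_ae (Filter.Eventually.of_forall fun t => ?_)
    have h := fun z : 𝕂 => sphericalVector_aMat_mul_nMat_mul σ t z (one_mem (maxCompact 𝕂))
    simp only [mul_one] at h
    simp only [h, abelTransform, unipotentIntegral]
    rw [integral_mul_const]
    push_cast
    ring
  · refine Continuous.integrable_of_hasCompactSupport (by fun_prop) ?_
    exact (hasCompactSupport_comp_aMat_mul_nMat hc).mul_right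
  · intro k hk g
    simp only [hs.right k hk, sphericalVector, iwasawaY_mul_right hk]

end Abel

/-! ### The Haar measure of the diagonal subgroup and a fundamental domain for `A`. -/

section HaarD

instance instSFiniteHaarD : SFinite (haarD 𝕂) := by
  unfold haarD; infer_instance

theorem measurable_haarDMap :
    Measurable fun p : ℝ × SL(2, 𝕂) => (aMat p.1 * p.2 : SL(2, 𝕂)) :=
  Continuous.measurable (by fun_prop)

theorem lintegral_haarD {f : SL(2, 𝕂) → ℝ≥0∞} (hf : Measurable f) :
    ∫⁻ d, f d ∂haarD 𝕂 = ∫⁻ t : ℝ, ∫⁻ τ, f (aMat t * τ) ∂haarProb (compactTorus 𝕂) := by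
  rw [haarD, lintegral_map hf measurable_haarDMap]
  exact lintegral_prod (fun p : ℝ × SL(2, 𝕂) => f (aMat p.1 * p.2))
    (hf.comp measurable_haarDMap).aemeasurable

theorem ae_mem_diagSubgroup : ∀ᵐ d ∂haarD 𝕂, d ∈ diagSubgroup 𝕂 := by
  refine (ae_map_iff measurable_haarDMap.aemeasurable
    (isClosed_diagSubgroup 𝕂).measurableSet).2 ?_
  filter_upwards [Measure.quasiMeasurePreserving_snd.ae (ae_mem_compactTorus (𝕂 := 𝕂))] with p hp
  exact mul_mem (aMat_mem_diagSubgroup _) hp.1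

theorem lintegral_haarD_mul_right {f : SL(2, 𝕂) → ℝ≥0∞} (hf : Measurable f)
    {d : SL(2, 𝕂)} (hd : d ∈ diagSubgroup 𝕂) : ∫⁻ h, f (h * d) ∂haarD 𝕂 = ∫⁻ h, f h ∂haarD 𝕂 := by
  obtain ⟨τ₀, hτ₀, h⟩ := exists_compactTorus_eq_aMat_mul hd
  set s := 2 * Real.log ‖d 0 0‖
  rw [lintegral_haarD hf, lintegral_haarD (f := fun h => f (h * d)) (by fun_prop)]
  rw [← lintegral_add_right_eq_self
    (fun t : ℝ => ∫⁻ τ, f (aMat t * τ) ∂haarProb (compactTorus 𝕂)) s]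
  refine lintegral_congr fun t => ?_
  rw [← lintegral_haarProb_mul_right (f := fun τ => f (aMat (t + s) * τ)) (by fun_prop) hτ₀]
  refine lintegral_haarProb_congr (by fun_prop) (by fun_prop) fun τ hτ => ?_
  rw [h, aMat_add, mul_assoc, ← mul_assoc τ,
    diagSubgroup_mul_comm hτ.1 (aMat_mem_diagSubgroup s)]
  simp only [mul_assoc]

theorem lintegral_haarD_inv {f : SL(2, 𝕂) → ℝ≥0∞} (hf : Measurable f) :
    ∫⁻ h, f h⁻¹ ∂haarD 𝕂 = ∫⁻ h, f h ∂haarD 𝕂 := by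
  rw [lintegral_haarD hf, lintegral_haarD (f := fun h => f h⁻¹) (by fun_prop)]
  rw [← lintegral_neg_eq_self (fun t : ℝ => ∫⁻ τ, f (aMat t * τ) ∂haarProb (compactTorus 𝕂))]
  refine lintegral_congr fun t => ?_
  rw [← lintegral_haarProb_inv (f := fun τ => f (aMat (-t) * τ)) (by fun_prop)]
  refine lintegral_haarProb_congr (by fun_prop) (by fun_prop) fun τ hτ => ?_
  rw [mul_inv_rev, ← aMat_neg, diagSubgroup_mul_comm (inv_mem hτ.1) (aMat_mem_diagSubgroup _)]

theorem iwasawaY_compactTorus_mul {τ : SL(2, 𝕂)} (h : τ ∈ compactTorus 𝕂) (g : SL(2, 𝕂)) :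
    iwasawaY (τ * g) = iwasawaY g := by
  have h1 : ‖τ 1 1‖ = 1 := by
    rw [(mem_maxCompact_iff.1 h.2).1, RCLike.norm_conj, norm_of_mem_compactTorus h]
  simp [iwasawaY, mul_entry, h.1.2, h1]

theorem iwasawaT_aMat_mul (t : ℝ) (g : SL(2, 𝕂)) : iwasawaT (aMat t * g) = t + iwasawaT g := by
  rw [iwasawaT, iwasawaY_aMat_mul, Real.log_mul (Real.exp_pos t).ne' (iwasawaY_pos g).ne',
    Real.log_exp, iwasawaT]

/-- The indicator function of a fundamental domain for the left action of `A`. -/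
def strip (g : SL(2, 𝕂)) : ℝ≥0∞ := (Set.Ico (0 : ℝ) 1).indicator 1 (iwasawaT g)

theorem measurable_strip : Measurable (strip : SL(2, 𝕂) → ℝ≥0∞) :=
  (measurable_one.indicator measurableSet_Ico).comp continuous_iwasawaT.measurable

theorem lintegral_haarD_strip (g : SL(2, 𝕂)) : ∫⁻ d, strip (d * g) ∂haarD 𝕂 = 1 := by
  have hm := measurable_strip (𝕂 := 𝕂)
  rw [lintegral_haarD (f := fun d => strip (d * g)) (by fun_prop)]
  have h : ∀ t : ℝ, ∫⁻ τ, strip (aMat t * τ * g) ∂haarProb (compactTorus 𝕂) =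
      (Set.Ico (0 : ℝ) 1).indicator 1 (t + iwasawaT g) := fun t => by
    rw [lintegral_haarProb_congr (f' := fun _ => (Set.Ico (0 : ℝ) 1).indicator 1 (t + iwasawaT g))
      (by fun_prop) measurable_const fun τ hτ => ?_]
    · simp
    · rw [strip, mul_assoc, iwasawaT_aMat_mul, iwasawaT, iwasawaY_compactTorus_mul hτ, iwasawaT]
  simp_rw [h]
  rw [lintegral_add_right_eq_self (fun t : ℝ => (Set.Ico (0 : ℝ) 1).indicator 1 t),
    lintegral_indicator_one measurableSet_Ico]
  simp

end HaarD

/-! ### Finiteness of the coset weight, and independence of the choice of weight. -/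

section Weight

theorem continuous_cosetWeight : Continuous (cosetWeight : SL(2, 𝕂) → ℝ≥0∞) :=
  ENNReal.continuous_ofReal.comp (by fun_prop)

theorem measurable_cosetWeight : Measurable (cosetWeight : SL(2, 𝕂) → ℝ≥0∞) :=
  continuous_cosetWeight.measurable

theorem cosetWeight_pos (g : SL(2, 𝕂)) : 0 < cosetWeight g :=
  ENNReal.ofReal_pos.2 (Real.exp_pos _)

theorem cosetWeight_le_one (g : SL(2, 𝕂)) : cosetWeight g ≤ 1 := by
  rw [cosetWeight, ENNReal.ofReal_le_one, Real.exp_le_one_iff]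
  linarith [one_le_coshHeight g]

theorem lintegral_cosetWeight_ne_zero {m : Measure SL(2, 𝕂)} (hm : m ≠ 0) (p g : SL(2, 𝕂)) :
    ∫⁻ h, cosetWeight (p * (h * g)) ∂m ≠ 0 := by
  have hw := measurable_cosetWeight (𝕂 := 𝕂)
  rw [Ne, lintegral_eq_zero_iff (by fun_prop)]
  intro h
  refine hm (Measure.measure_univ_eq_zero.1 ?_)
  rw [Filter.EventuallyEq, ae_iff] at h
  convert h using 2
  ext x
  simpa using (cosetWeight_pos _).ne'

theorem haarD_ne_zero : haarD 𝕂 ≠ 0 := by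
  intro h
  have := lintegral_haarD_strip (1 : SL(2, 𝕂))
  rw [h] at this
  simp at this

theorem integrable_exp_neg_abs : Integrable fun t : ℝ => Real.exp (-|t|) := by
  refine (integrable_inv_one_add_sq.const_mul 2).mono' (by fun_prop)
    (Filter.Eventually.of_forall fun t => ?_)
  rw [Real.norm_eq_abs, Real.abs_exp, Real.exp_neg, ← div_eq_mul_inv,
    inv_le_comm₀ (Real.exp_pos _) (by positivity), inv_div]
  have h := Real.quadratic_le_exp_of_nonneg (abs_nonneg t)
  rw [sq_abs] at h
  linarith [abs_nonneg t]

theorem height_aMat_mul {t : ℝ} {k : SL(2, 𝕂)} (hk : k ∈ maxCompact 𝕂) :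
    height (aMat t * k) = |t| := by
  rw [height, coshHeight_mul_right hk, coshHeight_aMat, ← Real.cosh_abs,
    Real.arcosh_cosh (abs_nonneg t)]

theorem height_le_coshHeight (g : SL(2, 𝕂)) : height g ≤ coshHeight g := by
  have := abs_le_of_cosh_le (cosh_height g).le
  rwa [abs_of_nonneg (height_nonneg g)] at this

/-- Subadditivity bounds the height of `p a(t) τ g` below by `|t|` minus a constant, so the weight
decays at least like `e^{-|t|}` along the coset. -/
theorem lintegral_haarD_cosetWeight_ne_top (p g : SL(2, 𝕂)) :
    ∫⁻ h, cosetWeight (p * (h * g)) ∂haarD 𝕂 ≠ ⊤ := by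
  have hw := measurable_cosetWeight (𝕂 := 𝕂)
  rw [lintegral_haarD (f := fun h => cosetWeight (p * (h * g))) (by fun_prop)]
  set c := height p + height g with hc
  have h1 : ∀ t : ℝ, ∫⁻ τ, cosetWeight (p * (aMat t * τ * g)) ∂haarProb (compactTorus 𝕂) ≤
      ENNReal.ofReal (Real.exp c * Real.exp (-|t|)) := fun t => by
    have h2 : ∀ᵐ τ ∂haarProb (compactTorus 𝕂), cosetWeight (p * (aMat t * τ * g)) ≤
        ENNReal.ofReal (Real.exp c * Real.exp (-|t|)) := by
      filter_upwards [ae_mem_compactTorus (𝕂 := 𝕂)] with τ hτ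
      rw [cosetWeight, ← Real.exp_add]
      refine ENNReal.ofReal_le_ofReal (Real.exp_le_exp.2 ?_)
      have h3 := height_mul_le (p⁻¹ * (p * (aMat t * τ * g))) g⁻¹
      have h4 := height_mul_le p⁻¹ (p * (aMat t * τ * g))
      rw [inv_mul_cancel_left, mul_inv_cancel_right, height_aMat_mul hτ.2, height_inv] at h3
      rw [inv_mul_cancel_left, height_inv] at h4
      have h5 := height_le_coshHeight (p * (aMat t * τ * g))
      linarith
    refine (lintegral_mono_ae h2).trans ?_
    simp
  refine ((lintegral_mono h1).trans_lt ?_).ne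
  exact (integrable_exp_neg_abs.const_mul _).lintegral_lt_top

variable [MeasureSpace 𝕂] [BorelSpace 𝕂] [(volume : Measure 𝕂).IsAddHaarMeasure]

/-- The integral of a left `H`-invariant function against a normalized weight does not depend on
the weight. -/
theorem lintegral_weight_eq {H : Subgroup SL(2, 𝕂)} {m : Measure SL(2, 𝕂)} [SFinite m]
    (hmH : ∀ᵐ h ∂m, h ∈ H)
    (hinv : ∀ f : SL(2, 𝕂) → ℝ≥0∞, Measurable f → ∫⁻ h, f h⁻¹ ∂m = ∫⁻ h, f h ∂m)
    (hright : ∀ f : SL(2, 𝕂) → ℝ≥0∞, Measurable f → ∀ d ∈ H, ∫⁻ h, f (h * d) ∂m = ∫⁻ h, f h ∂m)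
    {w b Φ : SL(2, 𝕂) → ℝ≥0∞} (hw : Measurable w) (hb : Measurable b) (hΦ : Measurable Φ)
    (hΦH : ∀ h ∈ H, ∀ g, Φ (h * g) = Φ g) (hb1 : ∀ g, ∫⁻ h, b (h * g) ∂m = 1)
    (hw0 : ∀ g, ∫⁻ h, w (h * g) ∂m ≠ 0) (hwt : ∀ g, ∫⁻ h, w (h * g) ∂m ≠ ⊤) :
    ∫⁻ g, Φ g * (w g / ∫⁻ h, w (h * g) ∂m) ∂haarG 𝕂 = ∫⁻ g, Φ g * b g ∂haarG 𝕂 := by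
  set N : SL(2, 𝕂) → ℝ≥0∞ := fun g => ∫⁻ h, w (h * g) ∂m with hN
  have hNm : Measurable N :=
    Measurable.lintegral_prod_right' (f := fun p : SL(2, 𝕂) × SL(2, 𝕂) => w (p.2 * p.1))
      (by fun_prop)
  have hNH : ∀ h ∈ H, ∀ g, N (h * g) = N g := fun h hh g => by
    simp only [hN, ← mul_assoc]
    exact hright (fun x => w (x * g)) (by fun_prop) h hh
  set q : SL(2, 𝕂) → ℝ≥0∞ := fun g => Φ g * (w g / N g) with hq
  have hqm : Measurable q := hΦ.mul (hw.div hNm)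
  have hqi : ∀ g, ∫⁻ h, q (h * g) ∂m = Φ g := fun g => by
    have h1 : ∀ᵐ h ∂m, q (h * g) = Φ g * (N g)⁻¹ * w (h * g) := by
      filter_upwards [hmH] with h hh
      simp only [hq, hΦH h hh, hNH h hh, div_eq_mul_inv]
      ring
    rw [lintegral_congr_ae h1, lintegral_const_mul _ (by fun_prop), mul_assoc,
      ENNReal.inv_mul_cancel (hw0 g) (hwt g), mul_one]
  -- Insert `∫ b (h g) dh = 1`, move the translation from `b` to `q` by left invariance, and invert
  -- `h`; integrating `q` over the coset then returns `Φ`.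
  calc ∫⁻ g, q g ∂haarG 𝕂 = ∫⁻ g, ∫⁻ h, q g * b (h * g) ∂m ∂haarG 𝕂 := by
        refine lintegral_congr fun g => ?_
        rw [lintegral_const_mul _ (by fun_prop), hb1, mul_one]
    _ = ∫⁻ h, ∫⁻ g, q g * b (h * g) ∂haarG 𝕂 ∂m :=
        lintegral_lintegral_swap (Measurable.aemeasurable (by fun_prop))
    _ = ∫⁻ h, ∫⁻ g, q (h⁻¹ * g) * b g ∂haarG 𝕂 ∂m := by
        refine lintegral_congr fun h => ?_
        rw [← lintegral_haarG_mul_left (f := fun g => q g * b (h * g)) (by fun_prop) h⁻¹]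
        simp
    _ = ∫⁻ g, ∫⁻ h, q (h⁻¹ * g) * b g ∂m ∂haarG 𝕂 :=
        lintegral_lintegral_swap (Measurable.aemeasurable (by fun_prop))
    _ = ∫⁻ g, Φ g * b g ∂haarG 𝕂 := by
        refine lintegral_congr fun g => ?_
        rw [lintegral_mul_const _ (by fun_prop),
          hinv (fun h => q (h * g)) (by fun_prop), hqi]

end Weight

/-! ### Orbital integrals as integrals over `G` with an arbitrary normalized weight. -/

section Orbital

variable [MeasureSpace 𝕂] [BorelSpace 𝕂] [(volume : Measure 𝕂).IsAddHaarMeasure]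

/-- This trades `cosetWeight` for a weight `b` suited to computation: `strip` for split `γ`, the
constant one for elliptic `γ`. -/
theorem orbitalIntegral_eq {γ p : SL(2, 𝕂)} {H : Subgroup SL(2, 𝕂)} {m : Measure SL(2, 𝕂)}
    [SFinite m] (hm : haarCentralizer γ = m.map fun h => p * h * p⁻¹)
    (hmH : ∀ᵐ h ∂m, h ∈ H)
    (hinv : ∀ f : SL(2, 𝕂) → ℝ≥0∞, Measurable f → ∫⁻ h, f h⁻¹ ∂m = ∫⁻ h, f h ∂m)
    (hright : ∀ f : SL(2, 𝕂) → ℝ≥0∞, Measurable f → ∀ d ∈ H, ∫⁻ h, f (h * d) ∂m = ∫⁻ h, f h ∂m)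
    (hcomm : ∀ h ∈ H, h⁻¹ * (p⁻¹ * γ * p) * h = p⁻¹ * γ * p)
    {b : SL(2, 𝕂) → ℝ≥0∞} (hb : Measurable b) (hb1 : ∀ g, ∫⁻ h, b (h * g) ∂m = 1)
    (hw0 : ∀ g, ∫⁻ h, cosetWeight (p * (h * g)) ∂m ≠ 0)
    (hwt : ∀ g, ∫⁻ h, cosetWeight (p * (h * g)) ∂m ≠ ⊤)
    {f : SL(2, 𝕂) → ℂ} (hf : Measurable f) :
    orbitalIntegral γ f = ∫ g, f (g⁻¹ * (p⁻¹ * γ * p) * g) ∂(haarG 𝕂).withDensity b := by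
  have hw := measurable_cosetWeight (𝕂 := 𝕂)
  have hof : Measurable (orbitFunction γ f) := by
    refine measurable_from_quotient.2 ?_
    change Measurable fun g => f (g⁻¹ * γ * g)
    fun_prop
  have hN : ∀ g, ∫⁻ h, cosetWeight (h * g) ∂haarCentralizer γ =
      ∫⁻ h, cosetWeight (p * (h * (p⁻¹ * g))) ∂m := fun g => by
    rw [hm, lintegral_map (by fun_prop) (by fun_prop)]
    simp only [mul_assoc]
  have hNm : Measurable fun g => ∫⁻ h, cosetWeight (h * g) ∂haarCentralizer γ := by
    simp_rw [hN]
    exact Measurable.lintegral_prod_right'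
      (f := fun q : SL(2, 𝕂) × SL(2, 𝕂) => cosetWeight (p * (q.2 * (p⁻¹ * q.1)))) (by fun_prop)
  have hβ : Measurable fun g =>
      cosetWeight g / ∫⁻ h, cosetWeight (h * g) ∂haarCentralizer γ := hw.div hNm
  have hq : Measurable (Quotient.mk (QuotientGroup.rightRel (Subgroup.centralizer {γ}))) :=
    fun s hs => hs
  rw [orbitalIntegral, quotientMeasure, integral_map hq.aemeasurable
    hof.aestronglyMeasurable]
  change ∫ g, f (g⁻¹ * γ * g) ∂_ = _
  -- The two integrals are compared through push-forward measures on `G`, so no integrability of `f`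
  -- is needed.
  have hmeas : ((haarG 𝕂).withDensity fun g =>
      cosetWeight g / ∫⁻ h, cosetWeight (h * g) ∂haarCentralizer γ).map (fun g => g⁻¹ * γ * g) =
      ((haarG 𝕂).withDensity b).map (fun g => g⁻¹ * (p⁻¹ * γ * p) * g) := by
    refine Measure.ext_of_lintegral _ fun Φ hΦ => ?_
    rw [lintegral_map hΦ (by fun_prop), lintegral_map hΦ (by fun_prop),
      lintegral_withDensity_eq_lintegral_mul _ hβ (by fun_prop),
      lintegral_withDensity_eq_lintegral_mul _ hb (by fun_prop)]
    simp only [Pi.mul_apply, mul_comm (b _), mul_comm (cosetWeight _ / _)]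
    rw [← lintegral_weight_eq hmH hinv hright (w := fun g => cosetWeight (p * g)) (by fun_prop) hb
      (Φ := fun g => Φ (g⁻¹ * (p⁻¹ * γ * p) * g)) (by fun_prop) ?_ hb1 hw0 hwt]
    · rw [← lintegral_haarG_mul_left _ p]
      · refine lintegral_congr fun g => ?_
        rw [hN, inv_mul_cancel_left]
        simp only [mul_inv_rev, mul_assoc]
      · exact Measurable.mul (by fun_prop) hβ
    · intro h hh g
      congr 1
      calc (h * g)⁻¹ * (p⁻¹ * γ * p) * (h * g) = g⁻¹ * (h⁻¹ * (p⁻¹ * γ * p) * h) * g := by group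
        _ = _ := by rw [hcomm h hh]
  have h1 := integral_map (μ := (haarG 𝕂).withDensity fun g =>
      cosetWeight g / ∫⁻ h, cosetWeight (h * g) ∂haarCentralizer γ)
      (φ := fun g => g⁻¹ * γ * g) (Measurable.aemeasurable (by fun_prop))
      (f := f) hf.aestronglyMeasurable
  have h2 := integral_map (μ := (haarG 𝕂).withDensity b)
      (φ := fun g => g⁻¹ * (p⁻¹ * γ * p) * g) (Measurable.aemeasurable (by fun_prop))
      (f := f) hf.aestronglyMeasurable
  rw [← h1, hmeas, h2]

end Orbital

/-! ### Conjugating regular semisimple elements into `D` or `K`. -/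

section Classification

theorem weylDisc_eq (γ : SL(2, 𝕂)) : weylDisc γ = (γ 0 0 + γ 1 1) ^ 2 - 4 := by
  rw [weylDisc, Matrix.trace_fin_two]

theorem weylDisc_conj (γ p : SL(2, 𝕂)) : weylDisc (p⁻¹ * γ * p) = weylDisc γ := by
  have h : ((p⁻¹ * γ * p : SL(2, 𝕂)) : Matrix (Fin 2) (Fin 2) 𝕂).trace =
      (γ : Matrix (Fin 2) (Fin 2) 𝕂).trace := by
    rw [Matrix.SpecialLinearGroup.coe_mul, Matrix.trace_mul_comm,
      ← Matrix.SpecialLinearGroup.coe_mul, ← mul_assoc, mul_inv_cancel, one_mul]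
  rw [weylDisc, weylDisc, h]

/-- For `γ 1 0 ≠ 0` the columns of `p` are eigenvectors for the eigenvalues `(tr γ ± δ)/2`, scaled
to give determinant one. For upper triangular `γ` a unipotent conjugation suffices. -/
theorem exists_conj_mem_diagSubgroup {γ : SL(2, 𝕂)} {δ : 𝕂} (hδ : δ ≠ 0)
    (h : δ ^ 2 = weylDisc γ) : ∃ p : SL(2, 𝕂), p⁻¹ * γ * p ∈ diagSubgroup 𝕂 := by
  have hd := det_entries γ
  rw [weylDisc_eq] at h
  by_cases hc : γ 1 0 = 0
  · rw [hc, mul_zero, sub_zero] at hd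
    have hne : γ 1 1 - γ 0 0 ≠ 0 := by
      intro h0
      refine hδ (pow_eq_zero_iff two_ne_zero |>.1 ?_)
      rw [h]
      linear_combination (γ 1 1 - γ 0 0) * h0 + 4 * hd
    refine ⟨nMat (γ 0 1 / (γ 1 1 - γ 0 0)), ?_, ?_⟩
    · rw [← nMat_neg]
      simp only [mul_entry, nMat_zero_zero, nMat_zero_one, nMat_one_one, hc]
      field_simp
      ring
    · rw [← nMat_neg]
      simp [mul_entry, hc]
  · set a := γ 0 0
    set b := γ 0 1
    set c := γ 1 0 with hcdef
    set d := γ 1 1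
    set x : 𝕂 := (a - d + δ) / 2 with hx
    set y : 𝕂 := (a - d - δ) / 2 with hy
    have hdet : (!![x / (c * δ), y; 1 / δ, c] : Matrix (Fin 2) (Fin 2) 𝕂).det = 1 := by
      rw [Matrix.det_fin_two_of, hx, hy]
      field_simp
      ring
    have hx2 : x ^ 2 - (a - d) * x - b * c = 0 := by
      rw [hx]; linear_combination h / 4 + hd
    have hy2 : y ^ 2 - (a - d) * y - b * c = 0 := by
      rw [hy]; linear_combination h / 4 + hd
    set p : SL(2, 𝕂) := ⟨!![x / (c * δ), y; 1 / δ, c], hdet⟩ with hp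
    have p00 : p 0 0 = x / (c * δ) := rfl
    have p01 : p 0 1 = y := rfl
    have p10 : p 1 0 = 1 / δ := rfl
    have p11 : p 1 1 = c := rfl
    clear_value p
    refine ⟨p, ?_, ?_⟩
    · simp only [mul_entry, inv_zero_zero, inv_zero_one, p01, p11]
      linear_combination -c * hy2
    · simp only [mul_entry, inv_one_zero, inv_one_one, p00, p10]
      field_simp
      linear_combination c * hx2

/-- `γ` fixes the point `m + i e^t` of the upper half-plane, with `m = (a - d)/(2c)` and `e^t = √(4
- (a + d)²)/(2|c|)`. Conjugation by `n(m) a(t)` moves this point to `i`, whose stabilizer is `K`. -/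
theorem exists_conj_mem_maxCompact {γ : SL(2, ℝ)} (h : weylDisc γ < 0) :
    ∃ p : SL(2, ℝ), p⁻¹ * γ * p ∈ maxCompact ℝ := by
  have hd := det_entries γ
  rw [weylDisc_eq] at h
  have hc : γ 1 0 ≠ 0 := by
    intro hc
    rw [hc, mul_zero, sub_zero] at hd
    nlinarith [sq_nonneg (γ 0 0 - γ 1 1)]
  set a := γ 0 0
  set b := γ 0 1
  set c := γ 1 0
  set d := γ 1 1
  set s := Real.sqrt (4 - (a + d) ^ 2) / 2 with hs
  have hs2 : 4 * s ^ 2 = 4 - (a + d) ^ 2 := by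
    rw [hs, div_pow, Real.sq_sqrt (by linarith)]; ring
  have hs0 : 0 < s := by
    have : 0 < 4 - (a + d) ^ 2 := by linarith
    positivity
  set t := Real.log (s / |c|) with ht
  set r := Real.exp (t / 2) with hr
  have hr0 : 0 < r := Real.exp_pos _
  have hr2 : r * r = s / |c| := by
    rw [hr, exp_half_mul_self, ht, Real.exp_log (by positivity)]
  have hri : Real.exp (-t / 2) = r⁻¹ := by rw [hr, ← Real.exp_neg]; ring_nf
  have hcc : |c| * |c| = c * c := abs_mul_abs_self c
  have hca : 0 < |c| := abs_pos.2 hc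
  have hrc : r ^ 2 * |c| = s := by rw [sq, hr2]; field_simp
  have hrc2 : r ^ 4 * c ^ 2 = s ^ 2 := by
    rw [← hrc]; linear_combination -r ^ 4 * hcc
  set m := (a - d) / (2 * c) with hm
  have hmc : 2 * c * m = a - d := by rw [hm]; field_simp
  refine ⟨nMat m * aMat t, ?_⟩
  rw [mem_maxCompact_iff]
  simp only [mul_entry, inv_zero_zero, inv_zero_one, inv_one_zero, inv_one_one, nMat_zero_zero,
    nMat_zero_one, nMat_one_zero, nMat_one_one, aMat_zero_zero, aMat_zero_one, aMat_one_zero,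
    aMat_one_one, hri, ← hr, conj_trivial, RCLike.ofReal_real_eq_id, id_eq]
  constructor
  · field_simp
    linear_combination r * hmc
  · have key : r ^ 4 * c + (b - c * m ^ 2 + (a - d) * m) = 0 := by
      apply mul_left_cancel₀ hc
      linear_combination hrc2 + hs2 / 4 - hd + (-c * m / 2 + (a - d) / 4) * hmc
    field_simp
    linear_combination key

end Classification

/-! ### Orbital integrals of split elements. -/

section Split

variable [MeasureSpace 𝕂] [BorelSpace 𝕂] [(volume : Measure 𝕂).IsAddHaarMeasure]

/-- The factor `a(t)` commutes with `δ` and drops out of the conjugate, and the strip has length one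
in `t`. -/
theorem map_withDensity_strip {δ : SL(2, 𝕂)} (hδ : δ ∈ diagSubgroup 𝕂) :
    ((haarG 𝕂).withDensity strip).map (fun g => g⁻¹ * δ * g) =
      ((volume : Measure 𝕂).prod (haarProb (maxCompact 𝕂))).map
        fun q => (nMat q.1 * q.2)⁻¹ * δ * (nMat q.1 * q.2) := by
  have hst := measurable_strip (𝕂 := 𝕂)
  have hc : Continuous fun q : 𝕂 × SL(2, 𝕂) => (nMat q.1 * q.2)⁻¹ * δ * (nMat q.1 * q.2) := by
    fun_prop
  refine Measure.ext_of_lintegral _ fun Φ hΦ => ?_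
  rw [lintegral_map hΦ (by fun_prop), lintegral_map hΦ hc.measurable,
    lintegral_withDensity_eq_lintegral_mul _ hst (by fun_prop)]
  simp only [Pi.mul_apply]
  rw [lintegral_haarG (f := fun g => strip g * Φ (g⁻¹ * δ * g)) (by fun_prop),
    lintegral_prod (fun q : 𝕂 × SL(2, 𝕂) => Φ ((nMat q.1 * q.2)⁻¹ * δ * (nMat q.1 * q.2)))
      (hΦ.comp hc.measurable).aemeasurable]
  set c : ℝ≥0∞ := ∫⁻ z : 𝕂, ∫⁻ k, Φ ((nMat z * k)⁻¹ * δ * (nMat z * k))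
    ∂haarProb (maxCompact 𝕂) with hcdef
  have h : ∀ t : ℝ, ∫⁻ z : 𝕂, ∫⁻ k, strip (aMat t * nMat z * k) *
      Φ ((aMat t * nMat z * k)⁻¹ * δ * (aMat t * nMat z * k)) ∂haarProb (maxCompact 𝕂) =
      (Set.Ico (0 : ℝ) 1).indicator 1 t * c := fun t => by
    have h1 : ∀ z : 𝕂, ∫⁻ k, strip (aMat t * nMat z * k) *
        Φ ((aMat t * nMat z * k)⁻¹ * δ * (aMat t * nMat z * k)) ∂haarProb (maxCompact 𝕂) =
        (Set.Ico (0 : ℝ) 1).indicator 1 t * ∫⁻ k, Φ ((nMat z * k)⁻¹ * δ * (nMat z * k))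
          ∂haarProb (maxCompact 𝕂) := fun z => by
      rw [← lintegral_const_mul _ (by fun_prop)]
      refine lintegral_haarProb_congr (by fun_prop) (by fun_prop) fun k hk => ?_
      have h2 : (aMat t * nMat z * k)⁻¹ * δ * (aMat t * nMat z * k) =
          (nMat z * k)⁻¹ * δ * (nMat z * k) := by
        calc _ = (nMat z * k)⁻¹ * ((aMat t)⁻¹ * (δ * aMat t)) * (nMat z * k) := by group
          _ = _ := by
            rw [diagSubgroup_mul_comm hδ (aMat_mem_diagSubgroup t), inv_mul_cancel_left]
      rw [h2, strip, iwasawaT, iwasawaY_aMat_mul_nMat_mul t z hk, Real.log_exp]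
    simp_rw [h1]
    rw [lintegral_const_mul']
    exact ((Set.indicator_le_self' (fun _ _ => zero_le_one) t).trans_lt ENNReal.one_lt_top).ne
  simp_rw [h]
  rw [lintegral_mul_const _ (measurable_one.indicator measurableSet_Ico),
    lintegral_indicator_one measurableSet_Ico]
  simp [hcdef]

/-- Conjugating `δ` by `n(z)` multiplies it by `n((1 - δ₀₀⁻²) z)`, so the integral differs from the
unipotent one by the Jacobian of a scaling. -/
theorem integral_conj_nMat {f : SL(2, 𝕂) → ℂ} (hs : IsSpherical f) {δ : SL(2, 𝕂)}
    (hδ : δ ∈ diagSubgroup 𝕂) (hne : 1 - (δ 0 0 ^ 2)⁻¹ ≠ 0) :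
    ∫ z : 𝕂, f ((nMat z)⁻¹ * δ * nMat z) =
      (modulus (1 - (δ 0 0 ^ 2)⁻¹))⁻¹ • unipotentIntegral f (2 * Real.log ‖δ 0 0‖) := by
  obtain ⟨τ, hτ, h⟩ := exists_compactTorus_eq_aMat_mul hδ
  set t := 2 * Real.log ‖δ 0 0‖
  rw [unipotentIntegral, ← integral_comp_mul_left_modulus hne]
  refine integral_congr_ae (Filter.Eventually.of_forall fun z => ?_)
  have h1 : (nMat z)⁻¹ * δ * nMat z = τ * (aMat t * nMat ((1 - (δ 0 0 ^ 2)⁻¹) * z)) := by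
    rw [← mul_assoc, diagSubgroup_mul_comm hτ.1 (aMat_mem_diagSubgroup t), ← h, sub_mul, one_mul,
      sub_eq_neg_add, nMat_add, ← mul_assoc, diag_mul_nMat hδ, mul_neg,
      mul_inv_cancel_left₀ (pow_ne_zero 2 (diag_ne_zero hδ)), nMat_neg]
  simp only [h1, hs.left hτ.2]

/-- For diagonal `δ` the discriminant is the square of `δ₀₀ (1 - δ₀₀⁻²)`. Its second factor cancels
the Jacobian, and the modulus of `δ₀₀` is the weight `e^{ρt/2}` at `t = 2 log ‖δ₀₀‖`. -/
theorem exists_orbitalIntegral_eq_abelTransform {γ : SL(2, 𝕂)} (hγ : IsRegularSemisimple γ)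
    (h : ∃ p : SL(2, 𝕂), p⁻¹ * γ * p ∈ diagSubgroup 𝕂) {f : SL(2, 𝕂) → ℂ} (hf : Continuous f)
    (hs : IsSpherical f) : ∃ t : ℝ, modulus (weylDisc γ) ^ (1 / 2 : ℝ) * ‖orbitalIntegral γ f‖ =
      ‖abelTransform f t‖ := by
  have hw := measurable_cosetWeight (𝕂 := 𝕂)
  set p := h.choose with hp
  have hδ : p⁻¹ * γ * p ∈ diagSubgroup 𝕂 := h.choose_spec
  have hm : haarCentralizer γ = (haarD 𝕂).map fun d => p * d * p⁻¹ := by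
    rw [haarCentralizer, dif_pos h]
  have hO := orbitalIntegral_eq hm ae_mem_diagSubgroup
    (fun f hf => lintegral_haarD_inv hf) (fun f hf d hd => lintegral_haarD_mul_right hf hd)
    (fun d hd => by rw [mul_assoc, diagSubgroup_mul_comm hδ hd, inv_mul_cancel_left])
    measurable_strip lintegral_haarD_strip
    (lintegral_cosetWeight_ne_zero haarD_ne_zero p) (lintegral_haarD_cosetWeight_ne_top p)
    hf.measurable
  have hreg : weylDisc (p⁻¹ * γ * p) ≠ 0 := by rw [weylDisc_conj]; exact hγ
  rw [← weylDisc_conj γ p]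
  set δ := p⁻¹ * γ * p with hδdef
  have hd := diag_mul_eq_one hδ
  have hne := diag_ne_zero hδ
  have hdisc : weylDisc δ = (δ 0 0 * (1 - (δ 0 0 ^ 2)⁻¹)) ^ 2 := by
    rw [weylDisc_eq, eq_inv_of_mul_eq_one_right hd]
    field_simp
    ring
  have hne' : 1 - (δ 0 0 ^ 2)⁻¹ ≠ 0 := by
    intro h0
    rw [hdisc, h0] at hreg
    simp at hreg
  have h1 := integral_map (μ := (haarG 𝕂).withDensity strip)
      (φ := fun g => g⁻¹ * δ * g) (Measurable.aemeasurable (by fun_prop))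
      (f := f) hf.measurable.aestronglyMeasurable
  have hcont : Continuous fun q : 𝕂 × SL(2, 𝕂) =>
      (nMat q.1 * q.2)⁻¹ * δ * (nMat q.1 * q.2) := by fun_prop
  have h2 := integral_map (μ := (volume : Measure 𝕂).prod (haarProb (maxCompact 𝕂)))
      (φ := fun q => (nMat q.1 * q.2)⁻¹ * δ * (nMat q.1 * q.2))
      hcont.measurable.aemeasurable (f := f) hf.measurable.aestronglyMeasurable
  have h3 : ∫ q, f ((nMat q.1 * q.2)⁻¹ * δ * (nMat q.1 * q.2))
      ∂((volume : Measure 𝕂).prod (haarProb (maxCompact 𝕂))) =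
      ∫ z : 𝕂, f ((nMat z)⁻¹ * δ * nMat z) := by
    have hmp : MeasurePreserving Prod.fst ((volume : Measure 𝕂).prod (haarProb (maxCompact 𝕂)))
      volume := measurePreserving_fst
    have hcont' : Continuous fun z : 𝕂 => f ((nMat z)⁻¹ * δ * nMat z) := by fun_prop
    have h4 := integral_map (μ := (volume : Measure 𝕂).prod (haarProb (maxCompact 𝕂)))
      hmp.measurable.aemeasurable hcont'.measurable.aestronglyMeasurable
    rw [hmp.map_eq] at h4
    rw [h4]
    refine integral_congr_ae ?_
    filter_upwards [Measure.quasiMeasurePreserving_snd.ae (ae_mem_maxCompact (𝕂 := 𝕂))] with q hq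
    rw [show (nMat q.1 * q.2)⁻¹ * δ * (nMat q.1 * q.2) =
      q.2⁻¹ * ((nMat q.1)⁻¹ * δ * nMat q.1) * q.2 by group, hs _ (inv_mem hq) _ hq]
  have hpos := modulus_pos (mul_ne_zero hne hne')
  refine ⟨2 * Real.log ‖δ 0 0‖, ?_⟩
  rw [hO, ← h1, map_withDensity_strip hδ, h2, h3, integral_conj_nMat hs hδ hne', abelTransform,
    norm_smul, norm_mul, hdisc, sq, modulus_mul, Real.mul_rpow hpos.le hpos.le,
    ← Real.rpow_add hpos, add_halves,
    Real.rpow_one, modulus_mul, Real.norm_eq_abs, abs_of_pos (inv_pos.2 (modulus_pos hne'))]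
  have h5 : Real.exp (degree 𝕂 * (2 * Real.log ‖δ 0 0‖) / 2) = modulus (δ 0 0) := by
    rw [show degree 𝕂 * (2 * Real.log ‖δ 0 0‖) / 2 = degree 𝕂 * Real.log ‖δ 0 0‖ by ring,
      Real.exp_nat_mul, Real.exp_log (norm_pos_iff.2 hne), modulus]
  rw [h5, Complex.norm_real, Real.norm_eq_abs, abs_of_pos (modulus_pos hne)]
  rw [mul_assoc, mul_inv_cancel_left₀ (modulus_pos hne').ne']

end Split

end Field

/-! ### Orbital integrals of elliptic elements of `SL₂(ℝ)`. -/

section Elliptic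

theorem degree_real : degree ℝ = 1 := Module.finrank_self ℝ

theorem maxCompact_real_mul_comm {k l : SL(2, ℝ)} (hk : k ∈ maxCompact ℝ) (hl : l ∈ maxCompact ℝ) :
    k * l = l * k := by
  obtain ⟨h1, h2⟩ := mem_maxCompact_iff.1 hk
  obtain ⟨h3, h4⟩ := mem_maxCompact_iff.1 hl
  simp only [conj_trivial] at h1 h2 h3 h4
  apply ext_entries <;> simp only [mul_entry, h1, h2, h3, h4] <;> ring

/-- The centralizer is compact of total mass one, so the constant weight is already normalized. -/
theorem orbitalIntegral_of_elliptic {γ : SL(2, ℝ)}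
    (h : ¬∃ p : SL(2, ℝ), p⁻¹ * γ * p ∈ diagSubgroup ℝ)
    (h' : ∃ p : SL(2, ℝ), p⁻¹ * γ * p ∈ maxCompact ℝ) {f : SL(2, ℝ) → ℂ} (hf : Continuous f) :
    ∃ p : SL(2, ℝ), p⁻¹ * γ * p ∈ maxCompact ℝ ∧
      orbitalIntegral γ f = ∫ g, f (g⁻¹ * (p⁻¹ * γ * p) * g) ∂haarG ℝ := by
  have hκ : h'.choose⁻¹ * γ * h'.choose ∈ maxCompact ℝ := h'.choose_spec
  have hm : haarCentralizer γ = (haarProb (maxCompact ℝ)).map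
      fun k => h'.choose * k * h'.choose⁻¹ := by
    rw [haarCentralizer, dif_neg h, dif_pos h']
  refine ⟨h'.choose, hκ, ?_⟩
  have hO := orbitalIntegral_eq hm ae_mem_maxCompact
    (fun f hf => lintegral_haarProb_inv hf) (fun f hf d hd => lintegral_haarProb_mul_right hf hd)
    (fun d hd => by rw [mul_assoc, maxCompact_real_mul_comm hκ hd, inv_mul_cancel_left])
    (b := 1) measurable_one (fun g => by simp)
    (lintegral_cosetWeight_ne_zero (IsProbabilityMeasure.ne_zero _) _)
    (fun g => ((lintegral_mono fun k => cosetWeight_le_one _).trans_lt (by simp)).ne)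
    hf.measurable
  rw [hO, withDensity_one]

/-- After the shift of `t` by `log (1 + z²)/2`, the height for fixed `τ` has the same form in `z` as
that of `a(T) n(αz)`. The `z`-integral thus becomes a unipotent integral. -/
theorem coshHeight_conj {κ : SL(2, ℝ)} (hκ : κ ∈ maxCompact ℝ) (τ z : ℝ) :
    coshHeight ((aMat (τ - Real.log (1 + z ^ 2) / 2) * nMat z)⁻¹ * κ *
      (aMat (τ - Real.log (1 + z ^ 2) / 2) * nMat z)) =
      1 + 2 * κ 0 1 ^ 2 * Real.sinh τ ^ 2 + 2 * κ 0 1 ^ 2 * (Real.cosh τ * z) ^ 2 := by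
  obtain ⟨h1, h2⟩ := mem_maxCompact_iff.1 hκ
  have h3 := norm_sq_add_of_mem_maxCompact hκ
  simp only [conj_trivial, Real.norm_eq_abs, sq_abs] at h1 h2 h3
  set t := τ - Real.log (1 + z ^ 2) / 2 with ht
  set r := Real.exp (t / 2) with hr
  have hr0 : 0 < r := Real.exp_pos _
  have hri : Real.exp (-t / 2) = r⁻¹ := by rw [hr, ← Real.exp_neg]; ring_nf
  set e := Real.exp τ with he
  have he0 : 0 < e := Real.exp_pos _
  have hz : 0 < 1 + z ^ 2 := by positivity
  have hr4 : r ^ 4 * (1 + z ^ 2) = e ^ 2 := by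
    have : r ^ 4 = Real.exp (2 * t) := by
      rw [hr, ← Real.exp_nat_mul]; congr 1; push_cast; ring
    rw [this, ht, show 2 * (τ - Real.log (1 + z ^ 2) / 2) = τ + τ - Real.log (1 + z ^ 2) by ring,
      Real.exp_sub, Real.exp_log hz, Real.exp_add]
    field_simp
    rw [he]
  set a := κ 0 0
  set b := κ 0 1
  set x : SL(2, ℝ) := aMat t * nMat z with hx
  have x00 : x 0 0 = r := by simp [hx, mul_entry, hr]
  have x01 : x 0 1 = r * z := by simp [hx, mul_entry, hr]
  have x10 : x 1 0 = 0 := by simp [hx, mul_entry]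
  have x11 : x 1 1 = r⁻¹ := by simp [hx, mul_entry, ← hri]
  have m00 : (x⁻¹ * κ * x) 0 0 = a + b * z * r ^ 2 := by
    simp only [mul_entry, inv_zero_zero, inv_zero_one, x00, x01, x10, x11, h1, h2]
    field_simp; ring
  have m01 : (x⁻¹ * κ * x) 0 1 = b * (z ^ 2 * r ^ 2 + (r ^ 2)⁻¹) := by
    simp only [mul_entry, inv_zero_zero, inv_zero_one, x01, x11, h1, h2]
    field_simp; ring
  have m10 : (x⁻¹ * κ * x) 1 0 = -(b * r ^ 2) := by
    simp only [mul_entry, inv_one_zero, inv_one_one, x00, x10, h2]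
    ring
  have m11 : (x⁻¹ * κ * x) 1 1 = a - b * z * r ^ 2 := by
    simp only [mul_entry, inv_one_zero, inv_one_one, x00, x01, x10, x11, h1, h2]
    field_simp; ring
  rw [coshHeight_eq, m00, m01, m10, m11, Real.sinh_eq, Real.cosh_eq, Real.exp_neg, ← he]
  simp only [Real.norm_eq_abs, sq_abs]
  have hrq : r ^ 2 * (r ^ 2)⁻¹ = 1 := mul_inv_cancel₀ (by positivity)
  have heq : e * e⁻¹ = 1 := mul_inv_cancel₀ he0.ne'
  have hq : (r ^ 2)⁻¹ ^ 2 = (1 + z ^ 2) * e⁻¹ ^ 2 := by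
    rw [inv_pow, inv_pow, ← hr4]
    field_simp
  set q := (r ^ 2)⁻¹
  set w := e⁻¹
  linear_combination h3 + b ^ 2 / 2 * hq + b ^ 2 / 2 * (1 + z ^ 2) * hr4 +
    b ^ 2 * z ^ 2 * hrq + b ^ 2 * (1 - z ^ 2) * heq

/-- Orbital integrals of elliptic elements are averages of the Abel transform. -/
theorem norm_orbitalIntegral_elliptic_le {κ : SL(2, ℝ)} (hκ : κ ∈ maxCompact ℝ)
    (hκ0 : weylDisc κ ≠ 0) {f : SL(2, ℝ) → ℂ} (hf : Continuous f) (hs : IsSpherical f) {C : ℝ}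
    (hC : ∀ t, ‖abelTransform f t‖ ≤ C) :
    modulus (weylDisc κ) ^ (1 / 2 : ℝ) * ‖∫ g, f (g⁻¹ * κ * g) ∂haarG ℝ‖ ≤ 2 * Real.pi * C := by
  set b := κ 0 1 with hb
  obtain ⟨h1, h2⟩ := mem_maxCompact_iff.1 hκ
  have h3 := norm_sq_add_of_mem_maxCompact hκ
  simp only [conj_trivial, Real.norm_eq_abs, sq_abs] at h1 h2 h3
  have hdisc : weylDisc κ = -(2 * b) ^ 2 := by
    rw [weylDisc_eq, h1]; linear_combination 4 * h3
  have hb0 : b ≠ 0 := by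
    intro h0
    rw [hdisc, h0] at hκ0
    simp at hκ0
  have hbp : 0 < |b| := abs_pos.2 hb0
  have hmod : modulus (weylDisc κ) ^ (1 / 2 : ℝ) = 2 * |b| := by
    rw [modulus, degree_real, pow_one, hdisc, norm_neg, norm_pow, ← Real.sqrt_eq_rpow,
      Real.sqrt_sq (norm_nonneg _), norm_mul, Real.norm_eq_abs, Real.norm_eq_abs]
    norm_num
  have hC0 : 0 ≤ C := (norm_nonneg _).trans (hC 0)
  set Φ : ℝ × ℝ → ℂ := fun p => f ((aMat p.1 * nMat p.2)⁻¹ * κ * (aMat p.1 * nMat p.2)) with hΦ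
  have hΦc : Continuous Φ := by fun_prop
  have hstep1 : ∫ g, f (g⁻¹ * κ * g) ∂haarG ℝ =
      ∫ p, Φ p ∂(volume : Measure ℝ).prod (volume : Measure ℝ) := by
    rw [IsRightInvariant.integral_haarG (f := fun g => f (g⁻¹ * κ * g))
      (Continuous.measurable (by fun_prop))]
    intro k hk g
    simp only
    rw [show (g * k)⁻¹ * κ * (g * k) = k⁻¹ * (g⁻¹ * κ * g) * k by group, hs _ (inv_mem hk) _ hk]
  have hlog : Continuous fun z : ℝ => Real.log (1 + z ^ 2) / 2 :=
    (Continuous.log (by fun_prop) fun z => by positivity).div_const 2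
  have hshear : MeasurePreserving (fun q : ℝ × ℝ => (q.1, q.2 - Real.log (1 + q.1 ^ 2) / 2))
      ((volume : Measure ℝ).prod volume) ((volume : Measure ℝ).prod volume) := by
    refine MeasurePreserving.skew_product (MeasurePreserving.id _)
      (g := fun z τ : ℝ => τ - Real.log (1 + z ^ 2) / 2)
      (Continuous.measurable ?_) (Filter.Eventually.of_forall fun z => ?_)
    · exact continuous_snd.sub (hlog.comp continuous_fst)
    · exact (measurePreserving_sub_right volume _).map_eq
  -- `T` matches the part of the height that is constant in `z`, and `α` below matches the
  -- coefficient of `z²`: `e^T α² / 2 = 2 b² cosh² τ`.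
  set T : ℝ → ℝ := fun τ => Real.arcosh (1 + 2 * b ^ 2 * Real.sinh τ ^ 2) with hT
  have hTc : ∀ τ, Real.cosh (T τ) = 1 + 2 * b ^ 2 * Real.sinh τ ^ 2 := fun τ =>
    Real.cosh_arcosh (by have : 0 ≤ 2 * b ^ 2 * Real.sinh τ ^ 2 := by positivity
                         linarith)
  set α : ℝ → ℝ := fun τ => 2 * |b| * Real.cosh τ * Real.exp (-(T τ) / 2) with hα
  have hα0 : ∀ τ, 0 < α τ := fun τ => by
    have := Real.cosh_pos τ
    positivity
  have hΨ : ∀ q : ℝ × ℝ, Φ (q.2 - Real.log (1 + q.1 ^ 2) / 2, q.1) =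
      f (aMat (T q.2) * nMat (α q.2 * q.1)) := fun q => by
    refine hs.eq_of_coshHeight_eq ?_
    rw [coshHeight_conj hκ, coshHeight_aMat_mul_nMat, hTc, Real.norm_eq_abs, sq_abs]
    congr 1
    have he : Real.exp (T q.2) * Real.exp (-(T q.2) / 2) ^ 2 = 1 := by
      rw [sq, exp_half_mul_self, ← Real.exp_add]; simp
    simp only [hα, mul_pow, sq_abs]
    linear_combination (-2 * b ^ 2 * Real.cosh q.2 ^ 2 * q.1 ^ 2) * he
  have hstep2 : ∫ p, Φ p ∂(volume : Measure ℝ).prod (volume : Measure ℝ) =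
      ∫ q : ℝ × ℝ, f (aMat (T q.2) * nMat (α q.2 * q.1))
        ∂(volume : Measure ℝ).prod (volume : Measure ℝ) := by
    rw [← integral_prod_swap]
    have h4 := integral_map (μ := (volume : Measure ℝ).prod (volume : Measure ℝ))
      hshear.measurable.aemeasurable (f := fun q : ℝ × ℝ => Φ q.swap)
      (Continuous.aestronglyMeasurable (by fun_prop))
    rw [hshear.map_eq] at h4
    rw [h4]
    exact integral_congr_ae (Filter.Eventually.of_forall hΨ)
  rw [hstep1, hstep2, hmod]
  by_cases hint : Integrable (fun q : ℝ × ℝ => f (aMat (T q.2) * nMat (α q.2 * q.1)))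
      ((volume : Measure ℝ).prod (volume : Measure ℝ))
  · rw [integral_prod_symm _ hint]
    have hinner : ∀ τ : ℝ, ‖∫ z : ℝ, f (aMat (T τ) * nMat (α τ * z))‖ ≤
        C / |b| * (1 + τ ^ 2)⁻¹ := fun τ => by
      rw [integral_comp_mul_left_modulus (hα0 τ).ne' (fun z => f (aMat (T τ) * nMat z)), norm_smul,
        norm_inv, modulus, degree_real, pow_one, norm_norm, Real.norm_eq_abs, abs_of_pos (hα0 τ)]
      have h5 := hC (T τ)
      rw [abelTransform, norm_mul, degree_real, Nat.cast_one, one_mul, Complex.norm_real,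
        Real.norm_eq_abs, Real.abs_exp, unipotentIntegral] at h5
      have h6 : ‖∫ z : ℝ, f (aMat (T τ) * nMat z)‖ ≤ Real.exp (-(T τ) / 2) * C := by
        calc _ = Real.exp (-(T τ) / 2) * (Real.exp (T τ / 2) *
              ‖∫ z : ℝ, f (aMat (T τ) * nMat z)‖) := by
              rw [← mul_assoc, ← Real.exp_add]; ring_nf; simp
          _ ≤ _ := by gcongr
      -- The factors `e^{-T/2}` cancel against `α`, leaving `C / (2 |b| cosh τ)`. Dominating `1 / (2
      -- cosh τ)` by `1 / (1 + τ²)`, of integral `π`, produces the constant `2π`.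
      have h7 : (1 + τ ^ 2) / 2 ≤ Real.cosh τ := by
        have h8 : |τ| / 2 ≤ Real.sinh (|τ| / 2) := Real.self_le_sinh_iff.2 (by positivity)
        have h9 : Real.cosh τ = 1 + 2 * Real.sinh (|τ| / 2) ^ 2 := by
          rw [← Real.cosh_abs, show |τ| = 2 * (|τ| / 2) by ring, Real.cosh_two_mul, Real.cosh_sq]
          ring_nf
        have h10 : (|τ| / 2) ^ 2 ≤ Real.sinh (|τ| / 2) ^ 2 := by gcongr
        rw [div_pow, sq_abs] at h10
        linarith
      have h11 := Real.cosh_pos τ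
      calc (α τ)⁻¹ * ‖∫ z : ℝ, f (aMat (T τ) * nMat z)‖ ≤
            (α τ)⁻¹ * (Real.exp (-(T τ) / 2) * C) := by
            gcongr
        _ = C / |b| * (2 * Real.cosh τ)⁻¹ := by
            simp only [hα]
            field_simp
        _ ≤ C / |b| * (1 + τ ^ 2)⁻¹ := by
            gcongr
            linarith
    have hbd := norm_integral_le_of_norm_le (integrable_inv_one_add_sq.const_mul (C / |b|))
      (Filter.Eventually.of_forall hinner)
    rw [integral_const_mul, integral_univ_inv_one_add_sq] at hbd
    calc 2 * |b| * ‖∫ τ : ℝ, ∫ z : ℝ, f (aMat (T τ) * nMat (α τ * z))‖ ≤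
          2 * |b| * (C / |b| * Real.pi) := by gcongr
      _ = 2 * Real.pi * C := by field_simp
  -- If the integrand is not integrable, the Bochner integral is zero by convention and the bound is
  -- trivial.
  · rw [integral_undef hint]
    have := Real.pi_pos
    simp only [norm_zero, mul_zero]
    positivity

end Elliptic

/-! ### Inversion of the Abel transform on radial profiles. -/

section Profile

variable {η : ℝ → ℝ} {b : ℝ}

theorem degree_complex : degree ℂ = 2 := Complex.finrank_real_complex

theorem deriv_eq_zero_of_forall_gt (hb : ∀ y, b < y → η y = 0) {y : ℝ} (hy : b < y) :
    deriv η y = 0 := by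
  have h : η =ᶠ[nhds y] fun _ => 0 := by
    filter_upwards [lt_mem_nhds hy] with x hx using hb x hx
  rw [h.deriv_eq, deriv_const]

theorem hasCompactSupport_comp_add_norm_sq {E : Type*} [NormedAddCommGroup E] [ProperSpace E]
    (hb : ∀ y, b < y → η y = 0) (y : ℝ) :
    HasCompactSupport fun w : E => η (y + ‖w‖ ^ 2) := by
  refine HasCompactSupport.intro (isCompact_closedBall (0 : E) (|b| + |y| + 1)) fun w hw => hb _ ?_
  rw [mem_closedBall_zero_iff, not_le] at hw
  nlinarith [abs_nonneg b, abs_nonneg y, le_abs_self b, neg_abs_le y]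

theorem continuous_deriv_comp_add_norm_sq {E : Type*} [NormedAddCommGroup E]
    (hη : ContDiff ℝ ∞ η) (y : ℝ) : Continuous fun w : E => deriv η (y + ‖w‖ ^ 2) :=
  (hη.continuous_deriv (by simp)).comp (by fun_prop)

/-- In polar coordinates the integrand becomes `π` times the derivative of `r ↦ η (y + r²)`, which
vanishes at infinity. -/
theorem integral_deriv_comp_add_norm_sq (hη : ContDiff ℝ ∞ η) (hb : ∀ y, b < y → η y = 0) (y : ℝ) :
    ∫ w : ℂ, deriv η (y + ‖w‖ ^ 2) = -Real.pi * η y := by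
  have hder : ∀ r ∈ Set.Ici (0 : ℝ),
      HasDerivAt (fun r : ℝ => η (y + r ^ 2)) (deriv η (y + r ^ 2) * (2 * r)) r := by
    intro r _
    have h1 : HasDerivAt (fun r : ℝ => y + r ^ 2) (2 * r) r := by
      simpa using ((hasDerivAt_id r).pow 2).const_add y
    exact ((hη.differentiable (by simp)).differentiableAt.hasDerivAt).comp r h1
  have hcont : Continuous fun r : ℝ => deriv η (y + r ^ 2) :=
    (hη.continuous_deriv (by simp)).comp (by fun_prop)
  have hcs : HasCompactSupport fun r : ℝ => deriv η (y + r ^ 2) := by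
    simpa using hasCompactSupport_comp_add_norm_sq (E := ℝ)
      (fun y hy => deriv_eq_zero_of_forall_gt hb hy) y
  have hint : Integrable fun r : ℝ => deriv η (y + r ^ 2) * (2 * r) :=
    (hcont.mul (by fun_prop)).integrable_of_hasCompactSupport hcs.mul_right
  have hlim : Filter.Tendsto (fun r : ℝ => η (y + r ^ 2)) Filter.atTop (nhds 0) := by
    refine tendsto_const_nhds.congr' ?_
    filter_upwards [Filter.eventually_gt_atTop (|b| + |y| + 1)] with r hr
    refine (hb _ ?_).symm
    nlinarith [abs_nonneg b, abs_nonneg y, le_abs_self b, neg_abs_le y]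
  have key := integral_Ioi_of_hasDerivAt_of_tendsto' hder hint.integrableOn hlim
  rw [integral_fun_norm_addHaar (volume : Measure ℂ) fun r => deriv η (y + r ^ 2),
    Complex.finrank_real_complex, Measure.real, Complex.volume_ball]
  have h2 : ∫ r in Set.Ioi (0 : ℝ), r ^ (2 - 1) • deriv η (y + r ^ 2) = -η y / 2 := by
    have : ∀ r : ℝ, r ^ (2 - 1) • deriv η (y + r ^ 2)
        = (1 / 2) * (deriv η (y + r ^ 2) * (2 * r)) := by
      intro r; simp only [smul_eq_mul]; ring
    simp_rw [this]
    rw [integral_const_mul, key]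
    simp
    ring
  rw [h2]
  simp
  ring

theorem exists_profile_complex (hη : ContDiff ℝ ∞ η) (hb : ∀ y, b < y → η y = 0) :
    ∃ φ : ℝ → ℝ, ContDiff ℝ ∞ φ ∧ (∀ y, b < y → φ y = 0) ∧
      ∀ y, √2 ^ degree ℂ * ∫ w : ℂ, φ (y + ‖w‖ ^ 2) = η y := by
  refine ⟨fun y => -(2 * Real.pi)⁻¹ * deriv η y, ?_, ?_, ?_⟩
  · exact contDiff_const.mul (hη.iterate_deriv 1)
  · intro y hy
    simp [deriv_eq_zero_of_forall_gt hb hy]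
  · intro y
    rw [integral_const_mul, integral_deriv_comp_add_norm_sq hη hb, degree_complex,
      Real.sq_sqrt (by norm_num)]
    field_simp [Real.pi_ne_zero]

/-- The integral is the convolution at `0` of the constant one with `v ↦ ψ (y + v²)`. For `y > p -
1` these functions vanish outside a common compact set, so smooth dependence on the parameter
applies. -/
theorem contDiff_integral_comp_add_sq {ψ : ℝ → ℝ} (hψ : ContDiff ℝ ∞ ψ)
    (hb : ∀ y, b < y → ψ y = 0) : ContDiff ℝ ∞ fun y : ℝ => ∫ v : ℝ, ψ (y + v ^ 2) := by
  rw [contDiff_iff_contDiffAt]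
  intro p
  have h := contDiffOn_convolution_right_with_param_comp (𝕜 := ℝ) (G := ℝ) (E := ℝ) (E' := ℝ)
    (F := ℝ) (P := ℝ) (μ := volume) (n := ⊤) (ContinuousLinearMap.mul ℝ ℝ) (s := Set.Ioi (p - 1))
    (v := fun _ => 0) contDiffOn_const (f := fun _ => 1) (g := fun y v => ψ (y + v ^ 2))
    (k := Metric.closedBall 0 (|b| + |p| + 2)) isOpen_Ioi (isCompact_closedBall _ _) ?_
    (locallyIntegrable_const 1) ?_
  · refine (h.congr fun y _ => ?_).contDiffAt (Ioi_mem_nhds (by linarith))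
    simp [convolution_def]
  · intro y v hy hv
    rw [mem_closedBall_zero_iff, not_le, Real.norm_eq_abs] at hv
    refine hb _ ?_
    rw [← sq_abs v]
    have : p - 1 < y := hy
    nlinarith [abs_nonneg b, abs_nonneg p, le_abs_self b, neg_abs_le p]
  · exact (hψ.comp (f := fun q : ℝ × ℝ => q.1 + q.2 ^ 2) (by fun_prop)).contDiffOn

/-- Two successive integrations over `ℝ` amount to one over the plane, so integrating `η'` once in
advance reduces the equation to the complex case. -/
theorem exists_profile_real (hη : ContDiff ℝ ∞ η) (hb : ∀ y, b < y → η y = 0) :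
    ∃ φ : ℝ → ℝ, ContDiff ℝ ∞ φ ∧ (∀ y, b < y → φ y = 0) ∧
      ∀ y, √2 ^ degree ℝ * ∫ w : ℝ, φ (y + ‖w‖ ^ 2) = η y := by
  have hb' : ∀ y, b < y → deriv η y = 0 := fun y hy => deriv_eq_zero_of_forall_gt hb hy
  refine ⟨fun y => -(√2 * Real.pi)⁻¹ * ∫ v : ℝ, deriv η (y + v ^ 2), ?_, ?_, ?_⟩
  · exact contDiff_const.mul (contDiff_integral_comp_add_sq (hη.iterate_deriv 1) hb')
  · intro y hy
    have : ∀ v : ℝ, deriv η (y + v ^ 2) = 0 := fun v => hb' _ (by nlinarith [sq_nonneg v])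
    simp [this]
  · intro y
    have h1 : ∫ w : ℂ, deriv η (y + ‖w‖ ^ 2)
        = ∫ w : ℝ, ∫ v : ℝ, deriv η (y + ‖w‖ ^ 2 + v ^ 2) := by
      have hint : Integrable fun w : ℂ => deriv η (y + ‖w‖ ^ 2) :=
        (continuous_deriv_comp_add_norm_sq hη y).integrable_of_hasCompactSupport
          (hasCompactSupport_comp_add_norm_sq hb' y)
      have hmp := Complex.volume_preserving_equiv_real_prod.symm
      rw [← hmp.integral_comp' (g := fun w : ℂ => deriv η (y + ‖w‖ ^ 2))]
      have hint' := hmp.integrable_comp_emb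
        (Complex.measurableEquivRealProd.symm.measurableEmbedding) |>.2 hint
      rw [Measure.volume_eq_prod] at hint' ⊢
      refine (integral_prod _ hint').trans ?_
      refine integral_congr_ae (.of_forall fun w => integral_congr_ae (.of_forall fun v => ?_))
      simp only [Function.comp]
      congr 1
      rw [← Complex.normSq_eq_norm_sq, Complex.normSq_apply]
      simp [Complex.measurableEquivRealProd]
      ring
    rw [integral_const_mul, ← h1, integral_deriv_comp_add_norm_sq hη hb, degree_real, pow_one]
    field_simp [Real.pi_ne_zero]

end Profile

/-! ### The bump on the `t`-axis, its self-convolution and its Laplace transform. -/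

section BumpProfile

/-- A smooth bump function supported in `[1, 13/10]` that equals `1` on `[11/10, 6/5]`. -/
def profileBump : ContDiffBump (23 / 20 : ℝ) := ⟨1 / 20, 3 / 20, by norm_num, by norm_num⟩

theorem profileBump_eq_one {x : ℝ} (h₁ : 11 / 10 ≤ x) (h₂ : x ≤ 6 / 5) : profileBump x = 1 := by
  refine profileBump.one_of_mem_closedBall ?_
  rw [Metric.mem_closedBall, Real.dist_eq, abs_le]
  simp only [profileBump]
  constructor <;> linarith

theorem mem_Ioo_of_profileBump_ne_zero {x : ℝ} (h : profileBump x ≠ 0) :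
    x ∈ Set.Ioo (1 : ℝ) (13 / 10) := by
  by_contra hx
  refine h (profileBump.zero_of_le_dist ?_)
  simp only [profileBump, Real.dist_eq]
  by_contra! h'
  rw [abs_lt] at h'
  exact hx ⟨by linarith, by linarith⟩

/-- The function `t ↦ η(e^{-R} cosh t)`, where `η` is the bump function `profileBump`. -/
def coshBump (R t : ℝ) : ℝ := profileBump (Real.exp (-R) * Real.cosh t)

theorem coshBump_nonneg (R t : ℝ) : 0 ≤ coshBump R t := profileBump.nonneg

theorem coshBump_le_one (R t : ℝ) : coshBump R t ≤ 1 := profileBump.le_one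

theorem coshBump_neg (R t : ℝ) : coshBump R (-t) = coshBump R t := by simp [coshBump]

theorem continuous_coshBump (R : ℝ) : Continuous (coshBump R) :=
  profileBump.continuous.comp (by fun_prop)

theorem exp_neg_mul_le_iff {R x y : ℝ} : Real.exp (-R) * x ≤ y ↔ x ≤ y * Real.exp R := by
  rw [Real.exp_neg, inv_mul_le_iff₀ (Real.exp_pos R), mul_comm]

theorem le_exp_neg_mul_iff {R x y : ℝ} : y ≤ Real.exp (-R) * x ↔ y * Real.exp R ≤ x := by
  rw [Real.exp_neg, le_inv_mul_iff₀ (Real.exp_pos R), mul_comm]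

/-- This is where the endpoint `13/10` comes from: it lies below `e/2`, so the support stays within
height `R + 1`. -/
theorem mul_exp_le_cosh_add_one {R : ℝ} : 13 / 10 * Real.exp R ≤ Real.cosh (R + 1) := by
  rw [Real.cosh_eq, Real.exp_add]
  have := Real.exp_one_gt_d9
  nlinarith [Real.exp_pos R, Real.exp_pos (-(R + 1))]

theorem abs_mem_Icc_of_coshBump_ne_zero {R t : ℝ} (hR : 0 ≤ R) (h : coshBump R t ≠ 0) :
    |t| ∈ Set.Icc R (R + 1) := by
  obtain ⟨h1, h2⟩ := mem_Ioo_of_profileBump_ne_zero h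
  have h1' := le_exp_neg_mul_iff.1 h1.le
  have h2' := (exp_neg_mul_le_iff.1 h2.le).trans mul_exp_le_cosh_add_one
  constructor
  · rw [one_mul] at h1'
    refine Real.exp_le_exp.1 (h1'.trans ?_)
    rw [Real.cosh_eq]
    have := Real.exp_le_exp.2 (le_abs_self t)
    have := Real.exp_le_exp.2 (neg_le_abs t)
    linarith
  · rwa [Real.cosh_le_cosh, abs_of_nonneg (by linarith : (0 : ℝ) ≤ R + 1)] at h2'

theorem hasCompactSupport_coshBump {R : ℝ} (hR : 0 ≤ R) : HasCompactSupport (coshBump R) := by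
  refine HasCompactSupport.intro (isCompact_closedBall (0 : ℝ) (R + 1)) fun t ht => ?_
  by_contra h
  exact ht (by simpa using (abs_mem_Icc_of_coshBump_ne_zero hR h).2)

/-- The bump is at most one and lives on two intervals of length one, uniformly in `R`. -/
theorem norm_integral_coshBump_mul_le {R : ℝ} (hR : 0 ≤ R) (t : ℝ) :
    ‖∫ s, (coshBump R s : ℂ) * (coshBump R (t - s) : ℂ)‖ ≤ 2 := by
  have hi : ∀ a : ℝ, Integrable ((Set.Icc a (a + 1)).indicator fun _ => (1 : ℝ)) := fun a =>
    (integrable_indicator_iff measurableSet_Icc).2 (by simp)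
  have hv : ∀ a : ℝ, ∫ s, (Set.Icc a (a + 1)).indicator (fun _ => (1 : ℝ)) s = 1 := fun a => by
    rw [integral_indicator measurableSet_Icc]
    simp
  have := norm_integral_le_of_norm_le ((hi R).add (hi (-(R + 1))))
    (f := fun s => (coshBump R s : ℂ) * (coshBump R (t - s) : ℂ)) (.of_forall fun s => ?_)
  · simp only [Pi.add_apply] at this
    rw [integral_add (hi _) (hi _), hv, hv] at this
    linarith
  · have h0 : ∀ a : ℝ, 0 ≤ (Set.Icc a (a + 1)).indicator (fun _ => (1 : ℝ)) s := fun a =>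
      Set.indicator_nonneg (fun _ _ => zero_le_one) _
    by_cases h : coshBump R s = 0
    · simpa [h] using add_nonneg (h0 R) (h0 (-(R + 1)))
    · have hle : ‖(coshBump R s : ℂ) * (coshBump R (t - s) : ℂ)‖ ≤ 1 := by
        rw [norm_mul, Complex.norm_real, Complex.norm_real, Real.norm_of_nonneg (coshBump_nonneg _ _),
          Real.norm_of_nonneg (coshBump_nonneg _ _)]
        exact mul_le_one₀ (coshBump_le_one _ _) (coshBump_nonneg _ _) (coshBump_le_one _ _)
      obtain ⟨h1, h2⟩ := abs_mem_Icc_of_coshBump_ne_zero hR h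
      refine hle.trans ?_
      rw [Pi.add_apply]
      rcases le_total 0 s with hs | hs
      · rw [abs_of_nonneg hs] at h1 h2
        rw [Set.indicator_of_mem (show s ∈ Set.Icc R (R + 1) from ⟨h1, h2⟩)]
        linarith [h0 (-(R + 1))]
      · rw [abs_of_nonpos hs] at h1 h2
        rw [Set.indicator_of_mem (show s ∈ Set.Icc (-(R + 1)) (-(R + 1) + 1) from
          ⟨by linarith, by linarith⟩)]
        linarith [h0 R]

theorem cosh_add_le {t d : ℝ} (hd : 0 ≤ d) : Real.cosh (t + d) ≤ Real.cosh t * Real.exp d := by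
  rw [Real.cosh_add, ← Real.cosh_add_sinh d, mul_add]
  have := Real.sinh_nonneg_iff.2 hd
  have := (Real.sinh_lt_cosh t).le
  nlinarith

/-- The plateau runs between the points where `cosh` equals `(11/10) e^R` and `(6/5) e^R`. As `cosh`
grows at most exponentially, its length is at least the logarithm of the ratio `12/11`. -/
theorem exists_coshBump_eq_one {R : ℝ} (hR : 0 ≤ R) :
    ∃ t₁ t₂ : ℝ, R ≤ t₁ ∧ Real.log (12 / 11) ≤ t₂ - t₁ ∧
      ∀ t ∈ Set.Icc t₁ t₂, coshBump R t = 1 := by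
  have hE := Real.one_le_exp hR
  have hc1 := Real.cosh_arcosh (show 1 ≤ 11 / 10 * Real.exp R by linarith)
  have hc2 := Real.cosh_arcosh (show 1 ≤ 6 / 5 * Real.exp R by linarith)
  have hn1 := Real.arcosh_nonneg (show 1 ≤ 11 / 10 * Real.exp R by linarith)
  have hn2 := Real.arcosh_nonneg (show 1 ≤ 6 / 5 * Real.exp R by linarith)
  set t₁ := Real.arcosh (11 / 10 * Real.exp R)
  set t₂ := Real.arcosh (6 / 5 * Real.exp R)
  have h12 : t₁ ≤ t₂ := by
    rw [← abs_of_nonneg hn1, ← abs_of_nonneg hn2, ← Real.cosh_le_cosh, hc1, hc2]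
    linarith
  have hb : ∀ t ∈ Set.Icc t₁ t₂, coshBump R t = 1 := by
    intro t ht
    have h0 : 0 ≤ t := hn1.trans ht.1
    refine profileBump_eq_one (le_exp_neg_mul_iff.2 ?_) (exp_neg_mul_le_iff.2 ?_)
    · rw [← hc1, Real.cosh_le_cosh, abs_of_nonneg hn1, abs_of_nonneg h0]
      exact ht.1
    · rw [← hc2, Real.cosh_le_cosh, abs_of_nonneg hn2, abs_of_nonneg h0]
      exact ht.2
  refine ⟨t₁, t₂, ?_, ?_, hb⟩
  · have := (abs_mem_Icc_of_coshBump_ne_zero hR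
      (by rw [hb t₁ ⟨le_rfl, h12⟩]; exact one_ne_zero)).1
    rwa [abs_of_nonneg hn1] at this
  · rw [Real.log_le_iff_le_exp (by norm_num)]
    have := cosh_add_le (t := t₁) (sub_nonneg.2 h12)
    rw [add_sub_cancel, hc1, hc2] at this
    nlinarith [Real.exp_pos R]

theorem integrable_exp_mul_coshBump {R : ℝ} (hR : 0 ≤ R) (a : ℝ) :
    Integrable fun t => Real.exp (a * t) * coshBump R t :=
  ((show Continuous fun t => Real.exp (a * t) by fun_prop).mul
    (continuous_coshBump R)).integrable_of_hasCompactSupport (hasCompactSupport_coshBump hR).mul_left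

theorem le_integral_exp_mul_coshBump_of_nonneg {R : ℝ} (hR : 0 ≤ R) {a : ℝ} (ha : 0 ≤ a) :
    Real.log (12 / 11) * Real.exp (a * R) ≤ ∫ t, Real.exp (a * t) * coshBump R t := by
  obtain ⟨t₁, t₂, h1, h2, hb⟩ := exists_coshBump_eq_one hR
  have hlog : 0 ≤ Real.log (12 / 11) := Real.log_nonneg (by norm_num)
  have hi : Integrable ((Set.Icc t₁ t₂).indicator fun _ => Real.exp (a * R)) :=
    (integrable_indicator_iff measurableSet_Icc).2 (by simp)
  have hle := integral_mono hi (integrable_exp_mul_coshBump hR a) fun t => by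
    refine Set.indicator_le' (fun t ht => ?_)
      (fun t _ => mul_nonneg (Real.exp_pos _).le (coshBump_nonneg R t)) t
    rw [hb t ht, mul_one, Real.exp_le_exp]
    exact mul_le_mul_of_nonneg_left (h1.trans ht.1) ha
  refine le_trans ?_ hle
  rw [integral_indicator measurableSet_Icc, setIntegral_const, Measure.real, Real.volume_Icc,
    ENNReal.toReal_ofReal (by linarith), smul_eq_mul]
  exact mul_le_mul_of_nonneg_right h2 (Real.exp_pos _).le

theorem le_integral_exp_mul_coshBump {R : ℝ} (hR : 0 ≤ R) (a : ℝ) :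
    Real.log (12 / 11) * Real.exp (|a| * R) ≤ ∫ t, Real.exp (a * t) * coshBump R t := by
  rcases le_total 0 a with ha | ha
  · rw [abs_of_nonneg ha]
    exact le_integral_exp_mul_coshBump_of_nonneg hR ha
  · rw [abs_of_nonpos ha, ← integral_neg_eq_self]
    simpa only [coshBump_neg, mul_neg, neg_mul]
      using le_integral_exp_mul_coshBump_of_nonneg hR (neg_nonneg.2 ha)

/-- The exponential is a character of `ℝ`, so the Laplace transform of a self-convolution is a
square. -/
theorem integral_exp_mul_integral_coshBump {R : ℝ} (hR : 0 ≤ R) (a : ℝ) :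
    ∫ t : ℝ, ((Real.exp (a * t) : ℝ) : ℂ) *
        ∫ s, (coshBump R s : ℂ) * (coshBump R (t - s) : ℂ)
      = (((∫ t, Real.exp (a * t) * coshBump R t) ^ 2 : ℝ) : ℂ) := by
  have hi := integrable_exp_mul_coshBump hR a
  have key := integral_convolution (ContinuousLinearMap.mul ℝ ℝ) hi hi
  simp only [convolution_def, ContinuousLinearMap.mul_apply'] at key
  rw [sq, ← key, ← integral_complex_ofReal]
  refine integral_congr_ae (.of_forall fun t => ?_)
  simp only
  rw [← integral_complex_ofReal, ← integral_const_mul]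
  refine integral_congr_ae (.of_forall fun s => ?_)
  have : Real.exp (a * t) = Real.exp (a * s) * Real.exp (a * (t - s)) := by
    rw [← Real.exp_add]; ring_nf
  simp only [this]
  push_cast
  ring

end BumpProfile

/-! ### The test function and its estimates, uniformly in `R`. -/

section RadialTest

variable {𝕂 : Type} [RCLike 𝕂]

/-- The bi-`K`-invariant function with radial profile `x ↦ e^{-ρR/2} φ(e^{-R} x)` in
`x = cosh H(g)`. -/
def radialFun (φ : ℝ → ℝ) (R : ℝ) (g : SL(2, 𝕂)) : ℂ :=
  ((Real.exp (-(degree 𝕂 * R / 2)) * φ (Real.exp (-R) * coshHeight g) : ℝ) : ℂ)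

theorem isSpherical_radialFun (φ : ℝ → ℝ) (R : ℝ) : IsSpherical (radialFun (𝕂 := 𝕂) φ R) := by
  intro k₁ h₁ k₂ h₂ g
  rw [radialFun, radialFun, coshHeight_mul_right h₂, coshHeight_mul_left h₁]

theorem check_radialFun (φ : ℝ → ℝ) (R : ℝ) :
    check (radialFun (𝕂 := 𝕂) φ R) = radialFun φ R := by
  funext g
  rw [check, radialFun, coshHeight_inv, Complex.conj_ofReal, radialFun]

theorem isSmooth_radialFun {φ : ℝ → ℝ} (hφ : ContDiff ℝ ∞ φ) (R : ℝ) :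
    IsSmooth (radialFun (𝕂 := 𝕂) φ R) := by
  refine ⟨fun M => ((Real.exp (-(degree 𝕂 * R / 2)) *
    φ (Real.exp (-R) * ((∑ i, ∑ j, ‖M i j‖ ^ 2) / 2)) : ℝ) : ℂ), ?_, fun g => rfl⟩
  refine Complex.ofRealCLM.contDiff.comp (contDiff_const.mul (hφ.comp (contDiff_const.mul
    (ContDiff.div_const (ContDiff.sum fun i _ => ContDiff.sum fun j _ => ?_) _))))
  exact (contDiff_norm_sq ℝ).comp (contDiff_apply_apply ℝ 𝕂 i j)

theorem continuous_radialFun {φ : ℝ → ℝ} (hφ : ContDiff ℝ ∞ φ) (R : ℝ) :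
    Continuous (radialFun (𝕂 := 𝕂) φ R) := by
  have := hφ.continuous
  unfold radialFun
  exact Complex.continuous_ofReal.comp (continuous_const.mul
    (this.comp (continuous_const.mul continuous_coshHeight)))

theorem coshHeight_le_of_radialFun_ne_zero {φ : ℝ → ℝ} {b : ℝ} (hb : ∀ y, b < y → φ y = 0) {R : ℝ}
    {g : SL(2, 𝕂)} (hg : radialFun φ R g ≠ 0) : coshHeight g ≤ b * Real.exp R := by
  rw [← exp_neg_mul_le_iff]
  by_contra! h
  exact hg (by simp [radialFun, hb _ h])

theorem isCompact_heightBall {r : ℝ} (hr : 0 ≤ r) : IsCompact (heightBall 𝕂 r) := by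
  rw [heightBall_eq hr]
  exact isCompact_coshHeight_le _

theorem isTestFunction_radialFun {φ : ℝ → ℝ} (hφ : ContDiff ℝ ∞ φ) {b : ℝ}
    (hb : ∀ y, b < y → φ y = 0) (R : ℝ) : IsTestFunction (radialFun (𝕂 := 𝕂) φ R) :=
  ⟨isSmooth_radialFun hφ R,
    hasCompactSupport_of_coshHeight_bound fun _ => coshHeight_le_of_radialFun_ne_zero hb,
    isSpherical_radialFun φ R⟩

variable [MeasureSpace 𝕂] [BorelSpace 𝕂] [(volume : Measure 𝕂).IsAddHaarMeasure]

/-- Substitute `w = r z` with `r² = e^{t - R}/2`. The Jacobian cancels both the weight `e^{ρt/2}`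
and the normalization `e^{-ρR/2}` up to `√2^ρ`, so `R` survives only in the argument of `η`. -/
theorem abelTransform_radialFun {φ η : ℝ → ℝ}
    (h : ∀ y, √2 ^ degree 𝕂 * ∫ w : 𝕂, φ (y + ‖w‖ ^ 2) = η y) (R t : ℝ) :
    abelTransform (radialFun (𝕂 := 𝕂) φ R) t = (η (Real.exp (-R) * Real.cosh t) : ℂ) := by
  set r : ℝ := Real.exp ((t - R) / 2) / √2 with hr
  have hr0 : 0 < r := by positivity
  have hr2 : r ^ 2 = Real.exp (-R) * Real.exp t / 2 := by
    rw [hr, div_pow, Real.sq_sqrt zero_le_two, sq, exp_half_mul_self, ← Real.exp_add]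
    ring_nf
  have hmod : modulus (r : 𝕂) = r ^ degree 𝕂 := by
    rw [modulus, RCLike.norm_ofReal, abs_of_pos hr0]
  have h1 : ∀ z : 𝕂, radialFun φ R (aMat t * nMat z)
      = ((Real.exp (-(degree 𝕂 * R / 2)) : ℝ) : ℂ) *
        ((φ (Real.exp (-R) * Real.cosh t + ‖(r : 𝕂) * z‖ ^ 2) : ℝ) : ℂ) := by
    intro z
    rw [radialFun, coshHeight_aMat_mul_nMat, norm_mul, RCLike.norm_ofReal, abs_of_pos hr0, mul_pow,
      hr2, Complex.ofReal_mul]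
    congr 4
    ring
  rw [abelTransform, unipotentIntegral]
  simp_rw [h1]
  rw [integral_const_mul, integral_comp_mul_left_modulus (RCLike.ofReal_ne_zero.2 hr0.ne')
    (fun w : 𝕂 => ((φ (Real.exp (-R) * Real.cosh t + ‖w‖ ^ 2) : ℝ) : ℂ)), hmod, integral_complex_ofReal,
    ← h, Complex.real_smul]
  norm_cast
  have h2 : Real.exp (degree 𝕂 * t / 2) * Real.exp (-(degree 𝕂 * R / 2))
      = r ^ degree 𝕂 * √2 ^ degree 𝕂 := by
    rw [← mul_pow, hr, div_mul_cancel₀ _ (by positivity), ← Real.exp_nat_mul, ← Real.exp_add]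
    ring_nf
  rw [← mul_assoc, ← mul_assoc, h2]
  field_simp

variable {φ : ℝ → ℝ} {R : ℝ}

theorem abelTransform_conv_radialFun (hφ : ContDiff ℝ ∞ φ) (hb : ∀ y, 13 / 10 < y → φ y = 0)
    (h : ∀ y, √2 ^ degree 𝕂 * ∫ w : 𝕂, φ (y + ‖w‖ ^ 2) = profileBump y) (t : ℝ) :
    abelTransform (conv (radialFun (𝕂 := 𝕂) φ R) (radialFun φ R)) t
      = ∫ s, (coshBump R s : ℂ) * (coshBump R (t - s) : ℂ) := by
  have hc := continuous_radialFun (𝕂 := 𝕂) hφ R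
  have ht := isTestFunction_radialFun (𝕂 := 𝕂) hφ hb R
  rw [abelTransform_conv hc ht.2 ht.3 hc ht.2 ht.3]
  simp only [abelTransform_radialFun h, coshBump]

theorem tsupport_conv_radialFun_subset (hb : ∀ y, 13 / 10 < y → φ y = 0) (hR : 0 ≤ R) :
    tsupport (conv (radialFun (𝕂 := 𝕂) φ R) (check (radialFun φ R)))
      ⊆ heightBall 𝕂 (2 * R + 2) := by
  have := tsupport_conv_check_subset (u := radialFun (𝕂 := 𝕂) φ R) (r := R + 1) fun g hg =>
    (height_le_iff (by linarith)).2
      ((coshHeight_le_of_radialFun_ne_zero hb hg).trans mul_exp_le_cosh_add_one)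
  rwa [mul_add, mul_one] at this

theorem sphericalTransform_conv_radialFun (hφ : ContDiff ℝ ∞ φ)
    (hb : ∀ y, 13 / 10 < y → φ y = 0)
    (h : ∀ y, √2 ^ degree 𝕂 * ∫ w : 𝕂, φ (y + ‖w‖ ^ 2) = profileBump y) (hR : 0 ≤ R) (σ : ℝ) :
    sphericalTransform (conv (radialFun (𝕂 := 𝕂) φ R) (check (radialFun φ R))) σ
      = (((∫ t, Real.exp (degree 𝕂 * σ * t) * coshBump R t) ^ 2 : ℝ) : ℂ) := by
  have hc := continuous_radialFun (𝕂 := 𝕂) hφ R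
  have ht := isTestFunction_radialFun (𝕂 := 𝕂) hφ hb R
  have hF : HasCompactSupport (conv (radialFun (𝕂 := 𝕂) φ R) (check (radialFun φ R))) :=
    (isCompact_heightBall (by linarith)).of_isClosed_subset (isClosed_tsupport _)
      (tsupport_conv_radialFun_subset hb hR)
  rw [check_radialFun] at hF ⊢
  rw [sphericalTransform_eq_integral_abelTransform (continuous_conv hc ht.2 hc) hF
    (ht.3.conv ht.3), ← integral_exp_mul_integral_coshBump hR]
  refine integral_congr_ae (.of_forall fun t => ?_)
  simp only [abelTransform_conv_radialFun hφ hb h, mul_right_comm]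

/-- The squared normalization `e^{-ρR}` cancels the volume growth `e^{ρR}` of the support. -/
theorem norm_conv_radialFun_le (hb : ∀ y, 13 / 10 < y → φ y = 0) {M : ℝ}
    (hM : ∀ y, 0 ≤ y → |φ y| ≤ M) (g : SL(2, 𝕂)) :
    ‖conv (radialFun (𝕂 := 𝕂) φ R) (check (radialFun φ R)) g‖
      ≤ M ^ 2 * (2 * (13 / 5) ^ degree 𝕂 * (volume (Metric.ball (0 : 𝕂) 1)).toReal) := by
  refine (norm_conv_check_le (b := Real.exp (-(degree 𝕂 * R / 2)) * M)
    (X := 13 / 10 * Real.exp R) (by positivity) (fun g => ?_)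
    (fun g => coshHeight_le_of_radialFun_ne_zero hb) g).trans (le_of_eq ?_)
  · rw [radialFun, Complex.norm_real, norm_mul, Real.norm_of_nonneg (Real.exp_pos _).le]
    exact mul_le_mul_of_nonneg_left (hM _ (mul_nonneg (Real.exp_pos _).le
      (zero_le_one.trans (one_le_coshHeight g)))) (Real.exp_pos _).le
  · have h1 : Real.exp (-(degree 𝕂 * R / 2)) ^ 2 * Real.exp R ^ degree 𝕂 = 1 := by
      rw [← Real.exp_nat_mul, ← Real.exp_nat_mul, ← Real.exp_add, Real.exp_eq_one_iff]
      push_cast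
      ring
    rw [show 2 * (13 / 10 * Real.exp R) = 13 / 5 * Real.exp R by ring, mul_pow, mul_pow]
    linear_combination (M ^ 2 * (2 * (13 / 5) ^ degree 𝕂 *
      (volume (Metric.ball (0 : 𝕂) 1)).toReal)) * h1

theorem exists_abs_le_of_forall_gt_eq_zero (hφ : Continuous φ) {b : ℝ} (hb : ∀ y, b < y → φ y = 0) :
    ∃ M, ∀ y, 0 ≤ y → |φ y| ≤ M := by
  obtain ⟨M, hM⟩ := (isCompact_Icc (a := 0) (b := b)).exists_bound_of_continuousOn hφ.continuousOn
  refine ⟨max M 0, fun y hy => ?_⟩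
  rcases le_or_gt y b with h | h
  · exact (hM y ⟨hy, h⟩).trans (le_max_left _ _)
  · simp [hb y h]

/-- The common shape of the conclusion for `𝕂 = ℝ` and `𝕂 = ℂ`, given a solution `φ` of the
equation expressing that the Abel transform of the radial function with profile `φ` is
`profileBump`, and a bound for orbital integrals in terms of the Abel transform. -/
theorem exists_testFunction_of_profile (hφ : ContDiff ℝ ∞ φ) (hb : ∀ y, 13 / 10 < y → φ y = 0)
    (h : ∀ y, √2 ^ degree 𝕂 * ∫ w : 𝕂, φ (y + ‖w‖ ^ 2) = profileBump y)
    {A : ℝ} (horb : ∀ f : SL(2, 𝕂) → ℂ, Continuous f → IsSpherical f →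
      (∀ t, ‖abelTransform f t‖ ≤ 2) → ∀ γ : SL(2, 𝕂), IsRegularSemisimple γ →
        modulus (weylDisc γ) ^ (1 / 2 : ℝ) * ‖orbitalIntegral γ f‖ ≤ A) :
    ∃ C₀ : ℝ, ∀ C, C₀ ≤ C → ∀ R : ℝ, 0 ≤ R →
      ∃ u : SL(2, 𝕂) → ℂ, IsTestFunction u ∧
        IsSpherical (conv u (check u)) ∧
        IsPositiveDefinite (conv u (check u)) ∧
        (∀ σ : ℝ, σ ∈ Set.Icc (-1) 1 →
          (sphericalTransform (conv u (check u)) σ).im = 0 ∧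
          Real.log (12 / 11) ^ 2 * Real.exp (2 * degree 𝕂 * R * |σ|) ≤
            (sphericalTransform (conv u (check u)) σ).re) ∧
        tsupport (conv u (check u)) ⊆ heightBall 𝕂 (2 * R + 2) ∧
        (∀ g, ‖conv u (check u) g‖ ≤ C) ∧
        ∀ γ : SL(2, 𝕂), IsRegularSemisimple γ →
          modulus (weylDisc γ) ^ (1 / 2 : ℝ) * ‖orbitalIntegral γ (conv u (check u))‖ ≤ C := by
  obtain ⟨M, hM⟩ := exists_abs_le_of_forall_gt_eq_zero hφ.continuous hb
  refine ⟨max (M ^ 2 * (2 * (13 / 5) ^ degree 𝕂 * (volume (Metric.ball (0 : 𝕂) 1)).toReal)) A,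
    fun C hC R hR => ?_⟩
  have hc := continuous_radialFun (𝕂 := 𝕂) hφ R
  have ht := isTestFunction_radialFun (𝕂 := 𝕂) hφ hb R
  refine ⟨radialFun φ R, ht, ht.3.conv ht.3.check, isPositiveDefinite_conv_check hc ht.2,
    fun σ _ => ?_, tsupport_conv_radialFun_subset hb hR,
    fun g => (norm_conv_radialFun_le hb hM g).trans ((le_max_left _ _).trans hC),
    fun γ hγ => (horb _ (continuous_conv hc ht.2 (continuous_check hc)) (ht.3.conv ht.3.check)
      (fun t => ?_) γ hγ).trans ((le_max_right _ _).trans hC)⟩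
  · rw [sphericalTransform_conv_radialFun hφ hb h hR, Complex.ofReal_im, Complex.ofReal_re]
    refine ⟨rfl, ?_⟩
    have hlog : 0 ≤ Real.log (12 / 11) := Real.log_nonneg (by norm_num)
    have h1 := pow_le_pow_left₀ (mul_nonneg hlog (Real.exp_pos _).le)
      (le_integral_exp_mul_coshBump hR (degree 𝕂 * σ)) 2
    refine le_trans (le_of_eq ?_) h1
    rw [mul_pow, ← Real.exp_nat_mul, abs_mul, Nat.abs_cast]
    push_cast
    ring_nf
  · rw [check_radialFun, abelTransform_conv_radialFun hφ hb h]
    exact norm_integral_coshBump_mul_le hR t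

end RadialTest

/-! ### Orbital integrals bounded by the supremum of the Abel transform. -/

section OrbitalBounds

/-- The discriminant always has a square root in `ℂ`, so every regular semisimple element is split.
-/
theorem norm_orbitalIntegral_complex_le {f : SL(2, ℂ) → ℂ} (hf : Continuous f) (hs : IsSpherical f)
    {A : ℝ} (hA : ∀ t, ‖abelTransform f t‖ ≤ A) {γ : SL(2, ℂ)} (hγ : IsRegularSemisimple γ) :
    modulus (weylDisc γ) ^ (1 / 2 : ℝ) * ‖orbitalIntegral γ f‖ ≤ A := by
  obtain ⟨δ, hδ⟩ := IsAlgClosed.exists_pow_nat_eq (weylDisc γ) (n := 2) two_pos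
  have hδ0 : δ ≠ 0 := fun h0 => hγ (by rw [← hδ, h0]; simp)
  obtain ⟨t, ht⟩ := exists_orbitalIntegral_eq_abelTransform hγ
    (exists_conj_mem_diagSubgroup hδ0 hδ) hf hs
  exact ht.trans_le (hA t)

/-- Over `ℝ` the sign of the discriminant decides: positive means split, and negative means
conjugate into `K`. -/
theorem norm_orbitalIntegral_real_le {f : SL(2, ℝ) → ℂ} (hf : Continuous f) (hs : IsSpherical f)
    {A : ℝ} (hA : ∀ t, ‖abelTransform f t‖ ≤ A) {γ : SL(2, ℝ)} (hγ : IsRegularSemisimple γ) :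
    modulus (weylDisc γ) ^ (1 / 2 : ℝ) * ‖orbitalIntegral γ f‖ ≤ 2 * Real.pi * A := by
  by_cases hd : ∃ p : SL(2, ℝ), p⁻¹ * γ * p ∈ diagSubgroup ℝ
  · obtain ⟨t, ht⟩ := exists_orbitalIntegral_eq_abelTransform hγ hd hf hs
    have hA0 : 0 ≤ A := (norm_nonneg _).trans (hA t)
    exact (ht.trans_le (hA t)).trans (by nlinarith [Real.pi_gt_three])
  · have hneg : weylDisc γ < 0 := by
      by_contra! h
      have h0 : 0 < weylDisc γ := lt_of_le_of_ne h (Ne.symm hγ)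
      exact hd (exists_conj_mem_diagSubgroup (Real.sqrt_pos.2 h0).ne' (Real.sq_sqrt h))
    obtain ⟨p, hp, hO⟩ := orbitalIntegral_of_elliptic hd (exists_conj_mem_maxCompact hneg) hf
    have hw : weylDisc (p⁻¹ * γ * p) = weylDisc γ := weylDisc_conj γ p
    rw [hO, ← hw]
    exact norm_orbitalIntegral_elliptic_le hp (by rw [hw]; exact hγ) hf hs hA

end OrbitalBounds

end

end SphericalSL2

open SphericalSL2 in
theorem mainTheorem3 :
    ∃ c C : ℝ, 0 < c ∧ 0 < C ∧ ∀ R : ℝ, 0 ≤ R →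
      (∃ u : SL(2, ℝ) → ℂ, IsTestFunction u ∧
        IsSpherical (conv u (check u)) ∧
        IsPositiveDefinite (conv u (check u)) ∧
        (∀ σ : ℝ, σ ∈ Set.Icc (-1) 1 →
          (sphericalTransform (conv u (check u)) σ).im = 0 ∧
          c * Real.exp (2 * degree ℝ * R * |σ|) ≤
            (sphericalTransform (conv u (check u)) σ).re) ∧
        tsupport (conv u (check u)) ⊆ heightBall ℝ (2 * R + 2) ∧
        (∀ g, ‖conv u (check u) g‖ ≤ C) ∧
        ∀ γ : SL(2, ℝ), IsRegularSemisimple γ →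
          modulus (weylDisc γ) ^ (1 / 2 : ℝ) * ‖orbitalIntegral γ (conv u (check u))‖ ≤ C) ∧
      (∃ u : SL(2, ℂ) → ℂ, IsTestFunction u ∧
        IsSpherical (conv u (check u)) ∧
        IsPositiveDefinite (conv u (check u)) ∧
        (∀ σ : ℝ, σ ∈ Set.Icc (-1) 1 →
          (sphericalTransform (conv u (check u)) σ).im = 0 ∧
          c * Real.exp (2 * degree ℂ * R * |σ|) ≤
            (sphericalTransform (conv u (check u)) σ).re) ∧
        tsupport (conv u (check u)) ⊆ heightBall ℂ (2 * R + 2) ∧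
        (∀ g, ‖conv u (check u) g‖ ≤ C) ∧
        ∀ γ : SL(2, ℂ), IsRegularSemisimple γ →
          modulus (weylDisc γ) ^ (1 / 2 : ℝ) * ‖orbitalIntegral γ (conv u (check u))‖ ≤ C) := by
  have hη : ContDiff ℝ ∞ profileBump := profileBump.contDiff
  have hb : ∀ y, 13 / 10 < y → profileBump y = 0 := fun y hy => by
    by_contra h
    exact (mem_Ioo_of_profileBump_ne_zero h).2.not_gt hy
  obtain ⟨φ, hφ, hφb, hφη⟩ := exists_profile_real hη hb
  obtain ⟨ψ, hψ, hψb, hψη⟩ := exists_profile_complex hη hb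
  obtain ⟨A, hA⟩ := exists_testFunction_of_profile hφ hφb hφη
    fun f hf hs hA γ hγ => norm_orbitalIntegral_real_le hf hs hA hγ
  obtain ⟨B, hB⟩ := exists_testFunction_of_profile hψ hψb hψη
    fun f hf hs hA γ hγ => norm_orbitalIntegral_complex_le hf hs hA hγ
  exact ⟨Real.log (12 / 11) ^ 2, max 1 (max A B), pow_pos (Real.log_pos (by norm_num)) 2,
    lt_max_of_lt_left one_pos, fun R hR =>
      ⟨hA _ ((le_max_left _ _).trans (le_max_right _ _)) R hR,
        hB _ ((le_max_right _ _).trans (le_max_right _ _)) R hR⟩⟩
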